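/- Let $h_k(x)=e^{x^2/2}\frac{(-1)^k}{\sqrt{k!\,2^k\sqrt{\pi}}}\frac{d^k}{dx^k}e^{-x^2}$ be the Hermite functions and, for $N>0$, let $\varphi_k(x)=\sqrt{\tfrac{\pi\sqrt N}{\sqrt 2}}\;h_k\!\big(x\tfrac{\pi\sqrt N}{\sqrt 2}\big)$. Let $\Psi:\mathbb{R}\to[0,1]$ be a differentiable function such that $\Psi'\le 0$ is Riemann integrable, $\Psi\in L^1(0,\infty)$, $1-\Psi\in L^1(-\infty,0)$, and such that $\Phi=-\Psi'$ satisfies $\Phi(x)\le e^{-c|x|}$ for all $x\in\mathbb{R}$ and some $c>0$. Let $0<\alpha<1$ and $\tau>0$, and for every $N>0$ consider the determinantal point process on $\mathbb{R}$ (with respect to Lebesgue measure) with points $(X_i)$ and correlation kernel $$K^N_{\Psi,\alpha}(x,y)=\sum_{k=0}^\infty \Psi\Big(\frac{k-N}{\tau N^\alpha}\Big)\varphi_k(x)\varphi_k(y).$$ Write $\hat g(u)=\int_{\mathbb{R}} g(x)e^{-2\pi i x u}\,dx$. Let $f\in L^2(\mathbb{R})$ be real-valued with compact support and $\int_{\mathbb{R}}|\hat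 f(u)|^2|u|\,du<\infty$ (that is, $f\in H^{1/2}(\mathbb{R})$ with compact support), and let $\Xi f_\alpha=\sum_i f(X_iN^\alpha)$. Then $\Xi f_\alpha$ has a finite variance for every $N>0$ and, with $\tau'=\tau/4$ and $B^2_\Psi=\int_{\mathbb{R}}\Psi(t)(1-\Psi(t))\,dt$, $$\lim_{N\to\infty}\operatorname{Var}_{K^N_{\Psi,\alpha}}[\Xi f_\alpha]=2\tau'\int_{\mathbb{R}}|\hat f(u)|^2\int_{\mathbb{R}}\Psi(t)\big(1-\Psi(t+u/\tau')\big)\,dt\,du$$ $$=2\tau' B^2_\Psi\int_{\mathbb{R}} f(x)^2\,dx+\frac1{4\pi^2}\iint_{\mathbb{R}^2}\left|\frac{f(x)-f(y)}{x-y}\right|^2\big|\hat\Phi(\tau'(x-y))\big|^2\,dx\,dy,$$ where all the integrals converge absolutely. -/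

import Mathlib

open MeasureTheory ProbabilityTheory Filter Topology
open scoped FourierTransform ENNReal

noncomputable section

/-! ## Point processes on the line -/

/-- A random point configuration on `ℝ` without multiple points and without accumulation
points: a random set of points that is finite in every compact set, such that the number of
points in every Borel set is a random variable. -/
structure PointProcess (Ω : Type*) [MeasurableSpace Ω] where
  /-- the set of points of the configuration -/
  points : Ω → Set ℝ
  finite_inter : ∀ (ω : Ω) (C : Set ℝ), IsCompact C → (points ω ∩ C).Finite
  measurable_count : ∀ B : Set ℝ, MeasurableSet B →
    Measurable fun ω => ((points ω ∩ B).encard : ℝ≥0∞)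

/-- The linear statistic `Ξ f = ∑ᵢ f (Xᵢ)`. It is a finite sum when `f` has compact support. -/
def PointProcess.linearStatistic {Ω : Type*} [MeasurableSpace Ω] (X : PointProcess Ω)
    (f : ℝ → ℝ) (ω : Ω) : ℝ :=
  ∑ᶠ x ∈ X.points ω, f x

/-- `ρ` is the `k`-point correlation function (with respect to Lebesgue measure) of the
point process `X` under `P`: it is almost everywhere nonnegative, and for every measurable
`F : ℝᵏ → [0, ∞]`, the expected sum of `F` over all `k`-tuples of distinct points of the
configuration is `∫ F ρ`. -/
def PointProcess.IsCorrelationFunction {Ω : Type*} [MeasurableSpace Ω] (X : PointProcess Ω)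
    (P : Measure Ω) (k : ℕ) (ρ : (Fin k → ℝ) → ℝ) : Prop :=
  (∀ᵐ x : Fin k → ℝ, 0 ≤ ρ x) ∧
  ∀ F : (Fin k → ℝ) → ℝ≥0∞, Measurable F →
    ∫⁻ ω, ∑' x : {x : Fin k → ℝ // Function.Injective x ∧ ∀ i, x i ∈ X.points ω}, F x.1 ∂P
      = ∫⁻ x : Fin k → ℝ, F x * ENNReal.ofReal (ρ x)

/-- `X` is, under `P`, a determinantal process with correlation kernel `K`. -/
def PointProcess.IsDeterminantal {Ω : Type*} [MeasurableSpace Ω] (X : PointProcess Ω)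
    (P : Measure Ω) (K : ℝ → ℝ → ℝ) : Prop :=
  ∀ k : ℕ, X.IsCorrelationFunction P k fun x => (Matrix.of fun i j => K (x i) (x j)).det

/-! ## Shapes -/

/-- Riemann integrability on every compact interval. -/
def IsLocallyRiemannIntegrable (g : ℝ → ℝ) : Prop :=
  ∀ (a b : ℝ) (hab : a < b),
    BoxIntegral.Integrable
      (⟨fun _ => a, fun _ => b, fun _ => hab⟩ : BoxIntegral.Box (Fin 1))
      BoxIntegral.IntegrationParams.Riemann (fun x => g (x 0))
      BoxIntegral.BoxAdditiveMap.volume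

/-- The class `𝔉` of shapes. As `Ψ` is monotone and takes values in `[0, 1]`, the improper
Riemann integral of `Ψ'` over the line converges as soon as `Ψ'` is Riemann integrable on
compact intervals. -/
structure IsShape (Ψ : ℝ → ℝ) : Prop where
  mem_Icc : ∀ t, Ψ t ∈ Set.Icc (0 : ℝ) 1
  differentiable : Differentiable ℝ Ψ
  deriv_nonpos : ∀ t, deriv Ψ t ≤ 0
  deriv_riemann : IsLocallyRiemannIntegrable (deriv Ψ)
  integrableOn_Ioi : IntegrableOn Ψ (Set.Ioi 0)
  integrableOn_Iio : IntegrableOn (fun t => 1 - Ψ t) (Set.Iio 0)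

/-- The density `Φ = -Ψ'` of a shape. -/
def shapeDensity (Ψ : ℝ → ℝ) (t : ℝ) : ℝ := -deriv Ψ t

/-- The class `𝔉'` of shapes whose density satisfies `Φ(x) ≤ exp (-c |x|)` for some `c > 0`. -/
structure IsExpShape (Ψ : ℝ → ℝ) : Prop extends IsShape Ψ where
  density_le : ∃ c : ℝ, 0 < c ∧ ∀ x, shapeDensity Ψ x ≤ Real.exp (-c * |x|)

/-- The constant `B²_Ψ = ∫ Ψ (1 - Ψ)`. -/
def shapeB2 (Ψ : ℝ → ℝ) : ℝ := ∫ t, Ψ t * (1 - Ψ t)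

/-! ## The kernel of the modified GUE -/

/-- The Hermite functions
`hₙ(x) = exp(x²/2) (-1)ⁿ / √(n! 2ⁿ √π) * (d/dx)ⁿ exp(-x²)`. -/
def hermiteFun (n : ℕ) (x : ℝ) : ℝ :=
  Real.exp (x ^ 2 / 2) * ((-1) ^ n / √((n.factorial : ℝ) * 2 ^ n * √Real.pi))
    * iteratedDeriv n (fun y : ℝ => Real.exp (-y ^ 2)) x

/-- The rescaled Hermite functions `φ_k(x) = √(π√N/√2) h_k(x π√N/√2)`. -/
def rescaledHermite (N : ℝ) (k : ℕ) (x : ℝ) : ℝ :=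
  √(Real.pi * √N / √2) * hermiteFun k (x * (Real.pi * √N / √2))

/-- The correlation kernel of the modified GUE with shape `Ψ`, modification scale `α`,
temperature `τ` and density `N`. -/
def modifiedGUEKernel (Ψ : ℝ → ℝ) (α τ N : ℝ) (x y : ℝ) : ℝ :=
  ∑' k : ℕ, Ψ (((k : ℝ) - N) / (τ * N ^ α)) * rescaledHermite N k x * rescaledHermite N k y

/-! ## Test functions -/

/-- The Fourier transform `u ↦ ∫ g(x) exp(-2πi x u) dx` of a real-valued function. -/
def realFourier (g : ℝ → ℝ) (u : ℝ) : ℂ := 𝓕 (fun x : ℝ => (g x : ℂ)) u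

/-- The real-valued functions with compact support in `H^{1/2}(ℝ)`: square integrable (hence,
by compactness of the support, integrable), with `∫ |f̂(u)|² |u| du < ∞`. -/
structure IsHHalfCompact (f : ℝ → ℝ) : Prop where
  memLp : MemLp f 2
  hasCompactSupport : HasCompactSupport f
  integrable_fourier : Integrable fun u : ℝ => ‖realFourier f u‖ ^ 2 * |u|

/-- The rescaled test function `f_δ(x) = f(x N^δ)`. -/
def rescaledTest (f : ℝ → ℝ) (δ N : ℝ) (x : ℝ) : ℝ := f (x * N ^ δ)

end

/-! ## Hermite functions: algebra -/

/-! The kernel is diagonal in an orthonormal basis, with weights p_k = Ψ((k-N)/(τN^α)) in [0,1].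
Parseval gives ∫ K(x,y)² dy = Σ p_k² φ_k(x)². Hence the determinantal variance ∫ f² K(x,x) - ∬ f(x)
f(y) K² equals ∫ f² Σ p_k(1-p_k) φ_k² plus ½ ∬ (f(x)-f(y))² K² (`variance_functional_eq`). The two
terms are treated separately, in coordinates magnified by N^α.

Both rest on one asymptotic statement, `tendsto_hermiteFun_sub_cos`: for k = N + rN^α + o(N^α) and
fixed x, the normalized Hermite function is a cosine of phase θ_N(x) + rπx/2 - kπ/2, where θ_N does
not depend on k. It follows from the oscillator equation h'' = -(2k+1-x²)h by variation of constants
(`hermiteFun_wkb`), with the amplitude at the origin given by Wallis' product and a priori bounds by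
Sonin's inequality.

Diagonal term: cos² averages to 1/2 because θ_N turns at rate about πN^(1-α), and the sum over k is
a Riemann sum of Ψ(1-Ψ). The limit is (τ/2) B² ∫ f².

Off-diagonal term: summation by parts in the Christoffel-Darboux formula writes (x-y)K as Σ (p_k -
p_{k+1}) W_k, where p_k - p_{k+1} is the mass that Φ gives to a cell of length 1/(τN^α)
(`sub_mul_oscKernel_eq_integral`). Since W_k is close to (1/π) sin(θ_N(x) - θ_N(y) + τtπ(x-y)/2),
the kernel (x-y)K is close to (1/π) Im(e^{i(θ_N(x)-θ_N(y))} χ(x-y)), where |χ(z)| = |Φ̂(τz/4)|. Its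
square is |χ|²/(2π²) plus a term oscillating like e^{2i(θ_N(x)-θ_N(y))}, which a Riemann-Lebesgue
argument removes. The integrable majorant is the difference quotient ((f(x)-f(y))/(x-y))², whose
integral is the H^{1/2} seminorm. Pointwise asymptotics hold only on bounded squares; far away an L²
bound on (x-y)K, uniform in N, makes the contribution small.

The two forms of the limit agree by Plancherel (`integrable_and_limit_eq`): with D(v) = ∫
Ψ(t)(1-Ψ(t+v)) dt one has D(v) + D(-v) = 2B² + ‖Ψ(·+v) - Ψ‖², |f̂|² is even, and the squared
distance is ∫ sin²(πvξ)/(π²ξ²) |Φ̂(ξ)|² dξ, the same sine that appears when the difference quotient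
of f is written through f̂. -/

theorem hasDerivAt_iteratedDeriv_gauss (n : ℕ) (x : ℝ) :
    HasDerivAt (iteratedDeriv n (fun y : ℝ => Real.exp (-y ^ 2)))
      (iteratedDeriv (n + 1) (fun y : ℝ => Real.exp (-y ^ 2)) x) x := by
  have h : ContDiff ℝ (⊤ : ℕ∞) (fun y : ℝ => Real.exp (-y ^ 2)) := by fun_prop
  rw [iteratedDeriv_succ]
  exact ((h.differentiable_iteratedDeriv n (by exact_mod_cast WithTop.coe_lt_top _)) x).hasDerivAt

theorem iteratedDeriv_gauss_rec (n : ℕ) (x : ℝ) :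
    iteratedDeriv (n + 2) (fun y : ℝ => Real.exp (-y ^ 2)) x
      = -2 * x * iteratedDeriv (n + 1) (fun y : ℝ => Real.exp (-y ^ 2)) x
        - 2 * (n + 1) * iteratedDeriv n (fun y : ℝ => Real.exp (-y ^ 2)) x := by
  have h1 : ∀ x : ℝ, iteratedDeriv 1 (fun y : ℝ => Real.exp (-y ^ 2)) x
      = -2 * x * Real.exp (-x ^ 2) := by
    intro x
    rw [iteratedDeriv_one]
    have : HasDerivAt (fun y : ℝ => Real.exp (-y ^ 2)) (Real.exp (-x ^ 2) * (-(2 * x))) x := by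
      simpa using ((hasDerivAt_pow 2 x).neg).exp
    rw [this.deriv]; ring
  induction n generalizing x with
  | zero =>
    have h2 := hasDerivAt_iteratedDeriv_gauss 1 x
    have h3 : HasDerivAt (iteratedDeriv 1 (fun y : ℝ => Real.exp (-y ^ 2)))
        (-2 * Real.exp (-x ^ 2) +
          -2 * x * iteratedDeriv 1 (fun y : ℝ => Real.exp (-y ^ 2)) x) x := by
      rw [show iteratedDeriv 1 (fun y : ℝ => Real.exp (-y ^ 2))
        = fun x => -2 * x * Real.exp (-x ^ 2) from funext h1]
      have h4 := hasDerivAt_iteratedDeriv_gauss 0 x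
      rw [iteratedDeriv_zero] at h4
      have := ((hasDerivAt_id x).const_mul (-2)).mul h4
      refine this.congr_deriv ?_
      simp only [id, h1]; ring
    have := h2.unique h3
    simp only [Nat.cast_zero, iteratedDeriv_zero, zero_add] at this ⊢
    rw [this]; ring
  | succ n ih =>
    have h2 := hasDerivAt_iteratedDeriv_gauss (n + 2) x
    have h3 := (((hasDerivAt_id x).const_mul (-2)).mul
      (hasDerivAt_iteratedDeriv_gauss (n + 1) x)).sub
      ((hasDerivAt_iteratedDeriv_gauss n x).const_mul (2 * ((n : ℝ) + 1)))
    have h4 : iteratedDeriv (n + 2) (fun y : ℝ => Real.exp (-y ^ 2)) = fun x =>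
      -2 * x * iteratedDeriv (n + 1) (fun y : ℝ => Real.exp (-y ^ 2)) x
        - 2 * (n + 1) * iteratedDeriv n (fun y : ℝ => Real.exp (-y ^ 2)) x := funext ih
    rw [h4] at h2
    have := h2.unique h3
    simp only [id] at this
    rw [this]; push_cast; ring

theorem hermite_norm_succ (n : ℕ) :
    √(((n + 1).factorial : ℝ) * 2 ^ (n + 1) * √Real.pi)
      = √(2 * (n + 1)) * √((n.factorial : ℝ) * 2 ^ n * √Real.pi) := by
  rw [← Real.sqrt_mul (by positivity), Nat.factorial_succ]
  congr 1; push_cast; ring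

theorem hermite_norm_pos (n : ℕ) : 0 < √((n.factorial : ℝ) * 2 ^ n * √Real.pi) := by
  have := Real.pi_pos
  positivity

theorem hermiteFun_zero (x : ℝ) :
    hermiteFun 0 x = (√(√Real.pi))⁻¹ * Real.exp (-x ^ 2 / 2) := by
  simp only [hermiteFun, pow_zero, Nat.factorial_zero, Nat.cast_one, one_mul, iteratedDeriv_zero]
  have : Real.exp (-x ^ 2 / 2) = Real.exp (x ^ 2 / 2) * Real.exp (-x ^ 2) := by
    rw [← Real.exp_add]; congr 1; ring
  rw [this]; ring

/-- The raising relation. Combined with the three-term recurrence it gives the lowering relation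
`hasDerivAt_hermiteFun_succ`, and the two together give the oscillator equation
`hasDerivAt_deriv_hermiteFun`, the source of all the asymptotics. -/
theorem hasDerivAt_hermiteFun (n : ℕ) (x : ℝ) :
    HasDerivAt (hermiteFun n)
      (x * hermiteFun n x - √(2 * (n + 1)) * hermiteFun (n + 1) x) x := by
  have h1 : HasDerivAt (fun x : ℝ => Real.exp (x ^ 2 / 2)) (Real.exp (x ^ 2 / 2) * x) x := by
    have : HasDerivAt (fun x : ℝ => x ^ 2 / 2) x x := by
      have := (hasDerivAt_pow 2 x).div_const 2
      simpa using this
    exact this.exp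
  have h2 := (h1.mul_const ((-1) ^ n / √((n.factorial : ℝ) * 2 ^ n * √Real.pi))).mul
    (hasDerivAt_iteratedDeriv_gauss n x)
  have h3 := hermite_norm_pos n
  have h4 : 0 < √(2 * ((n : ℝ) + 1)) := by positivity
  refine h2.congr_deriv ?_
  simp only [hermiteFun, hermite_norm_succ]
  field_simp
  ring

theorem hermiteFun_rec (n : ℕ) (x : ℝ) :
    √(2 * (n + 2)) * hermiteFun (n + 2) x
      = 2 * x * hermiteFun (n + 1) x - √(2 * (n + 1)) * hermiteFun n x := by
  have h3 := hermite_norm_pos n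
  have h4 : 0 < √(2 * ((n : ℝ) + 1)) := by positivity
  have h5 : 0 < √(2 * ((n : ℝ) + 1 + 1)) := by positivity
  have h6 : √(2 * ((n : ℝ) + 1)) ^ 2 = 2 * (n + 1) := Real.sq_sqrt (by positivity)
  simp only [hermiteFun, iteratedDeriv_gauss_rec, hermite_norm_succ]
  rw [show (n : ℝ) + 2 = n + 1 + 1 by ring]
  push_cast
  field_simp
  rw [h6]
  ring

theorem hasDerivAt_hermiteFun_zero (x : ℝ) :
    HasDerivAt (hermiteFun 0) (-x * hermiteFun 0 x) x := by
  rw [show hermiteFun 0 = _ from funext hermiteFun_zero]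
  have : HasDerivAt (fun x : ℝ => -x ^ 2 / 2) (-x) x := by
    refine ((hasDerivAt_pow 2 x).neg.div_const 2).congr_deriv ?_
    norm_num; ring
  refine (this.exp.const_mul _).congr_deriv ?_
  ring

theorem hasDerivAt_hermiteFun_succ (n : ℕ) (x : ℝ) :
    HasDerivAt (hermiteFun (n + 1))
      (√(2 * (n + 1)) * hermiteFun n x - x * hermiteFun (n + 1) x) x := by
  refine (hasDerivAt_hermiteFun (n + 1) x).congr_deriv ?_
  have := hermiteFun_rec n x
  push_cast
  rw [show (n : ℝ) + 1 + 1 = n + 2 by ring, this]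
  ring

theorem continuous_hermiteFun (n : ℕ) : Continuous (hermiteFun n) :=
  continuous_iff_continuousAt.2 fun x => (hasDerivAt_hermiteFun n x).continuousAt

theorem deriv_hermiteFun (n : ℕ) (x : ℝ) :
    deriv (hermiteFun n) x = x * hermiteFun n x - √(2 * (n + 1)) * hermiteFun (n + 1) x :=
  (hasDerivAt_hermiteFun n x).deriv

theorem hasDerivAt_deriv_hermiteFun (n : ℕ) (x : ℝ) :
    HasDerivAt (deriv (hermiteFun n)) (-(2 * n + 1 - x ^ 2) * hermiteFun n x) x := by
  rw [show deriv (hermiteFun n) = _ from funext (deriv_hermiteFun n)]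
  have h1 := ((hasDerivAt_id x).mul (hasDerivAt_hermiteFun n x)).sub
    ((hasDerivAt_hermiteFun_succ n x).const_mul √(2 * ((n : ℝ) + 1)))
  have h6 : √(2 * ((n : ℝ) + 1)) ^ 2 = 2 * (n + 1) := Real.sq_sqrt (by positivity)
  refine h1.congr_deriv ?_
  simp only [id]
  linear_combination -hermiteFun n x * h6

/-! ## Decay and orthonormality -/

theorem exists_pow_mul_hermiteFun_le (n m : ℕ) :
    ∃ C : ℝ, ∀ x, |x ^ m * hermiteFun n x| ≤ C := by
  have h0 : ∀ m : ℕ, ∃ C : ℝ, ∀ x, |x ^ m * hermiteFun 0 x| ≤ C := by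
    intro m
    refine ⟨(√(√Real.pi))⁻¹ * (m.factorial * Real.exp (1 / 2)), fun x => ?_⟩
    rw [hermiteFun_zero, abs_mul, abs_mul, abs_of_nonneg (Real.exp_pos _).le,
      abs_of_nonneg (by positivity : 0 ≤ (√(√Real.pi))⁻¹), abs_pow]
    have h1 : |x| ^ m ≤ m.factorial * Real.exp |x| := by
      have := Real.pow_div_factorial_le_exp |x| (abs_nonneg x) m
      rwa [div_le_iff₀' (by positivity)] at this
    have h2 : Real.exp |x| * Real.exp (-x ^ 2 / 2) ≤ Real.exp (1 / 2) := by
      rw [← Real.exp_add]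
      apply Real.exp_le_exp.2
      nlinarith [sq_nonneg (|x| - 1), sq_abs x]
    calc |x| ^ m * ((√√Real.pi)⁻¹ * Real.exp (-x ^ 2 / 2))
        ≤ (m.factorial * Real.exp |x|) * ((√√Real.pi)⁻¹ * Real.exp (-x ^ 2 / 2)) := by gcongr
      _ = (√√Real.pi)⁻¹ * (m.factorial * (Real.exp |x| * Real.exp (-x ^ 2 / 2))) := by ring
      _ ≤ _ := by gcongr
  -- The recurrence has order two and costs one power of x, so the induction carries two consecutive
  -- indices and all powers at once.
  have key : ∀ n : ℕ, (∀ m : ℕ, ∃ C : ℝ, ∀ x, |x ^ m * hermiteFun n x| ≤ C) ∧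
      (∀ m : ℕ, ∃ C : ℝ, ∀ x, |x ^ m * hermiteFun (n + 1) x| ≤ C) := by
    intro n
    induction n with
    | zero =>
      refine ⟨h0, fun m => ?_⟩
      obtain ⟨C, hC⟩ := h0 (m + 1)
      refine ⟨2 * C / √(2 * (0 + 1)), fun x => ?_⟩
      have h1 := (hasDerivAt_hermiteFun 0 x).unique (hasDerivAt_hermiteFun_zero x)
      have h2 : √(2 * (0 + 1)) * hermiteFun 1 x = 2 * x * hermiteFun 0 x := by
        simp only [Nat.cast_zero, zero_add] at h1 ⊢
        linarith
      rw [le_div_iff₀ (by positivity), ← abs_of_nonneg (by positivity : 0 ≤ √(2 * (0 + 1) : ℝ)),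
        ← abs_mul]
      have h3 : x ^ m * hermiteFun (0 + 1) x * √(2 * (0 + 1)) = 2 * (x ^ (m + 1) * hermiteFun 0 x) := by
        linear_combination x ^ m * h2
      rw [h3, abs_mul, abs_two]
      linarith [hC x]
    | succ n ih =>
      refine ⟨ih.2, fun m => ?_⟩
      obtain ⟨C, hC⟩ := ih.2 (m + 1)
      obtain ⟨D, hD⟩ := ih.1 m
      refine ⟨(2 * C + √(2 * (n + 1)) * D) / √(2 * (n + 2)), fun x => ?_⟩
      rw [le_div_iff₀ (by positivity), ← abs_of_nonneg (by positivity : 0 ≤ √(2 * (n + 2) : ℝ)),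
        ← abs_mul]
      have h3 : x ^ m * hermiteFun (n + 2) x * √(2 * (n + 2))
          = 2 * (x ^ (m + 1) * hermiteFun (n + 1) x)
            - √(2 * (n + 1)) * (x ^ m * hermiteFun n x) := by
        linear_combination x ^ m * hermiteFun_rec n x
      rw [h3]
      refine (abs_sub _ _).trans ?_
      rw [abs_mul, abs_mul √(2 * (n + 1) : ℝ), abs_two,
        abs_of_nonneg (by positivity : 0 ≤ √(2 * (n + 1) : ℝ))]
      gcongr
      exacts [hC x, hD x]
  exact (key n).1 m

theorem integrable_mul_hermiteFun {u : ℝ → ℝ} (hu : Continuous u) {m : ℕ} {A : ℝ}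
    (hA : ∀ x, |u x| ≤ A * (1 + |x| ^ m)) (n : ℕ) :
    Integrable fun x => u x * hermiteFun n x := by
  -- One bound for each of the four monomials in (1 + |x|^m)(1 + x²).
  obtain ⟨C0, h0⟩ := exists_pow_mul_hermiteFun_le n 0
  obtain ⟨C1, h1⟩ := exists_pow_mul_hermiteFun_le n 2
  obtain ⟨C2, h2⟩ := exists_pow_mul_hermiteFun_le n m
  obtain ⟨C3, h3⟩ := exists_pow_mul_hermiteFun_le n (m + 2)
  have hA0 : 0 ≤ A := by
    have := (abs_nonneg _).trans (hA 0)
    have h : (0:ℝ) < 1 + |(0:ℝ)| ^ m := by positivity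
    exact nonneg_of_mul_nonneg_left this h
  refine Integrable.mono' ((integrable_inv_one_add_sq).const_mul (A * (C0 + C1 + C2 + C3)))
    (hu.mul (continuous_hermiteFun n)).aestronglyMeasurable (Eventually.of_forall fun x => ?_)
  rw [← div_eq_mul_inv, le_div_iff₀ (by positivity), Real.norm_eq_abs, abs_mul]
  have e0 := h0 x
  have e1 := h1 x
  have e2 := h2 x
  have e3 := h3 x
  rw [abs_mul, abs_pow] at e0 e1 e2 e3
  have e4 : |x| ^ 2 = x ^ 2 := sq_abs x
  calc |u x| * |hermiteFun n x| * (1 + x ^ 2)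
      ≤ (A * (1 + |x| ^ m)) * |hermiteFun n x| * (1 + x ^ 2) := by gcongr; exact hA x
    _ = A * (|x| ^ 0 * |hermiteFun n x| + |x| ^ 2 * |hermiteFun n x| + |x| ^ m * |hermiteFun n x|
        + |x| ^ (m + 2) * |hermiteFun n x|) := by rw [← e4]; ring
    _ ≤ _ := by gcongr

theorem integrable_pow_mul_hermiteFun_mul (m j k : ℕ) :
    Integrable fun x => x ^ m * hermiteFun j x * hermiteFun k x := by
  obtain ⟨C, hC⟩ := exists_pow_mul_hermiteFun_le j m
  have hC0 : 0 ≤ C := (abs_nonneg _).trans (hC 0)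
  refine integrable_mul_hermiteFun (m := 0) (A := C)
    (u := fun x => x ^ m * hermiteFun j x)
    (((continuous_pow m)).mul (continuous_hermiteFun j)) (fun x => ?_) k
  have := hC x
  simp only [pow_zero] at this ⊢
  linarith

theorem integrable_hermiteFun_mul (j k : ℕ) :
    Integrable fun x => hermiteFun j x * hermiteFun k x := by
  simpa using integrable_pow_mul_hermiteFun_mul 0 j k

theorem integrable_id_mul_hermiteFun_mul (j k : ℕ) :
    Integrable fun x => x * hermiteFun j x * hermiteFun k x := by
  simpa using integrable_pow_mul_hermiteFun_mul 1 j k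

theorem integral_hermiteFun_deriv_mul (j k : ℕ) :
    ∫ x, (deriv (hermiteFun j) x * hermiteFun k x + hermiteFun j x * deriv (hermiteFun k) x) = 0 := by
  have hI : ∀ j k, Integrable fun x => deriv (hermiteFun j) x * hermiteFun k x := by
    intro j k
    simp only [deriv_hermiteFun]
    refine ((integrable_id_mul_hermiteFun_mul j k).sub
      ((integrable_hermiteFun_mul (j + 1) k).const_mul √(2 * (j + 1)))).congr
      (Eventually.of_forall fun x => ?_)
    simp only [Pi.sub_apply]; ring
  refine integral_eq_zero_of_hasDerivAt_of_integrable (f := fun x => hermiteFun j x * hermiteFun k x)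
    (fun x => ?_) ((hI j k).add ?_) (integrable_hermiteFun_mul j k)
  · have h1 := (hasDerivAt_hermiteFun j x)
    have h2 := (hasDerivAt_hermiteFun k x)
    rw [h1.deriv, h2.deriv]
    exact h1.mul h2
  · refine (hI k j).congr (Eventually.of_forall fun x => ?_)
    simp only []; ring

/-- Integration by parts: lowering on one factor is adjoint to raising on the other. This lowers
both indices of the Gram matrix by one, so orthonormality reduces to the first row and a Gaussian
integral. -/
theorem sqrt_mul_integral_hermiteFun_succ (j k : ℕ) :
    √(2 * (k + 1)) * ∫ x, hermiteFun (j + 1) x * hermiteFun (k + 1) x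
      = √(2 * (j + 1)) * ∫ x, hermiteFun j x * hermiteFun k x := by
  have h := integral_hermiteFun_deriv_mul (j + 1) k
  have e : ∀ x, deriv (hermiteFun (j + 1)) x * hermiteFun k x
      + hermiteFun (j + 1) x * deriv (hermiteFun k) x
      = √(2 * (j + 1)) * (hermiteFun j x * hermiteFun k x)
        - √(2 * (k + 1)) * (hermiteFun (j + 1) x * hermiteFun (k + 1) x) := by
    intro x
    rw [(hasDerivAt_hermiteFun_succ j x).deriv, deriv_hermiteFun]; ring
  simp_rw [e] at h
  rw [integral_sub ((integrable_hermiteFun_mul _ _).const_mul _)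
    ((integrable_hermiteFun_mul _ _).const_mul _), integral_const_mul, integral_const_mul] at h
  linarith

theorem integral_hermiteFun_zero_mul_succ (k : ℕ) :
    ∫ x, hermiteFun 0 x * hermiteFun (k + 1) x = 0 := by
  have h := integral_hermiteFun_deriv_mul 0 k
  have e : ∀ x, deriv (hermiteFun 0) x * hermiteFun k x
      + hermiteFun 0 x * deriv (hermiteFun k) x
      = - √(2 * (k + 1)) * (hermiteFun 0 x * hermiteFun (k + 1) x) := by
    intro x
    rw [(hasDerivAt_hermiteFun_zero x).deriv, deriv_hermiteFun]; ring
  simp_rw [e] at h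
  rw [integral_const_mul] at h
  have : √(2 * ((k : ℝ) + 1)) ≠ 0 := by positivity
  exact (mul_eq_zero.1 h).resolve_left (neg_ne_zero.2 this)

theorem integral_hermiteFun_mul (j k : ℕ) :
    ∫ x, hermiteFun j x * hermiteFun k x = if j = k then 1 else 0 := by
  induction j generalizing k with
  | zero =>
    cases k with
    | zero =>
      simp only [hermiteFun_zero, if_true]
      have e : ∀ x : ℝ, (√(√Real.pi))⁻¹ * Real.exp (-x ^ 2 / 2)
          * ((√(√Real.pi))⁻¹ * Real.exp (-x ^ 2 / 2)) = (√Real.pi)⁻¹ * Real.exp (-1 * x ^ 2) := by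
        intro x
        have h1 : Real.exp (-1 * x ^ 2) = Real.exp (-x ^ 2 / 2) * Real.exp (-x ^ 2 / 2) := by
          rw [← Real.exp_add]; congr 1; ring
        have h2 : (√Real.pi)⁻¹ = (√(√Real.pi))⁻¹ * (√(√Real.pi))⁻¹ := by
          rw [← mul_inv, Real.mul_self_sqrt (by positivity)]
        rw [h1, h2]; ring
      simp_rw [e]
      rw [integral_const_mul, integral_gaussian, div_one, inv_mul_cancel₀]
      have := Real.pi_pos
      positivity
    | succ k => simpa using integral_hermiteFun_zero_mul_succ k
  | succ j ih =>
    cases k with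
    | zero =>
      have := integral_hermiteFun_zero_mul_succ j
      simp_rw [mul_comm (hermiteFun 0 _)] at this
      simpa using this
    | succ k =>
      have h := sqrt_mul_integral_hermiteFun_succ j k
      rw [ih k] at h
      have h4 : √(2 * ((k : ℝ) + 1)) ≠ 0 := by positivity
      by_cases hjk : j = k
      · subst hjk
        rw [if_pos rfl] at h ⊢
        exact mul_left_cancel₀ h4 h
      · rw [if_neg hjk, mul_zero] at h
        rw [if_neg (by omega)]
        exact (mul_eq_zero.1 h).resolve_left h4

/-! ## Pointwise bounds and asymptotics of Hermite functions -/

theorem hasDerivAt_hermiteFun' (n : ℕ) (x : ℝ) :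
    HasDerivAt (hermiteFun n) (deriv (hermiteFun n) x) x :=
  (hasDerivAt_hermiteFun n x).differentiableAt.hasDerivAt

theorem integrable_hermiteFun_mul_deriv (j k : ℕ) :
    Integrable fun x => hermiteFun j x * deriv (hermiteFun k) x := by
  simp only [deriv_hermiteFun]
  refine ((integrable_id_mul_hermiteFun_mul j k).sub
    ((integrable_hermiteFun_mul j (k + 1)).const_mul √(2 * (k + 1)))).congr
    (Eventually.of_forall fun x => ?_)
  simp only [Pi.sub_apply]; ring

theorem integrable_deriv_hermiteFun_sq (k : ℕ) :
    Integrable fun x => deriv (hermiteFun k) x ^ 2 := by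
  simp only [deriv_hermiteFun]
  refine (((integrable_pow_mul_hermiteFun_mul 2 k k).sub
    ((integrable_id_mul_hermiteFun_mul k (k + 1)).const_mul (2 * √(2 * (k + 1))))).add
    ((integrable_hermiteFun_mul (k + 1) (k + 1)).const_mul (√(2 * (k + 1)) ^ 2))).congr
    (Eventually.of_forall fun x => ?_)
  simp only [Pi.sub_apply, Pi.add_apply]; ring

theorem tendsto_hermiteFun_mul_atBot (j : ℕ) (u : ℝ → ℝ) (C : ℝ) (hu : ∀ x, |u x| ≤ C) :
    Tendsto (fun x => hermiteFun j x * u x) atBot (𝓝 0) := by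
  obtain ⟨D, hD⟩ := exists_pow_mul_hermiteFun_le j 1
  have hC0 := (abs_nonneg _).trans (hu 0)
  have hD0 := (abs_nonneg _).trans (hD 0)
  have h1 : Tendsto (fun x : ℝ => D * C / |x|) atBot (𝓝 0) :=
    Tendsto.div_atTop tendsto_const_nhds tendsto_abs_atBot_atTop
  refine squeeze_zero_norm' ?_ h1
  filter_upwards [eventually_lt_atBot 0] with x hx
  rw [le_div_iff₀ (abs_pos.2 hx.ne), Real.norm_eq_abs, abs_mul]
  have := hD x
  rw [pow_one, abs_mul] at this
  calc |hermiteFun j x| * |u x| * |x| = (|x| * |hermiteFun j x|) * |u x| := by ring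
    _ ≤ D * C := by gcongr; exact hu x

/-- Integrating (h h')' = h'² - (2k+1-x²) h² over the line gives the kinetic energy; the potential
part only helps. -/
theorem integral_deriv_hermiteFun_sq_le (k : ℕ) :
    ∫ x, deriv (hermiteFun k) x ^ 2 ≤ 2 * k + 1 := by
  have hint : Integrable fun x => (2 * (k : ℝ) + 1 - x ^ 2) * hermiteFun k x ^ 2 := by
    refine (((integrable_hermiteFun_mul k k).const_mul (2 * (k : ℝ) + 1)).sub
      (integrable_pow_mul_hermiteFun_mul 2 k k)).congr (Eventually.of_forall fun x => ?_)
    simp only [Pi.sub_apply]; ring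
  have hint2 : Integrable fun x => hermiteFun k x ^ 2 := by
    simpa [sq] using integrable_hermiteFun_mul k k
  have h := integral_eq_zero_of_hasDerivAt_of_integrable
    (f := fun x => hermiteFun k x * deriv (hermiteFun k) x)
    (f' := fun x => deriv (hermiteFun k) x ^ 2 - (2 * (k : ℝ) + 1 - x ^ 2) * hermiteFun k x ^ 2)
    (fun x => ?_) ((integrable_deriv_hermiteFun_sq k).sub hint) (integrable_hermiteFun_mul_deriv k k)
  · rw [integral_sub (integrable_deriv_hermiteFun_sq k) hint, sub_eq_zero] at h
    rw [h]
    have h1 : ∫ x, hermiteFun k x ^ 2 = 1 := by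
      simpa [sq] using integral_hermiteFun_mul k k
    calc ∫ x, (2 * (k : ℝ) + 1 - x ^ 2) * hermiteFun k x ^ 2
        ≤ ∫ x, (2 * (k : ℝ) + 1) * hermiteFun k x ^ 2 := by
          refine integral_mono hint (hint2.const_mul _) fun x => ?_
          simp only []
          gcongr
          nlinarith [sq_nonneg x]
      _ = _ := by rw [integral_const_mul, h1, mul_one]
  · refine ((hasDerivAt_hermiteFun' k x).mul (hasDerivAt_deriv_hermiteFun k x)).congr_deriv ?_
    ring

/-- From h(x)² = ∫_{-∞}^x 2hh' ≤ ∫ (h² + h'²). The bound is crude but holds for all x and k;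
polynomial growth in k is enough against rapidly decreasing weights. -/
theorem hermiteFun_sq_le (k : ℕ) (x : ℝ) : hermiteFun k x ^ 2 ≤ 2 * k + 2 := by
  obtain ⟨C, hC⟩ := exists_pow_mul_hermiteFun_le k 0
  have hint2 : Integrable fun x => hermiteFun k x ^ 2 := by
    simpa [sq] using integrable_hermiteFun_mul k k
  have h1 : ∫ x, hermiteFun k x ^ 2 = 1 := by
    simpa [sq] using integral_hermiteFun_mul k k
  have hi : Integrable fun x => 2 * (hermiteFun k x * deriv (hermiteFun k) x) :=
    (integrable_hermiteFun_mul_deriv k k).const_mul 2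
  have h := integral_Iic_of_hasDerivAt_of_tendsto' (f := fun x => hermiteFun k x ^ 2) (a := x)
    (f' := fun x => 2 * (hermiteFun k x * deriv (hermiteFun k) x)) (m := 0)
    (fun x _ => ?_) hi.integrableOn ?_
  · rw [sub_zero] at h
    rw [← h]
    have hs := hint2.add (integrable_deriv_hermiteFun_sq k)
    calc ∫ y in Set.Iic x, 2 * (hermiteFun k y * deriv (hermiteFun k) y)
        ≤ ∫ y in Set.Iic x, (hermiteFun k y ^ 2 + deriv (hermiteFun k) y ^ 2) := by
          refine integral_mono hi.integrableOn hs.integrableOn fun y => ?_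
          simp only []
          nlinarith [sq_nonneg (hermiteFun k y - deriv (hermiteFun k) y)]
      _ ≤ ∫ y, (hermiteFun k y ^ 2 + deriv (hermiteFun k) y ^ 2) :=
          setIntegral_le_integral hs (Eventually.of_forall fun y => by positivity)
      _ ≤ _ := by
          rw [integral_add hint2 (integrable_deriv_hermiteFun_sq k), h1]
          linarith [integral_deriv_hermiteFun_sq_le k]
  · refine ((hasDerivAt_hermiteFun' k x).pow 2).congr_deriv ?_
    simp; ring
  · simpa [sq] using tendsto_hermiteFun_mul_atBot k (hermiteFun k) C (by simpa using hC)

/-! ### Values at the origin, Wallis' product and the amplitude -/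

theorem hermiteFun_one_at_zero : hermiteFun 1 0 = 0 := by
  have h1 := (hasDerivAt_hermiteFun 0 0).unique (hasDerivAt_hermiteFun_zero 0)
  simpa using h1

theorem hermiteFun_odd_at_zero (n : ℕ) : hermiteFun (2 * n + 1) 0 = 0 := by
  induction n with
  | zero => exact hermiteFun_one_at_zero
  | succ n ih =>
    have h := hermiteFun_rec (2 * n + 1) 0
    rw [ih, mul_zero, mul_zero, zero_mul, sub_zero] at h
    have : √(2 * (((2 * n + 1 : ℕ) : ℝ) + 2)) ≠ 0 := by positivity
    exact (mul_eq_zero.1 h).resolve_left this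

/-- When n increases, b⁴ gains the factor ((2n+1)/(2n+2))² and `Real.Wallis.W` the factor
(2n+2)²/((2n+1)(2n+3)), so the product in the last clause is conserved. Its value at n = 0 is the
Gaussian normalization. -/
theorem hermiteFun_even_at_zero (n : ℕ) :
    ∃ b : ℝ, 0 < b ∧ hermiteFun (2 * n) 0 = (-1) ^ n * b ∧
      b ^ 4 * (2 * n + 1) * (Real.pi * Real.Wallis.W n) = 1 := by
  induction n with
  | zero =>
    refine ⟨(√(√Real.pi))⁻¹, by have := Real.pi_pos; positivity, by simp [hermiteFun_zero], ?_⟩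
    have h1 : √(√Real.pi) ^ 4 = Real.pi := by
      rw [show 4 = 2 * 2 by rfl, pow_mul, Real.sq_sqrt (by positivity),
        Real.sq_sqrt Real.pi_pos.le]
    rw [inv_pow, h1]
    have := Real.pi_pos.ne'
    simp [Real.Wallis.W, this]
  | succ n ih =>
    obtain ⟨b, hb, h1, h2⟩ := ih
    have hs1 : 0 < √(2 * (((2 * n : ℕ) : ℝ) + 1)) := by positivity
    have hs2 : 0 < √(2 * (((2 * n : ℕ) : ℝ) + 2)) := by positivity
    have e1 : √(2 * (((2 * n : ℕ) : ℝ) + 1)) ^ 2 = 2 * (2 * n + 1) := by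
      rw [Real.sq_sqrt (by positivity)]; push_cast; ring
    have e2 : √(2 * (((2 * n : ℕ) : ℝ) + 2)) ^ 2 = 2 * (2 * n + 2) := by
      rw [Real.sq_sqrt (by positivity)]; push_cast; ring
    refine ⟨√(2 * (((2 * n : ℕ) : ℝ) + 1)) / √(2 * (((2 * n : ℕ) : ℝ) + 2)) * b,
      by positivity, ?_, ?_⟩
    · have h := hermiteFun_rec (2 * n) 0
      rw [h1] at h
      have : hermiteFun (2 * (n + 1)) 0 = hermiteFun (2 * n + 2) 0 := rfl
      rw [this]
      field_simp
      rw [pow_succ]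
      linarith
    · rw [mul_pow, div_pow, show 4 = 2 * 2 by rfl, pow_mul, pow_mul √(2 * (((2 * n : ℕ) : ℝ) + 2)),
        e1, e2, Real.Wallis.W_succ]
      push_cast
      have h3 : (2 * ((n : ℝ) + 1) + 1) = 2 * n + 3 := by ring
      rw [h3]
      have hw := Real.Wallis.W_pos n
      field_simp
      linear_combination h2

/-- The amplitude of the `k`-th Hermite function at the origin. -/
noncomputable def hermiteAmp (k : ℕ) : ℝ :=
  √(hermiteFun k 0 ^ 2 + deriv (hermiteFun k) 0 ^ 2 / (2 * k + 1))

theorem hermiteAmp_nonneg (k : ℕ) : 0 ≤ hermiteAmp k := Real.sqrt_nonneg _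

theorem hermiteAmp_sq (k : ℕ) :
    hermiteAmp k ^ 2 = hermiteFun k 0 ^ 2 + deriv (hermiteFun k) 0 ^ 2 / (2 * k + 1) :=
  Real.sq_sqrt (by positivity)

theorem deriv_hermiteFun_at_zero (k : ℕ) :
    deriv (hermiteFun k) 0 = -(√(2 * (k + 1)) * hermiteFun (k + 1) 0) := by
  rw [deriv_hermiteFun]; ring

theorem hermiteFun_at_zero_even (n : ℕ) :
    hermiteFun (2 * n) 0 = (-1) ^ n * hermiteAmp (2 * n) ∧
    deriv (hermiteFun (2 * n)) 0 = 0 ∧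
    hermiteAmp (2 * n) ^ 4 * (2 * n + 1) * (Real.pi * Real.Wallis.W n) = 1 := by
  have hd : deriv (hermiteFun (2 * n)) 0 = 0 := by
    rw [deriv_hermiteFun_at_zero, hermiteFun_odd_at_zero]; simp
  obtain ⟨b, hb, h1, h2⟩ := hermiteFun_even_at_zero n
  have : hermiteAmp (2 * n) = b := by
    rw [hermiteAmp, hd, h1, mul_pow, ← pow_mul, mul_comm n 2, pow_mul]
    simp [Real.sqrt_sq hb.le]
  exact ⟨by rw [h1, this], hd, by rw [this, h2]⟩

theorem hermiteFun_at_zero_odd (n : ℕ) :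
    hermiteFun (2 * n + 1) 0 = 0 ∧
    deriv (hermiteFun (2 * n + 1)) 0 = (-1) ^ n * (√(4 * n + 3) * hermiteAmp (2 * n + 1)) ∧
    hermiteAmp (2 * n + 1) ^ 4 * ((4 * n + 3) ^ 2 * (2 * n + 3)) *
      (Real.pi * Real.Wallis.W (n + 1)) = 16 * (n + 1) ^ 2 := by
  obtain ⟨b, hb, h1, h2⟩ := hermiteFun_even_at_zero (n + 1)
  have h0 := hermiteFun_odd_at_zero n
  have hd : deriv (hermiteFun (2 * n + 1)) 0 = (-1) ^ n * (√(4 * (n + 1)) * b) := by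
    rw [deriv_hermiteFun_at_zero, show 2 * n + 1 + 1 = 2 * (n + 1) by ring, h1, pow_succ]
    push_cast
    rw [show 2 * (2 * (n : ℝ) + 1 + 1) = 4 * (n + 1) by ring]
    ring
  have hsq : hermiteAmp (2 * n + 1) ^ 2 = 4 * (n + 1) * b ^ 2 / (4 * n + 3) := by
    rw [hermiteAmp_sq, h0, hd, mul_pow, mul_pow, Real.sq_sqrt (by positivity), ← pow_mul,
      mul_comm n 2, pow_mul]
    push_cast
    rw [show 2 * (2 * (n : ℝ) + 1) + 1 = 4 * n + 3 by ring]
    ring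
  have hA : √(4 * n + 3) * hermiteAmp (2 * n + 1) = √(4 * (n + 1)) * b := by
    rw [← sq_eq_sq₀ (mul_nonneg (Real.sqrt_nonneg _) (hermiteAmp_nonneg _)) (by positivity),
      mul_pow, mul_pow, hsq, Real.sq_sqrt (by positivity), Real.sq_sqrt (by positivity)]
    field_simp
  refine ⟨h0, by rw [hd, hA], ?_⟩
  rw [show hermiteAmp (2 * n + 1) ^ 4 = (hermiteAmp (2 * n + 1) ^ 2) ^ 2 by ring, hsq]
  push_cast at h2
  rw [show 2 * ((n : ℝ) + 1) + 1 = 2 * n + 3 by ring] at h2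
  field_simp
  linear_combination 16 * h2

/-- Together with `deriv_hermiteFun_at_zero'` this puts the Cauchy data at 0 on a circle of radius
`hermiteAmp k` at angle kπ/2, so that both parities obey a single asymptotic formula. -/
theorem hermiteFun_at_zero (k : ℕ) :
    hermiteFun k 0 = hermiteAmp k * Real.cos (k * (Real.pi / 2)) := by
  obtain ⟨n, rfl | rfl⟩ := Nat.even_or_odd' k
  · rw [(hermiteFun_at_zero_even n).1]
    push_cast
    rw [show 2 * (n : ℝ) * (Real.pi / 2) = n * Real.pi by ring, Real.cos_nat_mul_pi]
    ring
  · rw [(hermiteFun_at_zero_odd n).1]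
    push_cast
    rw [show (2 * (n : ℝ) + 1) * (Real.pi / 2) = n * Real.pi + Real.pi / 2 by ring,
      Real.cos_add_pi_div_two, Real.sin_nat_mul_pi]
    simp

theorem deriv_hermiteFun_at_zero' (k : ℕ) :
    deriv (hermiteFun k) 0 = √(2 * k + 1) * (hermiteAmp k * Real.sin (k * (Real.pi / 2))) := by
  obtain ⟨n, rfl | rfl⟩ := Nat.even_or_odd' k
  · rw [(hermiteFun_at_zero_even n).2.1]
    push_cast
    rw [show 2 * (n : ℝ) * (Real.pi / 2) = n * Real.pi by ring, Real.sin_nat_mul_pi]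
    simp
  · rw [(hermiteFun_at_zero_odd n).2.1]
    push_cast
    rw [show (2 * (n : ℝ) + 1) * (Real.pi / 2) = n * Real.pi + Real.pi / 2 by ring,
      Real.sin_add_pi_div_two, Real.cos_nat_mul_pi,
      show 2 * (2 * (n : ℝ) + 1) + 1 = 4 * n + 3 by ring]
    ring

theorem tendsto_of_even_of_odd {X : Type*} {u : ℕ → X} {l : Filter X}
    (h0 : Tendsto (fun n => u (2 * n)) atTop l) (h1 : Tendsto (fun n => u (2 * n + 1)) atTop l) :
    Tendsto u atTop l := by
  intro s hs
  obtain ⟨A, hA⟩ := eventually_atTop.1 (h0 hs)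
  obtain ⟨B, hB⟩ := eventually_atTop.1 (h1 hs)
  refine eventually_atTop.2 ⟨2 * (A + B) + 1, fun k hk => ?_⟩
  obtain ⟨n, rfl | rfl⟩ := Nat.even_or_odd' k
  · exact hA n (by omega)
  · exact hB n (by omega)

/-- Wallis' product tends to π/2 in the exact formulas for the two parities. The amplitude is thus
equivalent to √(2/π) (2k+1)^(-1/4). -/
theorem tendsto_hermiteAmp :
    Tendsto (fun k : ℕ => (2 * k + 1) * hermiteAmp k ^ 4) atTop (𝓝 ((2 / Real.pi) ^ 2)) := by
  have hπ := Real.pi_pos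
  have hW := Real.Wallis.tendsto_W_nhds_pi_div_two
  have hWpos : ∀ n, 0 < Real.Wallis.W n := Real.Wallis.W_pos
  have hinv : Tendsto (fun n : ℕ => ((n : ℝ))⁻¹) atTop (𝓝 0) := tendsto_inv_atTop_nhds_zero_nat
  have hl : (4 + 0) / (2 + 0) / (Real.pi * (Real.pi / 2)) = (2 / Real.pi) ^ 2 := by
    field_simp; norm_num
  apply tendsto_of_even_of_odd
  · have h : Tendsto (fun n : ℕ => (4 + (n : ℝ)⁻¹) / (2 + (n : ℝ)⁻¹) / (Real.pi * Real.Wallis.W n))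
        atTop (𝓝 ((4 + 0) / (2 + 0) / (Real.pi * (Real.pi / 2)))) :=
      ((hinv.const_add 4).div (hinv.const_add 2) (by norm_num)).div (hW.const_mul _)
        (by positivity)
    rw [hl] at h
    refine h.congr' ?_
    filter_upwards [eventually_gt_atTop 0] with n hn
    have hn' : (0 : ℝ) < n := by exact_mod_cast hn
    have := (hermiteFun_at_zero_even n).2.2
    have hw := hWpos n
    push_cast
    field_simp
    linear_combination -(4 * (n : ℝ) + 1) * this
  · have h : Tendsto (fun n : ℕ => 16 * (1 + (n : ℝ)⁻¹) ^ 2 / ((4 + 3 * (n : ℝ)⁻¹) *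
          (2 + 3 * (n : ℝ)⁻¹)) / (Real.pi * Real.Wallis.W (n + 1)))
        atTop (𝓝 (16 * (1 + 0) ^ 2 / ((4 + 3 * 0) * (2 + 3 * 0)) / (Real.pi * (Real.pi / 2)))) :=
      (((((hinv.const_add 1).pow 2).const_mul 16)).div
        (((hinv.const_mul 3).const_add 4).mul ((hinv.const_mul 3).const_add 2)) (by norm_num)).div
        ((hW.comp (tendsto_add_atTop_nat 1)).const_mul _) (by positivity)
    have hl' : 16 * (1 + 0) ^ 2 / ((4 + 3 * 0) * (2 + 3 * 0)) / (Real.pi * (Real.pi / 2))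
        = (2 / Real.pi) ^ 2 := by
      field_simp; norm_num
    rw [hl'] at h
    refine h.congr' ?_
    filter_upwards [eventually_gt_atTop 0] with n hn
    have hn' : (0 : ℝ) < n := by exact_mod_cast hn
    have := (hermiteFun_at_zero_odd n).2.2
    have hw := hWpos (n + 1)
    push_cast
    rw [show 2 * (2 * (n : ℝ) + 1) + 1 = 4 * n + 3 by ring]
    field_simp
    linear_combination -this

theorem exists_hermiteAmp_le : ∃ C : ℝ, 0 < C ∧ ∀ k : ℕ, √(2 * k + 1) * hermiteAmp k ^ 2 ≤ C := by
  obtain ⟨C, hC⟩ := tendsto_hermiteAmp.bddAbove_range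
  refine ⟨√(|C| + 1), by positivity, fun k => ?_⟩
  apply Real.le_sqrt_of_sq_le
  rw [mul_pow, Real.sq_sqrt (by positivity), ← pow_mul]
  have := hC ⟨k, rfl⟩
  simp only at this
  norm_num
  linarith [le_abs_self C]

/-- Sonin's inequality. -/
theorem hermiteFun_energy_le (k : ℕ) (x : ℝ) :
    deriv (hermiteFun k) x ^ 2 + (2 * k + 1 - x ^ 2) * hermiteFun k x ^ 2
      ≤ (2 * k + 1) * hermiteAmp k ^ 2 := by
  -- The energy is followed along the segment from 0 to x, which covers both signs of x. By the
  -- oscillator equation only the explicit dependence of the potential on the position contributes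
  -- to its derivative.
  set E : ℝ → ℝ := fun r => deriv (hermiteFun k) (r * x) ^ 2
    + (2 * k + 1 - (r * x) ^ 2) * hermiteFun k (r * x) ^ 2 with hE
  have hd : ∀ r, HasDerivAt E (-2 * r * x ^ 2 * hermiteFun k (r * x) ^ 2) r := by
    intro r
    have hm : HasDerivAt (fun r : ℝ => r * x) x r := by simpa using (hasDerivAt_id r).mul_const x
    have h1 := (hasDerivAt_hermiteFun' k (r * x)).comp r hm
    have h2 := (hasDerivAt_deriv_hermiteFun k (r * x)).comp r hm
    refine ((h2.pow 2).add (((hm.pow 2).const_sub (2 * (k : ℝ) + 1)).mul (h1.pow 2))).congr_deriv ?_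
    simp only [Function.comp]
    push_cast
    simp only [Pi.pow_apply, Function.comp]
    ring
  have hanti : AntitoneOn E (Set.Ici 0) := by
    refine antitoneOn_of_deriv_nonpos (convex_Ici 0)
      (fun r _ => (hd r).continuousAt.continuousWithinAt)
      (fun r _ => (hd r).differentiableAt.differentiableWithinAt) fun r hr => ?_
    rw [interior_Ici] at hr
    rw [(hd r).deriv]
    have : 0 ≤ r * x ^ 2 * hermiteFun k (r * x) ^ 2 := by have := hr.out.le; positivity
    linarith
  have h := hanti (Set.mem_Ici.2 le_rfl) (Set.mem_Ici.2 zero_le_one) zero_le_one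
  simp only [hE, one_mul, zero_mul] at h
  refine h.trans (le_of_eq ?_)
  rw [hermiteAmp_sq]
  field_simp
  ring

/-- Under `hx` the coefficient 2k+1-x² is at least half of 2k+1, so Sonin's energy controls h
itself. -/
theorem hermiteFun_sq_le_amp {k : ℕ} {x : ℝ} (hx : x ^ 2 ≤ (2 * k + 1) / 2) :
    hermiteFun k x ^ 2 ≤ 2 * hermiteAmp k ^ 2 := by
  have h := hermiteFun_energy_le k x
  have h1 : (2 * (k : ℝ) + 1) / 2 * hermiteFun k x ^ 2 ≤ (2 * k + 1 - x ^ 2) * hermiteFun k x ^ 2 := by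
    gcongr; linarith
  have h2 : (0 : ℝ) < 2 * k + 1 := by positivity
  have h3 : (2 * (k : ℝ) + 1) * (hermiteFun k x ^ 2) ≤ (2 * k + 1) * (2 * hermiteAmp k ^ 2) := by
    nlinarith [sq_nonneg (deriv (hermiteFun k) x)]
  exact le_of_mul_le_mul_left h3 h2

theorem deriv_hermiteFun_sq_le_amp {k : ℕ} {x : ℝ} (hx : x ^ 2 ≤ (2 * k + 1) / 2) :
    deriv (hermiteFun k) x ^ 2 ≤ (2 * k + 1) * hermiteAmp k ^ 2 := by
  have h := hermiteFun_energy_le k x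
  have h1 : 0 ≤ (2 * k + 1 - x ^ 2) * hermiteFun k x ^ 2 := by
    apply mul_nonneg _ (sq_nonneg _)
    have : (0 : ℝ) < 2 * k + 1 := by positivity
    linarith
  linarith

/-- The classical action `∫₀ˣ √(E - t²) dt` of the harmonic oscillator. -/
noncomputable def oscAction (E x : ℝ) : ℝ := ∫ t in (0 : ℝ)..x, √(E - t ^ 2)

theorem hasDerivAt_oscAction (E x : ℝ) : HasDerivAt (oscAction E) (√(E - x ^ 2)) x := by
  have hc : Continuous fun t : ℝ => √(E - t ^ 2) := by fun_prop
  exact intervalIntegral.integral_hasDerivAt_right (hc.intervalIntegrable _ _)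
    hc.stronglyMeasurable.stronglyMeasurableAtFilter hc.continuousAt

/-- Variation of constants. With w = √(E-t²) the local frequency, S its primitive and v = h'/w, the
pair (h, v) rotated by the angle S would be constant if w were. Its actual velocity involves only
w'/w = -t/w², which is O(|x|/E) where t² ≤ E/2. -/
theorem hermiteFun_wkb {k : ℕ} {x : ℝ} (hx : x ^ 2 ≤ (2 * k + 1) / 2) :
    |hermiteFun k x - hermiteAmp k * Real.cos (oscAction (2 * k + 1) x - k * (Real.pi / 2))|
      ≤ 8 * hermiteAmp k * x ^ 2 / (2 * k + 1) := by
  set E : ℝ := 2 * k + 1 with hE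
  have hEpos : 0 < E := by positivity
  set S := oscAction E with hS
  set w : ℝ → ℝ := fun t => √(E - t ^ 2) with hw
  have hs : ∀ t ∈ Set.Icc (-|x|) |x|, t ^ 2 ≤ E / 2 := fun t ht =>
    (sq_le_sq' ht.1 ht.2).trans (by rwa [sq_abs])
  have hwpos : ∀ t ∈ Set.Icc (-|x|) |x|, 0 < w t := fun t ht =>
    Real.sqrt_pos.2 (by linarith [hs t ht])
  have hwsq : ∀ t ∈ Set.Icc (-|x|) |x|, w t ^ 2 = E - t ^ 2 := fun t ht =>
    Real.sq_sqrt (by linarith [hs t ht])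
  have hwd : ∀ t ∈ Set.Icc (-|x|) |x|, HasDerivAt w (-t / w t) t := by
    intro t ht
    have h1 : HasDerivAt (fun t : ℝ => E - t ^ 2) (-(2 * t)) t := by
      simpa using (hasDerivAt_pow 2 t).const_sub E
    have := h1.sqrt (by linarith [hs t ht])
    refine this.congr_deriv ?_
    have := (hwpos t ht).ne'
    simp only [hw] at this ⊢
    field_simp
  set v : ℝ → ℝ := fun t => deriv (hermiteFun k) t / w t with hv
  have hvd : ∀ t ∈ Set.Icc (-|x|) |x|,
      HasDerivAt v (-w t * hermiteFun k t + v t * t / w t ^ 2) t := by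
    intro t ht
    have hp := (hwpos t ht).ne'
    refine ((hasDerivAt_deriv_hermiteFun k t).div (hwd t ht) hp).congr_deriv ?_
    have h2 := hwsq t ht
    simp only [hv]
    field_simp
    rw [show w t ^ 4 = w t ^ 2 * w t ^ 2 by ring, h2, hE]
    ring
  have hSd : ∀ t, HasDerivAt S (w t) t := hasDerivAt_oscAction E
  -- P and Q are the coordinates of (h, v) in the rotating frame; at 0 they are the amplitude times
  -- the cosine and sine of kπ/2.
  set P : ℝ → ℝ := fun t => hermiteFun k t * Real.cos (S t) - v t * Real.sin (S t) with hP
  set Q : ℝ → ℝ := fun t => hermiteFun k t * Real.sin (S t) + v t * Real.cos (S t) with hQ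
  have hdv : ∀ t ∈ Set.Icc (-|x|) |x|, deriv (hermiteFun k) t = v t * w t := fun t ht => by
    have hp := (hwpos t ht).ne'
    simp only [hv]; field_simp
  have hPd : ∀ t ∈ Set.Icc (-|x|) |x|,
      HasDerivAt P (-(v t * t / w t ^ 2) * Real.sin (S t)) t := by
    intro t ht
    refine (((hasDerivAt_hermiteFun' k t).mul (hSd t).cos).sub
      ((hvd t ht).mul (hSd t).sin)).congr_deriv ?_
    rw [hdv t ht]; ring
  have hQd : ∀ t ∈ Set.Icc (-|x|) |x|,
      HasDerivAt Q (v t * t / w t ^ 2 * Real.cos (S t)) t := by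
    intro t ht
    refine (((hasDerivAt_hermiteFun' k t).mul (hSd t).sin).add
      ((hvd t ht).mul (hSd t).cos)).congr_deriv ?_
    rw [hdv t ht]; ring
  have hA := hermiteAmp_nonneg k
  -- Here |v| ≤ 2A, by the energy bound on h' and w² ≥ E/2, and |t|/w² ≤ 2|x|/E. Each of P and Q
  -- then moves by at most 4Ax²/E, whence the constant 8.
  have hb : ∀ t ∈ Set.Icc (-|x|) |x|, |v t * t / w t ^ 2| ≤ 4 * hermiteAmp k * |x| / E := by
    intro t ht
    have h1 := deriv_hermiteFun_sq_le_amp (hs t ht)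
    have h2 : E / 2 ≤ w t ^ 2 := by rw [hwsq t ht]; linarith [hs t ht]
    have h3 : |v t| ≤ 2 * hermiteAmp k := by
      apply abs_le_of_sq_le_sq _ (by positivity)
      rw [hv]
      simp only [div_pow]
      rw [div_le_iff₀ (by linarith)]
      calc _ ≤ E * hermiteAmp k ^ 2 := h1
        _ ≤ (2 * hermiteAmp k) ^ 2 * (E / 2) := by nlinarith [mul_nonneg hEpos.le (sq_nonneg (hermiteAmp k))]
        _ ≤ _ := by gcongr
    rw [abs_div, abs_mul, abs_of_nonneg (sq_nonneg (w t))]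
    have ht' : |t| ≤ |x| := abs_le.2 ht
    calc |v t| * |t| / w t ^ 2 ≤ (2 * hermiteAmp k) * |x| / (E / 2) := by gcongr
      _ = _ := by rw [div_div_eq_mul_div]; ring
  have h0mem : (0 : ℝ) ∈ Set.Icc (-|x|) |x| := ⟨by simp, abs_nonneg x⟩
  have hxmem : x ∈ Set.Icc (-|x|) |x| := ⟨neg_abs_le x, le_abs_self x⟩
  have hbound : 4 * hermiteAmp k * |x| / E * ‖x - 0‖ = 4 * hermiteAmp k * x ^ 2 / E := by
    rw [sub_zero, Real.norm_eq_abs, ← sq_abs x]; ring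
  have hPb := (convex_Icc (-|x|) |x|).norm_image_sub_le_of_norm_hasDerivWithin_le
    (fun t ht => (hPd t ht).hasDerivWithinAt) (C := 4 * hermiteAmp k * |x| / E) (fun t ht => by
      rw [Real.norm_eq_abs, abs_mul, abs_neg]
      exact (mul_le_of_le_one_right (abs_nonneg _) (Real.abs_sin_le_one _)).trans (hb t ht))
    h0mem hxmem
  have hQb := (convex_Icc (-|x|) |x|).norm_image_sub_le_of_norm_hasDerivWithin_le
    (fun t ht => (hQd t ht).hasDerivWithinAt) (C := 4 * hermiteAmp k * |x| / E) (fun t ht => by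
      rw [Real.norm_eq_abs, abs_mul]
      exact (mul_le_of_le_one_right (abs_nonneg _) (Real.abs_cos_le_one _)).trans (hb t ht))
    h0mem hxmem
  rw [hbound, Real.norm_eq_abs] at hPb hQb
  have hS0 : S 0 = 0 := by simp [hS, oscAction]
  have hP0 : P 0 = hermiteAmp k * Real.cos (k * (Real.pi / 2)) := by
    simp only [hP, hS0, Real.cos_zero, Real.sin_zero, hermiteFun_at_zero]; ring
  have hQ0 : Q 0 = hermiteAmp k * Real.sin (k * (Real.pi / 2)) := by
    simp only [hQ, hv, hw, hS0, Real.cos_zero, Real.sin_zero, deriv_hermiteFun_at_zero']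
    have : √(2 * (k : ℝ) + 1) ≠ 0 := by positivity
    rw [hE]
    norm_num
    field_simp
  have hdec : hermiteFun k x - hermiteAmp k * Real.cos (S x - k * (Real.pi / 2))
      = (P x - P 0) * Real.cos (S x) + (Q x - Q 0) * Real.sin (S x) := by
    rw [hP0, hQ0, Real.cos_sub]
    simp only [hP, hQ]
    linear_combination -hermiteFun k x * Real.sin_sq_add_cos_sq (S x)
  rw [hdec]
  calc |(P x - P 0) * Real.cos (S x) + (Q x - Q 0) * Real.sin (S x)|
      ≤ |P x - P 0| * |Real.cos (S x)| + |Q x - Q 0| * |Real.sin (S x)| := by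
        rw [← abs_mul, ← abs_mul]; exact abs_add_le _ _
    _ ≤ 4 * hermiteAmp k * x ^ 2 / E * 1 + 4 * hermiteAmp k * x ^ 2 / E * 1 := by
        gcongr
        exacts [Real.abs_cos_le_one _, Real.abs_sin_le_one _]
    _ = _ := by ring

/-! ## Shapes with exponentially decaying density -/

theorem one_add_abs_pow_mul_exp_le {c : ℝ} (hc : 0 < c) (m : ℕ) (t : ℝ) :
    (1 + |t|) ^ m * Real.exp (-c * |t|) ≤ m.factorial * (c ^ m)⁻¹ * Real.exp c := by
  have h1 := Real.pow_div_factorial_le_exp (c * (1 + |t|)) (by positivity) m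
  rw [div_le_iff₀' (by positivity), mul_pow] at h1
  have h2 : Real.exp (c * (1 + |t|)) * Real.exp (-c * |t|) = Real.exp c := by
    rw [← Real.exp_add]; congr 1; ring
  rw [← h2]
  calc (1 + |t|) ^ m * Real.exp (-c * |t|)
      = (c ^ m)⁻¹ * (c ^ m * (1 + |t|) ^ m) * Real.exp (-c * |t|) := by field_simp
    _ ≤ (c ^ m)⁻¹ * (m.factorial * Real.exp (c * (1 + |t|))) * Real.exp (-c * |t|) := by gcongr
    _ = _ := by ring

theorem integrable_one_add_abs_pow_mul_exp {c : ℝ} (hc : 0 < c) (m : ℕ) :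
    Integrable fun t : ℝ => (1 + |t|) ^ m * Real.exp (-c * |t|) := by
  refine Integrable.mono' (integrable_inv_one_add_sq.const_mul
    ((m + 2).factorial * (c ^ (m + 2))⁻¹ * Real.exp c)) (by fun_prop)
    (Eventually.of_forall fun t => ?_)
  rw [Real.norm_of_nonneg (by positivity), ← div_eq_mul_inv, le_div_iff₀ (by positivity)]
  refine le_trans ?_ (one_add_abs_pow_mul_exp_le hc (m + 2) t)
  calc (1 + |t|) ^ m * Real.exp (-c * |t|) * (1 + t ^ 2)
      ≤ (1 + |t|) ^ m * Real.exp (-c * |t|) * (1 + |t|) ^ 2 := by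
        gcongr; nlinarith [sq_abs t, abs_nonneg t]
    _ = _ := by ring

/-- The function u - e^{-ct}/c is nondecreasing and tends to 0 at infinity, so it is nonpositive. -/
theorem le_exp_div_of_tendsto_zero {u u' : ℝ → ℝ} {c : ℝ} (hc : 0 < c)
    (hu : ∀ t, HasDerivAt u (u' t) t) (hu' : ∀ t, 0 ≤ t → -Real.exp (-c * t) ≤ u' t)
    (h0 : Tendsto u atTop (𝓝 0)) {t : ℝ} (ht : 0 ≤ t) : u t ≤ Real.exp (-c * t) / c := by
  have he : ∀ t, HasDerivAt (fun t : ℝ => Real.exp (-c * t) / c) (-Real.exp (-c * t)) t := by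
    intro t
    have h1 : HasDerivAt (fun t : ℝ => -c * t) (-c) t := by
      simpa using (hasDerivAt_id t).const_mul (-c)
    refine (h1.exp.div_const c).congr_deriv ?_
    field_simp
  have hmono : MonotoneOn (fun t => u t - Real.exp (-c * t) / c) (Set.Ici 0) := by
    refine monotoneOn_of_deriv_nonneg (convex_Ici 0)
      (fun t _ => ((hu t).sub (he t)).continuousAt.continuousWithinAt)
      (fun t _ => ((hu t).sub (he t)).differentiableAt.differentiableWithinAt) fun t ht => ?_
    rw [interior_Ici] at ht
    have : deriv (fun t => u t - Real.exp (-c * t) / c) t = _ := ((hu t).sub (he t)).deriv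
    rw [this]
    linarith [hu' t ht.out.le]
  have hlim : Tendsto (fun t => u t - Real.exp (-c * t) / c) atTop (𝓝 (0 - 0 / c)) := by
    refine h0.sub (Tendsto.div_const (Real.tendsto_exp_atBot.comp ?_) c)
    exact tendsto_id.const_mul_atTop_of_neg (neg_lt_zero.2 hc)
  have := ge_of_tendsto hlim (b := u t - Real.exp (-c * t) / c) (by
    filter_upwards [eventually_ge_atTop t] with s hs
    exact hmono ht (ht.trans hs) hs)
  simp at this
  simpa using this

theorem measurable_shapeDensity (Ψ : ℝ → ℝ) : Measurable (shapeDensity Ψ) :=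
  (measurable_deriv Ψ).neg

namespace IsExpShape

theorem hasDerivAt {Ψ : ℝ → ℝ} (hΨ : IsExpShape Ψ) (t : ℝ) : HasDerivAt Ψ (-shapeDensity Ψ t) t := by
  rw [shapeDensity, neg_neg]
  exact (hΨ.differentiable t).hasDerivAt

theorem density_nonneg {Ψ : ℝ → ℝ} (hΨ : IsExpShape Ψ) (t : ℝ) : 0 ≤ shapeDensity Ψ t := by
  have := hΨ.deriv_nonpos t
  simp only [shapeDensity]; linarith

theorem antitone {Ψ : ℝ → ℝ} (hΨ : IsExpShape Ψ) : Antitone Ψ := antitone_of_deriv_nonpos hΨ.differentiable hΨ.deriv_nonpos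

theorem continuous {Ψ : ℝ → ℝ} (hΨ : IsExpShape Ψ) : Continuous Ψ := hΨ.differentiable.continuous

theorem exists_tail {Ψ : ℝ → ℝ} (hΨ : IsExpShape Ψ) : ∃ c C : ℝ, 0 < c ∧ 1 ≤ C ∧
    (∀ t, shapeDensity Ψ t ≤ C * Real.exp (-c * |t|)) ∧
    (∀ t, Ψ t ≤ C * Real.exp (-c * t)) ∧ (∀ t, 1 - Ψ t ≤ C * Real.exp (c * t)) := by
  obtain ⟨c, hc, hΦ⟩ := hΨ.density_le
  have hint : Integrable (shapeDensity Ψ) := by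
    have := integrable_one_add_abs_pow_mul_exp hc 0
    simp only [pow_zero, one_mul] at this
    refine this.mono' (measurable_shapeDensity Ψ).aestronglyMeasurable (Eventually.of_forall fun t => ?_)
    rw [Real.norm_of_nonneg (hΨ.density_nonneg t)]
    exact hΦ t
  have hneg : ∀ t, HasDerivAt (fun t => 1 - Ψ (-t)) (-shapeDensity Ψ (-t)) t := by
    intro t
    have := ((hΨ.hasDerivAt (-t)).comp t (hasDerivAt_neg t)).const_sub 1
    simpa using this
  have h1 : ∀ t, 0 ≤ t → Ψ t ≤ Real.exp (-c * t) / c := by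
    intro t ht
    refine le_exp_div_of_tendsto_zero hc hΨ.hasDerivAt (fun t ht => ?_) ?_ ht
    · have := hΦ t
      rw [abs_of_nonneg ht] at this
      linarith
    · exact tendsto_zero_of_hasDerivAt_of_integrableOn_Ioi (a := 0) (fun t _ => hΨ.hasDerivAt t)
        hint.neg.integrableOn hΨ.integrableOn_Ioi
  have h2 : ∀ t, 0 ≤ t → 1 - Ψ (-t) ≤ Real.exp (-c * t) / c := by
    intro t ht
    refine le_exp_div_of_tendsto_zero hc hneg (fun t ht => ?_) ?_ ht
    · have := hΦ (-t)
      rw [abs_neg, abs_of_nonneg ht] at this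
      linarith
    · refine tendsto_zero_of_hasDerivAt_of_integrableOn_Ioi (a := 0) (fun t _ => hneg t)
        hint.comp_neg.neg.integrableOn ?_
      have := (Measure.measurePreserving_neg (volume : Measure ℝ)).integrableOn_comp_preimage
        (Homeomorph.neg ℝ).measurableEmbedding (f := fun t => 1 - Ψ t) (s := Set.Iio 0)
      have h3 := this.2 hΨ.integrableOn_Iio
      have h4 : (Neg.neg : ℝ → ℝ) ⁻¹' Set.Iio 0 = Set.Ioi 0 := by ext x; simp
      rw [h4] at h3
      exact h3
  -- The value 1/c comes from integrating the density over a tail; the value 1 makes each bound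
  -- trivial on the half-line where the exponential is at least 1, so that both hold for every t.
  refine ⟨c, max 1 (1 / c), hc, le_max_left _ _, fun t => (hΦ t).trans ?_, fun t => ?_, fun t => ?_⟩
  · exact le_mul_of_one_le_left (Real.exp_pos _).le (le_max_left _ _)
  · rcases le_total 0 t with ht | ht
    · refine (h1 t ht).trans ?_
      rw [div_eq_mul_one_div, mul_comm]
      gcongr
      exact le_max_right _ _
    · refine (hΨ.mem_Icc t).2.trans ?_
      have : 1 ≤ Real.exp (-c * t) := Real.one_le_exp (by nlinarith)
      nlinarith [le_max_left 1 (1 / c)]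
  · rcases le_total 0 t with ht | ht
    · have : 1 ≤ Real.exp (c * t) := Real.one_le_exp (by positivity)
      nlinarith [le_max_left 1 (1 / c), (hΨ.mem_Icc t).1]
    · have := h2 (-t) (by linarith)
      rw [neg_neg] at this
      refine this.trans ?_
      rw [div_eq_mul_one_div, mul_comm, neg_mul_neg]
      gcongr
      exact le_max_right _ _

theorem integrable_pow_mul_density {Ψ : ℝ → ℝ} (hΨ : IsExpShape Ψ) (m : ℕ) :
    Integrable fun t => (1 + |t|) ^ m * shapeDensity Ψ t := by
  obtain ⟨c, C, hc, hC, hΦ, -, -⟩ := hΨ.exists_tail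
  refine Integrable.mono' ((integrable_one_add_abs_pow_mul_exp hc m).const_mul C)
    ((by fun_prop : Measurable fun t : ℝ => (1 + |t|) ^ m).mul
      (measurable_shapeDensity Ψ)).aestronglyMeasurable (Eventually.of_forall fun t => ?_)
  rw [Real.norm_of_nonneg (mul_nonneg (by positivity) (hΨ.density_nonneg t))]
  calc (1 + |t|) ^ m * shapeDensity Ψ t ≤ (1 + |t|) ^ m * (C * Real.exp (-c * |t|)) := by
        gcongr; exact hΦ t
    _ = _ := by ring

theorem integrable_density {Ψ : ℝ → ℝ} (hΨ : IsExpShape Ψ) : Integrable (shapeDensity Ψ) := by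
  simpa using hΨ.integrable_pow_mul_density 0

theorem sub_eq_integral {Ψ : ℝ → ℝ} (hΨ : IsExpShape Ψ) (a b : ℝ) : Ψ a - Ψ b = ∫ t in a..b, shapeDensity Ψ t := by
  have := intervalIntegral.integral_eq_sub_of_hasDerivAt (a := a) (b := b)
    (fun t _ => hΨ.hasDerivAt t) hΨ.integrable_density.neg.intervalIntegrable
  rw [intervalIntegral.integral_neg] at this
  linarith

theorem density_le_one {Ψ : ℝ → ℝ} (hΨ : IsExpShape Ψ) (t : ℝ) : shapeDensity Ψ t ≤ 1 := by
  obtain ⟨c, hc, hΦ⟩ := hΨ.density_le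
  refine (hΦ t).trans (Real.exp_le_one_iff.2 ?_)
  nlinarith [abs_nonneg t]

/-- The Lipschitz constant is 1 because the density is at most e^{-c|x|} ≤ 1. It bounds the jumps of
the weights by the mesh 1/(τN^α). -/
theorem sub_le {Ψ : ℝ → ℝ} (hΨ : IsExpShape Ψ) {a b : ℝ} (hab : a ≤ b) : Ψ a - Ψ b ≤ b - a := by
  rw [hΨ.sub_eq_integral]
  have := intervalIntegral.integral_mono_on hab (f := shapeDensity Ψ) (g := fun _ => 1)
    hΨ.integrable_density.intervalIntegrable (by simp) (fun t _ => hΨ.density_le_one t)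
  simpa using this

/-- For t ≥ 0 the first factor is small; for t ≤ 0 the second one is, up to the loss e^{c|v|} due to
the translation. -/
theorem mul_one_sub_le {Ψ : ℝ → ℝ} (hΨ : IsExpShape Ψ) : ∃ c C : ℝ, 0 < c ∧ 0 < C ∧
    ∀ t v, Ψ t * (1 - Ψ (t + v)) ≤ C * Real.exp (c * |v|) * Real.exp (-c * |t|) := by
  obtain ⟨c, C, hc, hC, -, h1, h2⟩ := hΨ.exists_tail
  refine ⟨c, C, hc, by linarith, fun t v => ?_⟩
  have e1 := hΨ.mem_Icc t
  have e2 := hΨ.mem_Icc (t + v)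
  rcases le_total 0 t with ht | ht
  · rw [abs_of_nonneg ht]
    calc Ψ t * (1 - Ψ (t + v)) ≤ (C * 1 * Real.exp (-c * t)) * 1 := by
          rw [mul_one C]
          apply mul_le_mul (h1 t) (by linarith [e2.1]) (by linarith [e2.2]) (by positivity)
      _ ≤ _ := by
          rw [mul_one]
          gcongr
          exact Real.one_le_exp (by positivity)
  · rw [abs_of_nonpos ht]
    calc Ψ t * (1 - Ψ (t + v)) ≤ 1 * (C * Real.exp (c * (t + v))) := by
          apply mul_le_mul e1.2 (h2 _) (by linarith [e2.2]) zero_le_one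
      _ ≤ C * Real.exp (c * |v| + -c * -t) := by
          rw [one_mul]
          gcongr
          nlinarith [le_abs_self v]
      _ = _ := by rw [Real.exp_add]; ring

theorem integrable_mul_one_sub {Ψ : ℝ → ℝ} (hΨ : IsExpShape Ψ) (v : ℝ) : Integrable fun t => Ψ t * (1 - Ψ (t + v)) := by
  obtain ⟨c, C, hc, hC, h⟩ := hΨ.mul_one_sub_le
  have := integrable_one_add_abs_pow_mul_exp hc 0
  simp only [pow_zero, one_mul] at this
  have hcont := hΨ.continuous
  refine (this.const_mul (C * Real.exp (c * |v|))).mono' (by fun_prop)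
    (Eventually.of_forall fun t => ?_)
  rw [Real.norm_of_nonneg (mul_nonneg (hΨ.mem_Icc t).1 (by linarith [(hΨ.mem_Icc (t + v)).2]))]
  exact h t v

end IsExpShape

/-! ## Series in an orthonormal system -/

/-- A real orthonormal sequence of bounded continuous functions on the line. -/
structure IsOrthonormalSeq (u : ℕ → ℝ → ℝ) (M : ℕ → ℝ) : Prop where
  continuous : ∀ k, Continuous (u k)
  abs_le : ∀ k x, |u k x| ≤ M k
  integrable_mul : ∀ j k, Integrable fun x => u j x * u k x
  integral_mul : ∀ j k, ∫ x, u j x * u k x = if j = k then 1 else 0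

namespace IsOrthonormalSeq

theorem integral_abs_mul_le {u : ℕ → ℝ → ℝ} {M : ℕ → ℝ} (hu : IsOrthonormalSeq u M) (j k : ℕ) :
    ∫ x, |u j x * u k x| ≤ 1 := by
  have hi := ((hu.integrable_mul j j).add (hu.integrable_mul k k)).const_mul (1 / 2)
  calc ∫ x, |u j x * u k x| ≤ ∫ x, 1 / 2 * (u j x * u j x + u k x * u k x) := by
        refine integral_mono (hu.integrable_mul j k).abs hi fun x => ?_
        simp only [abs_mul]
        nlinarith [sq_nonneg (|u j x| - |u k x|), abs_mul_abs_self (u j x),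
          abs_mul_abs_self (u k x)]
    _ = 1 := by
        rw [integral_const_mul, integral_add (hu.integrable_mul j j) (hu.integrable_mul k k),
          hu.integral_mul, hu.integral_mul]
        norm_num

/-- Parseval without completeness: the squared series is a double series that can be integrated term
by term, since ∫ |u_j u_k| ≤ 1, and orthonormality keeps the diagonal. `hcM` gives pointwise
absolute convergence, `hc` the summability of the integrals. -/
theorem hasSum_sq {u : ℕ → ℝ → ℝ} {M : ℕ → ℝ} (hu : IsOrthonormalSeq u M) {c : ℕ → ℝ}
    (hc : Summable fun k => |c k|) (hcM : Summable fun k => |c k| * M k) :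
    HasSum (fun k => c k ^ 2) (∫ y, (∑' k, c k * u k y) ^ 2) := by
  have hsum : ∀ y, Summable fun k => ‖c k * u k y‖ := fun y => by
    refine Summable.of_nonneg_of_le (fun k => norm_nonneg _) (fun k => ?_) hcM
    rw [norm_mul]
    exact mul_le_mul_of_nonneg_left (hu.abs_le k y) (norm_nonneg _)
  have hsq : ∀ y, (∑' k, c k * u k y) ^ 2
      = ∑' z : ℕ × ℕ, (c z.1 * c z.2) * (u z.1 y * u z.2 y) := fun y => by
    rw [sq, tsum_mul_tsum_of_summable_norm (hsum y) (hsum y)]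
    congr 1; ext z; ring
  have h := hasSum_integral_of_summable_integral_norm (μ := (volume : Measure ℝ))
    (F := fun (z : ℕ × ℕ) (y : ℝ) => (c z.1 * c z.2) * (u z.1 y * u z.2 y))
    (fun z => (hu.integrable_mul z.1 z.2).const_mul _) (by
      refine Summable.of_nonneg_of_le (fun z => integral_nonneg fun y => norm_nonneg _)
        (fun z => ?_) (hc.mul_of_nonneg hc (fun _ => abs_nonneg _) (fun _ => abs_nonneg _))
      simp only [norm_mul (c z.1 * c z.2), Real.norm_eq_abs, integral_const_mul]
      rw [abs_mul (c z.1)]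
      exact mul_le_of_le_one_right (by positivity) (hu.integral_abs_mul_le z.1 z.2))
  simp_rw [← hsq, integral_const_mul, hu.integral_mul] at h
  have hinj : Function.Injective fun k : ℕ => (k, k) := fun a b h => (Prod.ext_iff.1 h).1
  have h2 := (hinj.hasSum_iff (f := fun z : ℕ × ℕ => c z.1 * c z.2 * if z.1 = z.2 then 1 else 0)
    (a := ∫ y, (∑' k, c k * u k y) ^ 2) (fun z hz => ?_)).2 h
  · refine h2.congr_fun ?_ |> fun h => h
    intro k
    simp [sq]
  · have : z.1 ≠ z.2 := fun h => hz ⟨z.1, Prod.ext rfl h⟩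
    simp [this]

theorem integrable_sq {u : ℕ → ℝ → ℝ} {M : ℕ → ℝ} (hu : IsOrthonormalSeq u M) {c : ℕ → ℝ}
    (hc : Summable fun k => |c k|) (hcM : Summable fun k => |c k| * M k) :
    Integrable fun y => (∑' k, c k * u k y) ^ 2 := by
  -- A nonzero Bochner integral forces integrability, and if the integral vanishes then Parseval
  -- makes every coefficient zero.
  by_cases h0 : ∫ y, (∑' k, c k * u k y) ^ 2 = 0
  · have h := hu.hasSum_sq hc hcM
    rw [h0] at h
    have h1 := (hasSum_zero_iff_of_nonneg (fun k => sq_nonneg (c k))).1 h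
    have h2 : ∀ k, c k = 0 := fun k => by simpa using congrFun h1 k
    simp [h2]
  · exact Integrable.of_integral_ne_zero h0

end IsOrthonormalSeq

/-! ## Rescaled Hermite functions -/

/-- The rescaled Hermite function `√l hₖ(l x)`. -/
noncomputable def oscFun (l : ℝ) (k : ℕ) (x : ℝ) : ℝ := √l * hermiteFun k (l * x)

theorem continuous_oscFun (l : ℝ) (k : ℕ) : Continuous (oscFun l k) :=
  continuous_const.mul ((continuous_hermiteFun k).comp (continuous_const.mul continuous_id))

theorem oscFun_sq_le {l : ℝ} (hl : 0 < l) (k : ℕ) (x : ℝ) :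
    oscFun l k x ^ 2 ≤ 2 * l * (k + 1) := by
  rw [oscFun, mul_pow, Real.sq_sqrt hl.le]
  nlinarith [hermiteFun_sq_le k (l * x)]

theorem abs_oscFun_le {l : ℝ} (hl : 0 < l) (k : ℕ) (x : ℝ) :
    |oscFun l k x| ≤ √(2 * l) * (k + 1) := by
  apply abs_le_of_sq_le_sq _ (by positivity)
  rw [mul_pow, Real.sq_sqrt (by positivity)]
  refine (oscFun_sq_le hl k x).trans ?_
  gcongr
  nlinarith [(Nat.cast_nonneg k : (0 : ℝ) ≤ k)]

theorem isOrthonormalSeq_oscFun {l : ℝ} (hl : 0 < l) :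
    IsOrthonormalSeq (oscFun l) (fun k => √(2 * l) * (k + 1)) where
  continuous := continuous_oscFun l
  abs_le := abs_oscFun_le hl
  integrable_mul j k := by
    have := ((integrable_hermiteFun_mul j k).comp_mul_left' hl.ne').const_mul (√l * √l)
    refine this.congr (Eventually.of_forall fun x => ?_)
    simp only [oscFun]; ring
  integral_mul j k := by
    have h : ∀ x, oscFun l j x * oscFun l k x
        = l * (hermiteFun j (l * x) * hermiteFun k (l * x)) := fun x => by
      simp only [oscFun]
      linear_combination hermiteFun j (l * x) * hermiteFun k (l * x) * Real.mul_self_sqrt hl.le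
    simp_rw [h]
    rw [integral_const_mul,
      Measure.integral_comp_mul_left (fun x => hermiteFun j x * hermiteFun k x) l,
      integral_hermiteFun_mul, abs_of_pos (inv_pos.2 hl), smul_eq_mul, ← mul_assoc,
      mul_inv_cancel₀ hl.ne', one_mul]

theorem IsOrthonormalSeq.comp_succ {u : ℕ → ℝ → ℝ} {M : ℕ → ℝ} (hu : IsOrthonormalSeq u M) :
    IsOrthonormalSeq (fun k => u (k + 1)) (fun k => M (k + 1)) where
  continuous k := hu.continuous _
  abs_le k := hu.abs_le _
  integrable_mul j k := hu.integrable_mul _ _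
  integral_mul j k := by simp [hu.integral_mul]

/-- The off-diagonal coefficient of the Jacobi matrix of the rescaled Hermite functions. -/
noncomputable def oscCoeff (l : ℝ) (k : ℕ) : ℝ := √(2 * (k + 1)) / (2 * l)

theorem mul_oscFun_succ {l : ℝ} (hl : 0 < l) (k : ℕ) (x : ℝ) :
    x * oscFun l (k + 1) x
      = oscCoeff l (k + 1) * oscFun l (k + 2) x + oscCoeff l k * oscFun l k x := by
  have h := hermiteFun_rec k (l * x)
  simp only [oscFun, oscCoeff]
  push_cast
  rw [show (k : ℝ) + 1 + 1 = k + 2 by ring]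
  field_simp
  simp only [mul_comm l x] at h
  linear_combination -h

theorem mul_oscFun_zero {l : ℝ} (hl : 0 < l) (x : ℝ) :
    x * oscFun l 0 x = oscCoeff l 0 * oscFun l 1 x := by
  have h := (hasDerivAt_hermiteFun 0 (l * x)).unique (hasDerivAt_hermiteFun_zero (l * x))
  simp only [oscFun, oscCoeff]
  push_cast at h ⊢
  simp only [zero_add, mul_one] at h ⊢
  field_simp
  simp only [mul_comm l x] at h
  linear_combination h

/-- The antisymmetric two-point expression of the Christoffel-Darboux formula. -/
noncomputable def oscWronskian (l : ℝ) (k : ℕ) (x y : ℝ) : ℝ :=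
  oscCoeff l k * (oscFun l (k + 1) x * oscFun l k y - oscFun l k x * oscFun l (k + 1) y)

/-- Multiplication by x is a symmetric Jacobi matrix in this basis, so each term times x - y is a
difference of consecutive expressions. Summation by parts against the weights is then a finite
induction. -/
theorem sub_mul_oscFun_succ {l : ℝ} (hl : 0 < l) (k : ℕ) (x y : ℝ) :
    (x - y) * (oscFun l (k + 1) x * oscFun l (k + 1) y)
      = oscWronskian l (k + 1) x y - oscWronskian l k x y := by
  have h1 := mul_oscFun_succ hl k x
  have h2 := mul_oscFun_succ hl k y
  simp only [oscWronskian]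
  linear_combination oscFun l (k + 1) y * h1 - oscFun l (k + 1) x * h2

theorem sub_mul_oscFun_zero {l : ℝ} (hl : 0 < l) (x y : ℝ) :
    (x - y) * (oscFun l 0 x * oscFun l 0 y) = oscWronskian l 0 x y := by
  have h1 := mul_oscFun_zero hl x
  have h2 := mul_oscFun_zero hl y
  simp only [oscWronskian]
  linear_combination oscFun l 0 y * h1 - oscFun l 0 x * h2

theorem sub_mul_sum_range {l : ℝ} (hl : 0 < l) (p : ℕ → ℝ) (x y : ℝ) (n : ℕ) :
    (x - y) * ∑ k ∈ Finset.range (n + 1), p k * oscFun l k x * oscFun l k y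
      = ∑ k ∈ Finset.range (n + 1), (p k - p (k + 1)) * oscWronskian l k x y
        + p (n + 1) * oscWronskian l n x y := by
  induction n with
  | zero =>
    simp only [zero_add, Finset.sum_range_one]
    linear_combination p 0 * sub_mul_oscFun_zero hl x y
  | succ n ih =>
    rw [Finset.sum_range_succ, mul_add, ih,
      Finset.sum_range_succ (fun k => (p k - p (k + 1)) * oscWronskian l k x y) (n + 1)]
    linear_combination p (n + 1) * sub_mul_oscFun_succ hl n x y

/-! ## Kernels diagonal in the Hermite basis -/

/-- Rapidly decreasing weights. -/
def IsRapid (p : ℕ → ℝ) : Prop := ∀ m : ℕ, Summable fun k => |p k| * ((k : ℝ) + 1) ^ m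

theorem IsRapid.mono {p q : ℕ → ℝ} (hp : IsRapid p) (h : ∀ k, |q k| ≤ |p k|) : IsRapid q :=
  fun m => Summable.of_nonneg_of_le (fun k => by positivity)
    (fun k => mul_le_mul_of_nonneg_right (h k) (by positivity)) (hp m)

theorem IsRapid.succ {p : ℕ → ℝ} (hp : IsRapid p) : IsRapid fun k => p (k + 1) := fun m => by
  refine Summable.of_nonneg_of_le (fun k => by positivity) (fun k => ?_)
    ((summable_nat_add_iff 1).2 (hp m))
  push_cast
  gcongr
  linarith

theorem IsRapid.sub {p q : ℕ → ℝ} (hp : IsRapid p) (hq : IsRapid q) :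
    IsRapid fun k => p k - q k := fun m => by
  refine Summable.of_nonneg_of_le (fun k => by positivity) (fun k => ?_) ((hp m).add (hq m))
  rw [← add_mul]
  gcongr
  exact abs_sub _ _

theorem IsRapid.summable_mul {p c : ℕ → ℝ} (hp : IsRapid p) (A : ℝ) (m : ℕ)
    (hc : ∀ k, |c k| ≤ A * ((k : ℝ) + 1) ^ m) : Summable fun k => |p k * c k| := by
  refine Summable.of_nonneg_of_le (fun k => abs_nonneg _) (fun k => ?_) ((hp m).mul_left A)
  rw [abs_mul]
  calc |p k| * |c k| ≤ |p k| * (A * ((k : ℝ) + 1) ^ m) := by gcongr; exact hc k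
    _ = _ := by ring

theorem IsRapid.mul {p c : ℕ → ℝ} (hp : IsRapid p) (A : ℝ) (m : ℕ)
    (hc : ∀ k, |c k| ≤ A * ((k : ℝ) + 1) ^ m) : IsRapid fun k => p k * c k := fun n => by
  refine Summable.of_nonneg_of_le (fun k => by positivity) (fun k => ?_)
    ((hp (m + n)).mul_left A)
  rw [abs_mul]
  calc |p k| * |c k| * ((k : ℝ) + 1) ^ n
      ≤ |p k| * (A * ((k : ℝ) + 1) ^ m) * ((k : ℝ) + 1) ^ n := by gcongr; exact hc k
    _ = _ := by ring

theorem IsRapid.summable {p : ℕ → ℝ} (hp : IsRapid p) : Summable fun k => |p k| := by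
  simpa using hp 0

theorem IsRapid.summable_mul_linear {p : ℕ → ℝ} (hp : IsRapid p) (A : ℝ) :
    Summable fun k => |p k| * (A * ((k : ℝ) + 1)) := by
  refine ((hp 1).mul_left A).congr fun k => ?_
  rw [pow_one]; ring

/-- The kernel `∑ₖ pₖ eₖ(x) eₖ(y)` of an operator diagonal in the Hermite basis. -/
noncomputable def oscKernel (p : ℕ → ℝ) (l : ℝ) (x y : ℝ) : ℝ :=
  ∑' k, p k * oscFun l k x * oscFun l k y

theorem abs_oscFun_mul_le {l : ℝ} (hl : 0 < l) (k : ℕ) (x y : ℝ) :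
    |oscFun l k x * oscFun l k y| ≤ 2 * l * ((k : ℝ) + 1) ^ 2 := by
  rw [abs_mul]
  calc |oscFun l k x| * |oscFun l k y| ≤ (√(2 * l) * (k + 1)) * (√(2 * l) * (k + 1)) :=
        mul_le_mul (abs_oscFun_le hl k x) (abs_oscFun_le hl k y) (abs_nonneg _) (by positivity)
    _ = _ := by linear_combination ((k : ℝ) + 1) ^ 2 * Real.mul_self_sqrt (by positivity : 0 ≤ 2 * l)

theorem norm_oscKernel_term_le {l : ℝ} (hl : 0 < l) (p : ℕ → ℝ) (k : ℕ) (x y : ℝ) :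
    ‖p k * oscFun l k x * oscFun l k y‖ ≤ 2 * l * (|p k| * ((k : ℝ) + 1) ^ 2) := by
  rw [mul_assoc, norm_mul, Real.norm_eq_abs]
  calc |p k| * ‖oscFun l k x * oscFun l k y‖ ≤ |p k| * (2 * l * ((k : ℝ) + 1) ^ 2) := by
        gcongr; exact abs_oscFun_mul_le hl k x y
    _ = _ := by ring

theorem summable_oscKernel {p : ℕ → ℝ} (hp : IsRapid p) {l : ℝ} (hl : 0 < l) (x y : ℝ) :
    Summable fun k => p k * oscFun l k x * oscFun l k y :=
  Summable.of_norm_bounded ((hp 2).mul_left (2 * l)) fun k => norm_oscKernel_term_le hl p k x y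

theorem continuous_oscKernel {p : ℕ → ℝ} (hp : IsRapid p) {l : ℝ} (hl : 0 < l) :
    Continuous fun z : ℝ × ℝ => oscKernel p l z.1 z.2 := by
  refine continuous_tsum (fun k => ?_) ((hp 2).mul_left (2 * l))
    fun k z => norm_oscKernel_term_le hl p k z.1 z.2
  have := continuous_oscFun l k
  fun_prop

theorem continuous_oscKernel_right {p : ℕ → ℝ} (hp : IsRapid p) {l : ℝ} (hl : 0 < l) (x : ℝ) :
    Continuous (oscKernel p l x) :=
  continuous_tsum (fun k => continuous_const.mul (continuous_oscFun l k))
    ((hp 2).mul_left (2 * l)) fun k y => norm_oscKernel_term_le hl p k x y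

theorem continuous_oscKernel_self {p : ℕ → ℝ} (hp : IsRapid p) {l : ℝ} (hl : 0 < l) :
    Continuous fun x => oscKernel p l x x :=
  continuous_tsum (fun k => (continuous_const.mul (continuous_oscFun l k)).mul
    (continuous_oscFun l k)) ((hp 2).mul_left (2 * l))
    fun k y => norm_oscKernel_term_le hl p k y y

theorem exists_abs_oscKernel_le {p : ℕ → ℝ} (hp : IsRapid p) {l : ℝ} (hl : 0 < l) :
    ∃ C : ℝ, 0 ≤ C ∧ ∀ x y, |oscKernel p l x y| ≤ C :=
  ⟨∑' k, 2 * l * (|p k| * ((k : ℝ) + 1) ^ 2), tsum_nonneg fun k => by positivity, fun x y =>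
    tsum_of_norm_bounded ((hp 2).mul_left (2 * l)).hasSum
      fun k => norm_oscKernel_term_le hl p k x y⟩

theorem oscKernel_comm (p : ℕ → ℝ) (l : ℝ) (x y : ℝ) : oscKernel p l x y = oscKernel p l y x :=
  tsum_congr fun k => by ring

theorem integrable_oscKernel_sq {p : ℕ → ℝ} (hp : IsRapid p) {l : ℝ} (hl : 0 < l) (x : ℝ) :
    Integrable fun y => oscKernel p l x y ^ 2 := by
  have hr : IsRapid fun k => p k * oscFun l k x :=
    hp.mul (√(2 * l)) 1 fun k => by simpa using abs_oscFun_le hl k x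
  exact (isOrthonormalSeq_oscFun hl).integrable_sq hr.summable (hr.summable_mul_linear _)

theorem integral_oscKernel_sq {p : ℕ → ℝ} (hp : IsRapid p) {l : ℝ} (hl : 0 < l) (x : ℝ) :
    ∫ y, oscKernel p l x y ^ 2 = oscKernel (fun k => p k ^ 2) l x x := by
  have hr : IsRapid fun k => p k * oscFun l k x :=
    hp.mul (√(2 * l)) 1 fun k => by simpa using abs_oscFun_le hl k x
  have h := (isOrthonormalSeq_oscFun hl).hasSum_sq hr.summable (hr.summable_mul_linear _)
  refine h.tsum_eq.symm.trans (tsum_congr fun k => by ring)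

theorem oscCoeff_nonneg {l : ℝ} (hl : 0 < l) (k : ℕ) : 0 ≤ oscCoeff l k := by
  unfold oscCoeff; positivity

theorem oscCoeff_le {l : ℝ} (hl : 0 < l) (k : ℕ) : |oscCoeff l k| ≤ l⁻¹ * ((k : ℝ) + 1) ^ 1 := by
  rw [abs_of_nonneg (oscCoeff_nonneg hl k), oscCoeff, div_le_iff₀ (by positivity), pow_one]
  have : l⁻¹ * ((k : ℝ) + 1) * (2 * l) = 2 * (k + 1) := by field_simp
  rw [this]
  apply Real.sqrt_le_iff.2 ⟨by positivity, ?_⟩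
  nlinarith [(Nat.cast_nonneg k : (0 : ℝ) ≤ k)]

theorem abs_oscFun_succ_le {l : ℝ} (hl : 0 < l) (k : ℕ) (x : ℝ) :
    |oscFun l (k + 1) x| ≤ (2 * √(2 * l)) * ((k : ℝ) + 1) ^ 1 := by
  refine (abs_oscFun_le hl (k + 1) x).trans ?_
  push_cast
  have h := Real.sqrt_nonneg (2 * l)
  have : (0 : ℝ) ≤ k := Nat.cast_nonneg k
  nlinarith

theorem isRapid_left {d : ℕ → ℝ} (hd : IsRapid d) {l : ℝ} (hl : 0 < l) (x : ℝ) :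
    IsRapid fun k => d k * oscCoeff l k * oscFun l k x :=
  (hd.mul _ _ (oscCoeff_le hl)).mul (√(2 * l)) 1 fun k => by simpa using abs_oscFun_le hl k x

theorem isRapid_right {d : ℕ → ℝ} (hd : IsRapid d) {l : ℝ} (hl : 0 < l) (x : ℝ) :
    IsRapid fun k => d k * oscCoeff l k * oscFun l (k + 1) x :=
  (hd.mul _ _ (oscCoeff_le hl)).mul _ 1 (abs_oscFun_succ_le hl · x)

theorem summable_left {d : ℕ → ℝ} (hd : IsRapid d) {l : ℝ} (hl : 0 < l) (x y : ℝ) :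
    Summable fun k => (d k * oscCoeff l k * oscFun l (k + 1) x) * oscFun l k y :=
  ((isRapid_right hd hl x).summable_mul (√(2 * l)) 1
    fun k => by simpa using abs_oscFun_le hl k y).of_abs

theorem summable_right {d : ℕ → ℝ} (hd : IsRapid d) {l : ℝ} (hl : 0 < l) (x y : ℝ) :
    Summable fun k => (d k * oscCoeff l k * oscFun l k x) * oscFun l (k + 1) y :=
  ((isRapid_left hd hl x).summable_mul _ 1 (abs_oscFun_succ_le hl · y)).of_abs

theorem hasSum_oscWronskian {d : ℕ → ℝ} (hd : IsRapid d) {l : ℝ} (hl : 0 < l) (x y : ℝ) :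
    HasSum (fun k => d k * oscWronskian l k x y)
      (∑' k, (d k * oscCoeff l k * oscFun l (k + 1) x) * oscFun l k y
        - ∑' k, (d k * oscCoeff l k * oscFun l k x) * oscFun l (k + 1) y) := by
  refine ((summable_left hd hl x y).hasSum.sub (summable_right hd hl x y).hasSum).congr_fun ?_
  intro k
  simp only [oscWronskian]; ring

/-- The Christoffel-Darboux formula after summation by parts. -/
theorem sub_mul_oscKernel {p : ℕ → ℝ} (hp : IsRapid p) {l : ℝ} (hl : 0 < l) (x y : ℝ) :
    (x - y) * oscKernel p l x y = ∑' k, (p k - p (k + 1)) * oscWronskian l k x y := by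
  have hd : IsRapid fun k => p k - p (k + 1) := hp.sub hp.succ
  have h1 := ((summable_oscKernel hp hl x y).hasSum.tendsto_sum_nat.const_mul (x - y)).comp
    (tendsto_add_atTop_nat 1)
  have h2 := (hasSum_oscWronskian hd hl x y).summable.hasSum.tendsto_sum_nat.comp
    (tendsto_add_atTop_nat 1)
  -- The boundary term of the summation by parts vanishes in the limit, being the general term of a
  -- convergent series.
  have h3 : Tendsto (fun n => p (n + 1) * oscWronskian l n x y) atTop (𝓝 0) :=
    (hasSum_oscWronskian hp.succ hl x y).summable.tendsto_atTop_zero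
  have h4 := h2.add h3
  rw [add_zero] at h4
  refine tendsto_nhds_unique h1 (h4.congr fun n => ?_)
  exact (sub_mul_sum_range hl p x y n).symm

/-- For fixed x, (x-y)K is a difference U - V of two series in y, one in the functions e_k and one
in the e_{k+1}. Parseval applies to each, and (U-V)² ≤ 2(U²+V²). This L² bound over all y replaces
pointwise asymptotics, which are available only for bounded y. -/
theorem integral_sub_mul_oscKernel_sq_le {p : ℕ → ℝ} (hp : IsRapid p) {l : ℝ} (hl : 0 < l)
    (x : ℝ) :
    Integrable (fun y => ((x - y) * oscKernel p l x y) ^ 2) ∧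
    ∫ y, ((x - y) * oscKernel p l x y) ^ 2
      ≤ 2 * ∑' k, (p k - p (k + 1)) ^ 2 * oscCoeff l k ^ 2
          * (oscFun l (k + 1) x ^ 2 + oscFun l k x ^ 2) := by
  have hd : IsRapid fun k => p k - p (k + 1) := hp.sub hp.succ
  have hL := isRapid_left hd hl x
  have hR := isRapid_right hd hl x
  have hL1 : Summable fun k => |(p k - p (k + 1)) * oscCoeff l k * oscFun l k x|
      * (√(2 * l) * (((k + 1 : ℕ) : ℝ) + 1)) := by
    refine Summable.of_nonneg_of_le (fun k => by positivity) (fun k => ?_)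
      ((hL 1).mul_left (2 * √(2 * l)))
    push_cast
    have h := Real.sqrt_nonneg (2 * l)
    have : (0 : ℝ) ≤ k := Nat.cast_nonneg k
    calc |(p k - p (k + 1)) * oscCoeff l k * oscFun l k x| * (√(2 * l) * ((k : ℝ) + 1 + 1))
        ≤ |(p k - p (k + 1)) * oscCoeff l k * oscFun l k x| * (2 * √(2 * l) * (k + 1)) :=
          mul_le_mul_of_nonneg_left (by nlinarith) (abs_nonneg _)
      _ = _ := by ring
  have hR1 : Summable fun k => |(p k - p (k + 1)) * oscCoeff l k * oscFun l (k + 1) x|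
      * (√(2 * l) * ((k : ℝ) + 1)) :=
    hR.summable_mul_linear _
  have ho := isOrthonormalSeq_oscFun hl
  have iU := ho.integrable_sq hR.summable hR1
  have iV := ho.comp_succ.integrable_sq hL.summable hL1
  have sU := ho.hasSum_sq hR.summable hR1
  have sV := ho.comp_succ.hasSum_sq hL.summable hL1
  obtain ⟨U, hU⟩ : ∃ U : ℝ → ℝ, U = fun y =>
    ∑' k, ((p k - p (k + 1)) * oscCoeff l k * oscFun l (k + 1) x) * oscFun l k y := ⟨_, rfl⟩
  obtain ⟨V, hV⟩ : ∃ V : ℝ → ℝ, V = fun y =>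
    ∑' k, ((p k - p (k + 1)) * oscCoeff l k * oscFun l k x) * oscFun l (k + 1) y := ⟨_, rfl⟩
  have eUV : ∀ y, (x - y) * oscKernel p l x y = U y - V y := fun y => by
    rw [sub_mul_oscKernel hp hl, (hasSum_oscWronskian hd hl x y).tsum_eq, hU, hV]
  have iU' : Integrable fun y => U y ^ 2 := by rw [hU]; exact iU
  have iV' : Integrable fun y => V y ^ 2 := by rw [hV]; exact iV
  have sU' : HasSum (fun k => ((p k - p (k + 1)) * oscCoeff l k * oscFun l (k + 1) x) ^ 2)
      (∫ y, U y ^ 2) := by rw [hU]; exact sU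
  have sV' : HasSum (fun k => ((p k - p (k + 1)) * oscCoeff l k * oscFun l k x) ^ 2)
      (∫ y, V y ^ 2) := by rw [hV]; exact sV
  have hle : ∀ y, ((x - y) * oscKernel p l x y) ^ 2 ≤ 2 * (U y ^ 2 + V y ^ 2) := by
    intro y
    rw [eUV]
    nlinarith [sq_nonneg (U y + V y)]
  have iUV : Integrable fun y => 2 * (U y ^ 2 + V y ^ 2) := (iU'.add iV').const_mul 2
  have hcont : Continuous fun y => ((x - y) * oscKernel p l x y) ^ 2 := by
    have := continuous_oscKernel_right hp hl x
    fun_prop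
  have hint : Integrable (fun y => ((x - y) * oscKernel p l x y) ^ 2) := by
    refine iUV.mono' hcont.aestronglyMeasurable (Eventually.of_forall fun y => ?_)
    rw [Real.norm_of_nonneg (sq_nonneg _)]
    exact hle y
  refine ⟨hint, (integral_mono hint iUV hle).trans (le_of_eq ?_)⟩
  have hs := sU'.add sV'
  have hs' : ∑' k, (p k - p (k + 1)) ^ 2 * oscCoeff l k ^ 2
      * (oscFun l (k + 1) x ^ 2 + oscFun l k x ^ 2) = (∫ y, U y ^ 2) + ∫ y, V y ^ 2 := by
    rw [← hs.tsum_eq]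
    exact tsum_congr fun k => by ring
  rw [integral_const_mul, integral_add iU' iV', hs']

/-! ## Mesoscopic asymptotics of Hermite functions -/

/-- The microscopic scale `π √N / √2`. -/
noncomputable def microScale (N : ℝ) : ℝ := Real.pi * √N / √2

/-- The scale after zooming in by the factor `N ^ α`. -/
noncomputable def mesoScale (α N : ℝ) : ℝ := microScale N * N ^ (-α)

theorem microScale_pos {N : ℝ} (hN : 0 < N) : 0 < microScale N := by
  have := Real.pi_pos
  unfold microScale; positivity

theorem mesoScale_pos (α : ℝ) {N : ℝ} (hN : 0 < N) : 0 < mesoScale α N :=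
  mul_pos (microScale_pos hN) (Real.rpow_pos_of_pos hN _)

theorem microScale_sq {N : ℝ} (hN : 0 ≤ N) : microScale N ^ 2 = Real.pi ^ 2 * N / 2 := by
  rw [microScale, div_pow, mul_pow, Real.sq_sqrt hN, Real.sq_sqrt (by norm_num)]

theorem mesoScale_sq (α : ℝ) {N : ℝ} (hN : 0 ≤ N) :
    mesoScale α N ^ 2 = Real.pi ^ 2 / 2 * N * (N ^ (-α)) ^ 2 := by
  rw [mesoScale, mul_pow, microScale_sq hN]; ring

theorem tendsto_mesoScale_sq_div {α : ℝ} (hα : 0 < α) (x : ℝ) :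
    Tendsto (fun N => (mesoScale α N * x) ^ 2 / N) atTop (𝓝 0) := by
  have h := ((tendsto_rpow_neg_atTop hα).pow 2).const_mul (Real.pi ^ 2 / 2 * x ^ 2)
  norm_num at h
  refine h.congr' ?_
  filter_upwards [eventually_gt_atTop 0] with N hN
  rw [mul_pow, mesoScale_sq α hN.le]
  field_simp

section

variable {α r : ℝ} {k : ℝ → ℕ}

/-- As α < 1, the window of width N^α around N is negligible compared with N. The hypothesis `hk`
recurs below: r is the position of k in that window. -/
theorem tendsto_div_of_window (hα1 : α < 1)
    (hk : Tendsto (fun N => ((k N : ℝ) - N) / N ^ α) atTop (𝓝 r)) :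
    Tendsto (fun N => (2 * (k N : ℝ) + 1) / N) atTop (𝓝 2) := by
  have h1 : Tendsto (fun N : ℝ => N ^ (-(1 - α))) atTop (𝓝 0) :=
    tendsto_rpow_neg_atTop (by linarith)
  have h2 : Tendsto (fun N : ℝ => N⁻¹) atTop (𝓝 0) := tendsto_inv_atTop_zero
  have h := (((hk.mul h1).const_mul 2).add h2).const_add 2
  norm_num at h
  refine h.congr' ?_
  filter_upwards [eventually_gt_atTop 0] with N hN
  have h3 : N ^ (-(1 - α)) = N ^ α / N := by
    rw [show -(1 - α) = α - 1 by ring, Real.rpow_sub hN, Real.rpow_one]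
  have := Real.rpow_pos_of_pos hN α
  rw [show α - 1 = -(1 - α) by ring, h3]
  field_simp
  ring

theorem tendsto_index_atTop (hα1 : α < 1)
    (hk : Tendsto (fun N => ((k N : ℝ) - N) / N ^ α) atTop (𝓝 r)) :
    Tendsto k atTop atTop := by
  have h := (tendsto_div_of_window hα1 hk).pos_mul_atTop (by norm_num) tendsto_id
  have h2 : Tendsto (fun N => 2 * (k N : ℝ) + 1) atTop atTop := by
    refine h.congr' ?_
    filter_upwards [eventually_gt_atTop 0] with N hN
    simp only [id]
    field_simp
  rw [← tendsto_natCast_atTop_iff (R := ℝ)]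
  refine tendsto_atTop.2 fun b => ?_
  filter_upwards [tendsto_atTop.1 h2 (2 * b + 1)] with N hN
  linarith

/-- The fourth power is (π²N/2) A⁴, and A⁴ is equivalent to (2/π)²/(2N), so the normalization of the
scale makes the limit exactly 1. -/
theorem tendsto_sqrt_microScale_mul_amp (hα1 : α < 1)
    (hk : Tendsto (fun N => ((k N : ℝ) - N) / N ^ α) atTop (𝓝 r)) :
    Tendsto (fun N => √(microScale N) * hermiteAmp (k N)) atTop (𝓝 1) := by
  have h1 := tendsto_hermiteAmp.comp (tendsto_index_atTop hα1 hk)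
  have h2 := ((tendsto_div_of_window hα1 hk).inv₀ (by norm_num)).mul h1
  have h3 := ((h2.const_mul (Real.pi ^ 2 / 2)).sqrt).sqrt
  have hπ := Real.pi_pos
  have e : √√(Real.pi ^ 2 / 2 * (2⁻¹ * (2 / Real.pi) ^ 2)) = 1 := by
    have : Real.pi ^ 2 / 2 * (2⁻¹ * (2 / Real.pi) ^ 2) = 1 := by field_simp
    rw [this]; simp
  rw [e] at h3
  refine h3.congr' ?_
  filter_upwards [eventually_gt_atTop 0] with N hN
  have hs := microScale_pos hN
  have hA := hermiteAmp_nonneg (k N)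
  have : Real.pi ^ 2 / 2 * (((2 * (k N : ℝ) + 1) / N)⁻¹ * ((2 * (k N : ℝ) + 1) * hermiteAmp (k N) ^ 4))
      = ((√(microScale N) * hermiteAmp (k N)) ^ 2) ^ 2 := by
    rw [mul_pow, Real.sq_sqrt hs.le, mul_pow, microScale_sq hN.le]
    field_simp
  simp only [Function.comp]
  rw [this, Real.sqrt_sq (by positivity), Real.sqrt_sq (by positivity)]

/-- The difference of the two phase velocities l√(2k+1-(lx)²) and l√(2N-(lx)²), rationalized. The
numerator is about 2rlN^α and the denominator about 2√(2N). -/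
theorem tendsto_window_slope (hα0 : 0 < α) (hα1 : α < 1)
    (hk : Tendsto (fun N => ((k N : ℝ) - N) / N ^ α) atTop (𝓝 r)) (x : ℝ) :
    Tendsto (fun N => mesoScale α N * (2 * k N + 1 - 2 * N) /
      (√(2 * k N + 1 - (mesoScale α N * x) ^ 2) + √(2 * N - (mesoScale α N * x) ^ 2)))
      atTop (𝓝 (r * (Real.pi / 2))) := by
  have h1 : Tendsto (fun N => Real.pi / √2 * (2 * (((k N : ℝ) - N) / N ^ α) + N ^ (-α))) atTop
      (𝓝 (Real.pi / √2 * (2 * r + 0))) :=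
    ((hk.const_mul 2).add (tendsto_rpow_neg_atTop hα0)).const_mul _
  have h2 := ((tendsto_div_of_window hα1 hk).sub (tendsto_mesoScale_sq_div hα0 x)).sqrt
  have h3 := ((tendsto_mesoScale_sq_div hα0 x).const_sub 2).sqrt
  have h4 := h1.div (h2.add h3) (by norm_num)
  have e : Real.pi / √2 * (2 * r + 0) / (√(2 - 0) + √(2 - 0)) = r * (Real.pi / 2) := by
    rw [sub_zero]
    field_simp
    rw [Real.sq_sqrt (by norm_num)]; ring
  rw [e] at h4
  refine h4.congr' ?_
  filter_upwards [eventually_gt_atTop 0] with N hN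
  have hs : 0 < √N := Real.sqrt_pos.2 hN
  have e1 : √((2 * (k N : ℝ) + 1) / N - (mesoScale α N * x) ^ 2 / N)
      = √(2 * k N + 1 - (mesoScale α N * x) ^ 2) / √N := by
    rw [← sub_div, Real.sqrt_div' _ hN.le]
  have e2 : √(2 - (mesoScale α N * x) ^ 2 / N) = √(2 * N - (mesoScale α N * x) ^ 2) / √N := by
    rw [← Real.sqrt_div' _ hN.le]
    congr 1; field_simp
  have hp := Real.rpow_pos_of_pos hN α
  simp only [Pi.div_apply]
  rw [e1, e2, ← add_div, div_div_eq_mul_div]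
  congr 1
  rw [mesoScale, microScale, Real.rpow_neg hN.le]
  field_simp
  ring

theorem hasDerivAt_oscAction_scaled (E l v : ℝ) :
    HasDerivAt (fun v => oscAction E (l * v)) (l * √(E - (l * v) ^ 2)) v := by
  have hm : HasDerivAt (fun v : ℝ => l * v) l v := by simpa using (hasDerivAt_id v).const_mul l
  refine ((hasDerivAt_oscAction E (l * v)).comp v hm).congr_deriv (mul_comm _ _)

theorem oscAction_zero (E : ℝ) : oscAction E 0 = 0 := by simp [oscAction]

/-- Mean value inequality on [-|x|, |x|]: the phase difference vanishes at 0, and its derivative is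
uniformly close to rπ/2. -/
theorem tendsto_oscAction_sub (hα0 : 0 < α) (hα1 : α < 1)
    (hk : Tendsto (fun N => ((k N : ℝ) - N) / N ^ α) atTop (𝓝 r)) (x : ℝ) :
    Tendsto (fun N => oscAction (2 * k N + 1) (mesoScale α N * x)
      - oscAction (2 * N) (mesoScale α N * x)) atTop (𝓝 (r * (Real.pi / 2) * x)) := by
  set s : ℝ → ℝ → ℝ := fun N x => mesoScale α N * (2 * k N + 1 - 2 * N) /
      (√(2 * k N + 1 - (mesoScale α N * x) ^ 2) + √(2 * N - (mesoScale α N * x) ^ 2)) with hs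
  have h0 : Tendsto (fun N => s N 0) atTop (𝓝 (r * (Real.pi / 2))) :=
    tendsto_window_slope hα0 hα1 hk 0
  have hx : Tendsto (fun N => s N x) atTop (𝓝 (r * (Real.pi / 2))) :=
    tendsto_window_slope hα0 hα1 hk x
  have hb : Tendsto (fun N => (|s N 0 - r * (Real.pi / 2)| + |s N x - s N 0|) * ‖x - 0‖) atTop
      (𝓝 ((|r * (Real.pi / 2) - r * (Real.pi / 2)| + |r * (Real.pi / 2) - r * (Real.pi / 2)|)
        * ‖x - 0‖)) :=
    ((h0.sub_const _).abs.add (hx.sub h0).abs).mul_const _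
  simp only [sub_self, abs_zero, add_zero, zero_mul] at hb
  rw [tendsto_iff_norm_sub_tendsto_zero]
  refine squeeze_zero' (Eventually.of_forall fun _ => norm_nonneg _) ?_ hb
  have hlim1 := (tendsto_div_of_window hα1 hk).sub (tendsto_mesoScale_sq_div hα0 x)
  have hlim2 := (tendsto_mesoScale_sq_div hα0 x).const_sub 2
  filter_upwards [eventually_gt_atTop 0, hlim1.eventually (lt_mem_nhds (by norm_num : (0:ℝ) < 2 - 0)),
    hlim2.eventually (lt_mem_nhds (by norm_num : (0:ℝ) < 2 - 0))] with N hN g1 g2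
  set l := mesoScale α N with hl
  have hl0 : 0 < l := mesoScale_pos α hN
  have p1 : 0 < 2 * (k N : ℝ) + 1 - (l * x) ^ 2 := by
    rw [← sub_div] at g1
    exact (div_pos_iff_of_pos_right hN).1 g1
  have p2 : 0 < 2 * N - (l * x) ^ 2 := by
    have : (2 : ℝ) - (l * x) ^ 2 / N = (2 * N - (l * x) ^ 2) / N := by field_simp
    rw [this] at g2
    exact (div_pos_iff_of_pos_right hN).1 g2
  set D : ℝ → ℝ := fun v => √(2 * k N + 1 - (l * v) ^ 2) + √(2 * N - (l * v) ^ 2) with hD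
  have hDx : 0 < D x := add_pos (Real.sqrt_pos.2 p1) (Real.sqrt_pos.2 p2)
  have hvx : ∀ v ∈ Set.Icc (-|x|) |x|, (l * v) ^ 2 ≤ (l * x) ^ 2 := fun v hv => by
    rw [mul_pow, mul_pow]
    have := sq_le_sq' hv.1 hv.2
    rw [sq_abs] at this
    gcongr
  have hDle : ∀ v ∈ Set.Icc (-|x|) |x|, D x ≤ D v := fun v hv => by
    have := hvx v hv
    simp only [hD]
    gcongr
  have hDle0 : ∀ v, D v ≤ D 0 := fun v => by
    have : (l * 0) ^ 2 ≤ (l * v) ^ 2 := by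
      rw [mul_zero, zero_pow two_ne_zero]; positivity
    simp only [hD]
    gcongr
  have hder : ∀ v ∈ Set.Icc (-|x|) |x|, l * √(2 * k N + 1 - (l * v) ^ 2) - l * √(2 * N - (l * v) ^ 2)
      = l * (2 * k N + 1 - 2 * N) / D v := fun v hv => by
    have hDv : 0 < D v := hDx.trans_le (hDle v hv)
    rw [eq_div_iff hDv.ne']
    have q1 : √(2 * (k N : ℝ) + 1 - (l * v) ^ 2) ^ 2 = 2 * k N + 1 - (l * v) ^ 2 :=
      Real.sq_sqrt (by linarith [hvx v hv])
    have q2 : √(2 * N - (l * v) ^ 2) ^ 2 = 2 * N - (l * v) ^ 2 :=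
      Real.sq_sqrt (by linarith [hvx v hv])
    simp only [hD]
    linear_combination l * q1 - l * q2
  have key := (convex_Icc (-|x|) |x|).norm_image_sub_le_of_norm_hasDerivWithin_le
    (f := fun v => oscAction (2 * k N + 1) (l * v) - oscAction (2 * N) (l * v)
      - r * (Real.pi / 2) * v)
    (f' := fun v => l * √(2 * k N + 1 - (l * v) ^ 2) - l * √(2 * N - (l * v) ^ 2)
      - r * (Real.pi / 2)) (C := |s N 0 - r * (Real.pi / 2)| + |s N x - s N 0|) (x := 0) (y := x)
    (fun v _ => (((hasDerivAt_oscAction_scaled _ l v).sub (hasDerivAt_oscAction_scaled _ l v)).sub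
      (by simpa using (hasDerivAt_id v).const_mul (r * (Real.pi / 2)))).hasDerivWithinAt)
    (fun v hv => ?_) ⟨by simp, abs_nonneg x⟩ ⟨neg_abs_le x, le_abs_self x⟩
  · simpa [oscAction_zero] using key
  · rw [hder v hv, Real.norm_eq_abs]
    have hDv : 0 < D v := hDx.trans_le (hDle v hv)
    have hD0 : 0 < D 0 := hDv.trans_le (hDle0 v)
    have e0 : s N 0 = l * (2 * k N + 1 - 2 * N) / D 0 := rfl
    have ex : s N x = l * (2 * k N + 1 - 2 * N) / D x := rfl
    set c := l * (2 * (k N : ℝ) + 1 - 2 * N) with hc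
    -- D decreases with |v|, so the slope at v lies between the slopes at 0 and at x. Convergence at
    -- these two points therefore controls the whole interval.
    have h2 : |c / D v - s N 0| ≤ |s N x - s N 0| := by
      rw [e0, ex, div_eq_mul_inv, div_eq_mul_inv, div_eq_mul_inv, ← mul_sub, ← mul_sub,
        abs_mul c, abs_mul c]
      have i1 : (D 0)⁻¹ ≤ (D v)⁻¹ := inv_anti₀ hDv (hDle0 v)
      have i2 : (D v)⁻¹ ≤ (D x)⁻¹ := inv_anti₀ hDx (hDle v hv)
      rw [abs_of_nonneg (by linarith : 0 ≤ (D v)⁻¹ - (D 0)⁻¹),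
        abs_of_nonneg (by linarith : 0 ≤ (D x)⁻¹ - (D 0)⁻¹)]
      gcongr
    calc |c / D v - r * (Real.pi / 2)|
        = |(c / D v - s N 0) + (s N 0 - r * (Real.pi / 2))| := by congr 1; ring
      _ ≤ |c / D v - s N 0| + |s N 0 - r * (Real.pi / 2)| := abs_add_le _ _
      _ ≤ _ := by linarith

/-- The phase of the Hermite functions of index close to `N` near the origin. -/
noncomputable def mesoPhase (α N x : ℝ) : ℝ := oscAction (2 * N) (mesoScale α N * x)

/-- Three errors tend to 0: the WKB remainder, of relative size (lx)²/(2k+1); the amplitude, which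
tends to 1; and the phase, relative to that of energy 2N. The comparison phase has no limit, so the
statement concerns a difference. -/
theorem tendsto_hermiteFun_sub_cos (hα0 : 0 < α) (hα1 : α < 1)
    (hk : Tendsto (fun N => ((k N : ℝ) - N) / N ^ α) atTop (𝓝 r)) (x : ℝ) :
    Tendsto (fun N => √(microScale N) * hermiteFun (k N) (mesoScale α N * x)
      - Real.cos (mesoPhase α N x + r * (Real.pi / 2) * x - k N * (Real.pi / 2)))
      atTop (𝓝 0) := by
  have hA := tendsto_sqrt_microScale_mul_amp hα1 hk
  have hS := tendsto_oscAction_sub hα0 hα1 hk x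
  have hq : Tendsto (fun N => (mesoScale α N * x) ^ 2 / (2 * (k N : ℝ) + 1)) atTop (𝓝 0) := by
    have h := (tendsto_mesoScale_sq_div hα0 x).div (tendsto_div_of_window hα1 hk) (by norm_num)
    rw [zero_div] at h
    refine h.congr' ?_
    filter_upwards [eventually_gt_atTop 0] with N hN
    simp only [Pi.div_apply]
    field_simp
  have hbound : Tendsto (fun N => 8 * (√(microScale N) * hermiteAmp (k N))
      * ((mesoScale α N * x) ^ 2 / (2 * (k N : ℝ) + 1))
      + |√(microScale N) * hermiteAmp (k N) - 1|
      + |oscAction (2 * k N + 1) (mesoScale α N * x)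
      - oscAction (2 * N) (mesoScale α N * x) - r * (Real.pi / 2) * x|) atTop
      (𝓝 (8 * 1 * 0 + |(1 : ℝ) - 1| + |r * (Real.pi / 2) * x - r * (Real.pi / 2) * x|)) :=
    (((hA.const_mul 8).mul hq).add (hA.sub_const 1).abs).add (hS.sub_const _).abs
  simp only [mul_zero, sub_self, abs_zero, add_zero] at hbound
  refine squeeze_zero_norm' ?_ hbound
  filter_upwards [hq.eventually (ge_mem_nhds (by norm_num : (0 : ℝ) < 1 / 2))] with N hN
  have hpos : (0 : ℝ) < 2 * k N + 1 := by positivity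
  rw [div_le_iff₀ hpos] at hN
  have hw := hermiteFun_wkb (k := k N) (x := mesoScale α N * x) (by linarith)
  set A := oscAction (2 * k N + 1) (mesoScale α N * x) - k N * (Real.pi / 2) with hAdef
  set B := mesoPhase α N x + r * (Real.pi / 2) * x - k N * (Real.pi / 2) with hB
  set m := √(microScale N)
  have hm : 0 ≤ m := Real.sqrt_nonneg _
  set a := hermiteAmp (k N)
  set h := hermiteFun (k N) (mesoScale α N * x)
  have e : m * h - Real.cos B = m * (h - a * Real.cos A) + (m * a - 1) * Real.cos A
      + (Real.cos A - Real.cos B) := by ring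
  rw [e, Real.norm_eq_abs]
  have h1 : |m * (h - a * Real.cos A)| ≤ 8 * (m * a)
      * ((mesoScale α N * x) ^ 2 / (2 * (k N : ℝ) + 1)) := by
    rw [abs_mul, abs_of_nonneg hm]
    calc m * |h - a * Real.cos A| ≤ m * (8 * a * (mesoScale α N * x) ^ 2 / (2 * (k N : ℝ) + 1)) := by
          gcongr
      _ = _ := by ring
  have h2 : |(m * a - 1) * Real.cos A| ≤ |m * a - 1| := by
    rw [abs_mul]; exact mul_le_of_le_one_right (abs_nonneg _) (Real.abs_cos_le_one _)
  have h3 : |Real.cos A - Real.cos B| ≤ |oscAction (2 * k N + 1) (mesoScale α N * x)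
      - oscAction (2 * N) (mesoScale α N * x) - r * (Real.pi / 2) * x| := by
    have h4 : |Real.cos A - Real.cos B| ≤ |A - B| := by
      rw [Real.cos_sub_cos, abs_mul, abs_mul, abs_neg, abs_two]
      have h5 := Real.abs_sin_le_one ((A + B) / 2)
      have h6 : |Real.sin ((A - B) / 2)| ≤ |(A - B) / 2| := Real.abs_sin_le_abs
      rw [abs_div, abs_two] at h6
      calc 2 * |Real.sin ((A + B) / 2)| * |Real.sin ((A - B) / 2)|
          ≤ 2 * 1 * (|A - B| / 2) := by gcongr
        _ = _ := by ring
    refine h4.trans (le_of_eq ?_)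
    congr 1
    simp only [hAdef, hB, mesoPhase]; ring
  calc _ ≤ |m * (h - a * Real.cos A)| + |(m * a - 1) * Real.cos A| + |Real.cos A - Real.cos B| :=
        abs_add_three _ _ _
    _ ≤ _ := by gcongr

end

/-! ## Oscillating integrals -/

theorem tendsto_one_add_exp {ι : Type*} {l : Filter ι} {u : ι → ℝ} (hu : Tendsto u l (𝓝 Real.pi)) :
    Tendsto (fun n => 1 + Complex.exp (u n * Complex.I)) l (𝓝 0) := by
  have h : Continuous fun x : ℝ => 1 + Complex.exp (x * Complex.I) := by fun_prop
  have := (h.tendsto Real.pi).comp hu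
  simpa [Function.comp_def] using this

theorem norm_exp_ofReal_mul_I' (x : ℝ) : ‖Complex.exp (x * Complex.I)‖ = 1 :=
  Complex.norm_exp_ofReal_mul_I x

/-- Riemann-Lebesgue by translation: a shift by δ N turns the phase by about π and flips the sign of
the exponential. The integral plus its translate, which is twice the integral, thus tends to 0 by
dominated convergence. No stationary-phase analysis of θ is needed. -/
theorem tendsto_integral_mul_exp_of_continuous {θ : ℝ → ℝ → ℝ} (hθ : ∀ N, Continuous (θ N))
    {δ : ℝ → ℝ} (hδ : Tendsto δ atTop (𝓝 0))
    (hshift : ∀ x, Tendsto (fun N => θ N (x + δ N) - θ N x) atTop (𝓝 Real.pi))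
    {g : ℝ → ℂ} (hg : Continuous g) (hgs : HasCompactSupport g) :
    Tendsto (fun N => ∫ x, g x * Complex.exp (θ N x * Complex.I)) atTop (𝓝 0) := by
  have hint : ∀ N, Integrable fun x => g x * Complex.exp (θ N x * Complex.I) := fun N => by
    have := hθ N
    exact Continuous.integrable_of_hasCompactSupport (by fun_prop) hgs.mul_right
  have hint2 : ∀ N, Integrable fun x => g (x + δ N) * Complex.exp (θ N (x + δ N) * Complex.I) :=
    fun N => (hint N).comp_add_right (δ N)
  obtain ⟨C, hC⟩ := hgs.exists_bound_of_continuous hg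
  obtain ⟨R, hR⟩ := hgs.isCompact.isBounded.subset_closedBall 0
  have hzero : ∀ x, R < |x| → g x = 0 := fun x hx => by
    by_contra h
    have := hR (subset_tsupport g h)
    rw [mem_closedBall_zero_iff, Real.norm_eq_abs] at this
    linarith
  have hC0 : 0 ≤ C := (norm_nonneg _).trans (hC 0)
  have hD : Tendsto (fun N => ∫ x, (g x * Complex.exp (θ N x * Complex.I)
      + g (x + δ N) * Complex.exp (θ N (x + δ N) * Complex.I))) atTop (𝓝 (∫ _ : ℝ, (0 : ℂ))) := by
    refine tendsto_integral_filter_of_dominated_convergence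
      (fun x => (Metric.closedBall (0 : ℝ) (R + 1)).indicator (fun _ => 2 * C) x)
      (Eventually.of_forall fun N => ((hint N).add (hint2 N)).aestronglyMeasurable) ?_ ?_ ?_
    · filter_upwards [hδ.eventually (Metric.ball_mem_nhds 0 one_pos)] with N hN
      refine Eventually.of_forall fun x => ?_
      rw [dist_zero_right, Real.norm_eq_abs] at hN
      by_cases hx : x ∈ Metric.closedBall (0 : ℝ) (R + 1)
      · rw [Set.indicator_of_mem hx]
        refine (norm_add_le _ _).trans ?_
        rw [norm_mul, norm_mul, norm_exp_ofReal_mul_I', norm_exp_ofReal_mul_I']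
        linarith [hC x, hC (x + δ N)]
      · rw [Set.indicator_of_notMem hx]
        rw [mem_closedBall_zero_iff, Real.norm_eq_abs, not_le] at hx
        have h1 : |x| ≤ |x + δ N| + |δ N| := by
          have := abs_sub (x + δ N) (δ N)
          simpa using this
        rw [hzero x (by linarith), hzero (x + δ N) (by linarith)]
        simp
    · exact (integrableOn_const
        measure_closedBall_lt_top.ne).integrable_indicator Metric.isClosed_closedBall.measurableSet
    · refine Eventually.of_forall fun x => ?_
      have h1 : Tendsto (fun N => g (x + δ N) - g x) atTop (𝓝 0) := by
        have h2 : Tendsto (fun N => g (x + δ N)) atTop (𝓝 (g (x + 0))) :=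
          (hg.tendsto _).comp (hδ.const_add x)
        rw [add_zero] at h2
        simpa using h2.sub_const (g x)
      have h2 := (tendsto_one_add_exp (hshift x)).norm.const_mul ‖g x‖
      have h3 := h2.add h1.norm
      simp only [norm_zero, mul_zero, add_zero] at h3
      refine squeeze_zero_norm (fun N => ?_) h3
      have e : g x * Complex.exp (θ N x * Complex.I)
          + g (x + δ N) * Complex.exp (θ N (x + δ N) * Complex.I)
          = g x * Complex.exp (θ N x * Complex.I) *
              (1 + Complex.exp ((θ N (x + δ N) - θ N x : ℝ) * Complex.I))
            + (g (x + δ N) - g x) * Complex.exp (θ N (x + δ N) * Complex.I) := by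
        have : Complex.exp (θ N (x + δ N) * Complex.I) = Complex.exp (θ N x * Complex.I)
            * Complex.exp ((θ N (x + δ N) - θ N x : ℝ) * Complex.I) := by
          rw [← Complex.exp_add]; congr 1; push_cast; ring
        rw [this]; ring
      rw [e]
      refine (norm_add_le _ _).trans ?_
      rw [norm_mul, norm_mul, norm_mul, norm_exp_ofReal_mul_I', norm_exp_ofReal_mul_I', mul_one,
        mul_one]
  have h2 : ∀ N, ∫ x, (g x * Complex.exp (θ N x * Complex.I)
      + g (x + δ N) * Complex.exp (θ N (x + δ N) * Complex.I))
      = 2 * ∫ x, g x * Complex.exp (θ N x * Complex.I) := fun N => by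
    rw [integral_add (hint N) (hint2 N),
      integral_add_right_eq_self (fun x => g x * Complex.exp (θ N x * Complex.I)) (δ N)]
    ring
  simp_rw [h2, integral_zero] at hD
  have h3 := hD.const_mul (1 / 2 : ℂ)
  rw [mul_zero] at h3
  exact h3.congr fun N => by ring

theorem tendsto_integral_mul_exp {θ : ℝ → ℝ → ℝ} (hθ : ∀ N, Continuous (θ N))
    {δ : ℝ → ℝ} (hδ : Tendsto δ atTop (𝓝 0))
    (hshift : ∀ x, Tendsto (fun N => θ N (x + δ N) - θ N x) atTop (𝓝 Real.pi))
    {g : ℝ → ℂ} (hg : Integrable g) :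
    Tendsto (fun N => ∫ x, g x * Complex.exp (θ N x * Complex.I)) atTop (𝓝 0) := by
  rw [Metric.tendsto_nhds]
  intro ε hε
  obtain ⟨φ, hφs, hφ, hφc, hφi⟩ := hg.exists_hasCompactSupport_integral_sub_le (half_pos hε)
  have h := tendsto_integral_mul_exp_of_continuous hθ hδ hshift hφc hφs
  filter_upwards [h.eventually (Metric.ball_mem_nhds 0 (half_pos hε))] with N hN
  rw [dist_zero_right] at hN ⊢
  have hE : AEStronglyMeasurable (fun x => Complex.exp (θ N x * Complex.I)) volume := by
    have := hθ N
    exact (by fun_prop : Continuous fun x => Complex.exp (θ N x * Complex.I)).aestronglyMeasurable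
  have hm : ∀ {f : ℝ → ℂ}, Integrable f →
      Integrable fun x => f x * Complex.exp (θ N x * Complex.I) := fun hf =>
    hf.mul_bdd hE (Eventually.of_forall fun x => (norm_exp_ofReal_mul_I' _).le)
  have e : ∫ x, g x * Complex.exp (θ N x * Complex.I)
      = (∫ x, (g x - φ x) * Complex.exp (θ N x * Complex.I))
        + ∫ x, φ x * Complex.exp (θ N x * Complex.I) := by
    have h3 := integral_add (hm (hg.sub hφi)) (hm hφi)
    simp only [Pi.sub_apply] at h3
    rw [← h3]
    congr 1; ext x; ring
  rw [e]
  refine (norm_add_le _ _).trans_lt ?_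
  have h1 : ‖∫ x, (g x - φ x) * Complex.exp (θ N x * Complex.I)‖ ≤ ε / 2 := by
    refine (norm_integral_le_integral_norm _).trans ?_
    simpa only [norm_mul, norm_exp_ofReal_mul_I', mul_one] using hφ
  linarith

/-- For fixed y the factor e^{-iθ(y)} has modulus one and comes out of the inner integral, which the
one-variable statement handles; dominated convergence in y concludes. -/
theorem tendsto_integral_prod_mul_exp {θ : ℝ → ℝ → ℝ} (hθ : ∀ N, Continuous (θ N))
    {δ : ℝ → ℝ} (hδ : Tendsto δ atTop (𝓝 0))
    (hshift : ∀ x, Tendsto (fun N => θ N (x + δ N) - θ N x) atTop (𝓝 Real.pi))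
    {H : ℝ × ℝ → ℂ} (hH : Integrable H) :
    Tendsto (fun N => ∫ z, H z * Complex.exp ((θ N z.1 - θ N z.2 : ℝ) * Complex.I))
      atTop (𝓝 0) := by
  have hint : ∀ N, Integrable fun z : ℝ × ℝ =>
      H z * Complex.exp ((θ N z.1 - θ N z.2 : ℝ) * Complex.I) := fun N => by
    have := hθ N
    refine hH.mul_bdd (by fun_prop : Continuous fun z : ℝ × ℝ =>
      Complex.exp ((θ N z.1 - θ N z.2 : ℝ) * Complex.I)).aestronglyMeasurable
      (Eventually.of_forall fun x => (norm_exp_ofReal_mul_I' _).le)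
  have hH' : Integrable H (volume.prod volume) := hH
  have hD : Tendsto (fun N => ∫ y, ∫ x, H (x, y) * Complex.exp ((θ N x - θ N y : ℝ) * Complex.I))
      atTop (𝓝 (∫ _ : ℝ, (0 : ℂ))) := by
    refine tendsto_integral_filter_of_dominated_convergence (fun y => ∫ x, ‖H (x, y)‖)
      (Eventually.of_forall fun N => (Integrable.integral_prod_right (hint N)).aestronglyMeasurable)
      (Eventually.of_forall fun N => Eventually.of_forall fun y => ?_)
      hH'.integral_norm_prod_right ?_
    · refine (norm_integral_le_integral_norm _).trans (le_of_eq ?_)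
      simp only [norm_mul, norm_exp_ofReal_mul_I', mul_one]
    · filter_upwards [hH'.prod_left_ae] with y hy
      have h := (tendsto_integral_mul_exp hθ hδ hshift hy).norm
      rw [norm_zero] at h
      refine squeeze_zero_norm (fun N => le_of_eq ?_) h
      have e : ∀ x, H (x, y) * Complex.exp ((θ N x - θ N y : ℝ) * Complex.I)
          = H (x, y) * Complex.exp (θ N x * Complex.I) * Complex.exp ((-θ N y : ℝ) * Complex.I) := by
        intro x
        rw [mul_assoc, ← Complex.exp_add]; congr 2; push_cast; ring
      simp_rw [e]
      rw [integral_mul_const, norm_mul, norm_exp_ofReal_mul_I', mul_one]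
  rw [integral_zero] at hD
  refine hD.congr fun N => ?_
  exact (integral_prod_symm _ (hint N)).symm

/-! ### The shift property for the Hermite phase -/

theorem continuous_mesoPhase (α N : ℝ) : Continuous (mesoPhase α N) :=
  continuous_iff_continuousAt.2 fun x =>
    (hasDerivAt_oscAction_scaled (2 * N) (mesoScale α N) x).continuousAt

theorem mesoScale_mul_sqrt (α : ℝ) {N : ℝ} (hN : 0 < N) :
    mesoScale α N * √(2 * N) = Real.pi * N ^ (1 - α) := by
  rw [mesoScale, microScale, Real.sqrt_mul (by norm_num), Real.rpow_sub hN, Real.rpow_one,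
    Real.rpow_neg hN.le]
  have h := Real.mul_self_sqrt hN.le
  have := Real.rpow_pos_of_pos hN α
  field_simp
  linear_combination h

/-- The phase has velocity l√(2N-(lx)²), equivalent to πN^(1-α) at fixed x, so the doubled phase
gains π over the length N^(α-1)/2. The mean value theorem makes the gain exactly π times a factor at
most 1 and tending to 1. -/
theorem tendsto_mesoPhase_shift {α : ℝ} (hα0 : 0 < α) (hα1 : α < 1) (x : ℝ) :
    Tendsto (fun N => 2 * mesoPhase α N (x + N ^ (-(1 - α)) / 2) - 2 * mesoPhase α N x) atTop
      (𝓝 Real.pi) := by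
  have hδ : Tendsto (fun N : ℝ => N ^ (-(1 - α)) / 2) atTop (𝓝 (0 / 2)) :=
    (tendsto_rpow_neg_atTop (by linarith)).div_const 2
  rw [zero_div] at hδ
  have hlow : Tendsto (fun N => Real.pi * √(1 - (mesoScale α N * (|x| + 1)) ^ 2 / N / 2)) atTop
      (𝓝 (Real.pi * √(1 - 0 / 2))) :=
    ((((tendsto_mesoScale_sq_div hα0 _).div_const 2).const_sub 1).sqrt).const_mul _
  simp only [zero_div, sub_zero, Real.sqrt_one, mul_one] at hlow
  have key : ∀ᶠ N in atTop, Real.pi * √(1 - (mesoScale α N * (|x| + 1)) ^ 2 / N / 2)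
      ≤ 2 * mesoPhase α N (x + N ^ (-(1 - α)) / 2) - 2 * mesoPhase α N x ∧
      2 * mesoPhase α N (x + N ^ (-(1 - α)) / 2) - 2 * mesoPhase α N x ≤ Real.pi := by
    filter_upwards [eventually_gt_atTop 0, hδ.eventually (ge_mem_nhds one_pos)] with N hN hN1
    set d := N ^ (-(1 - α)) / 2 with hd
    have hpos : 0 < N ^ (-(1 - α)) := Real.rpow_pos_of_pos hN _
    have hd0 : 0 < d := by positivity
    obtain ⟨ξ, hξ, he⟩ := exists_hasDerivAt_eq_slope (mesoPhase α N)
      (fun v => mesoScale α N * √(2 * N - (mesoScale α N * v) ^ 2)) (lt_add_of_pos_right x hd0)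
      (continuous_mesoPhase α N).continuousOn
      (fun v _ => hasDerivAt_oscAction_scaled (2 * N) (mesoScale α N) v)
    simp only [add_sub_cancel_left] at he
    rw [eq_div_iff hd0.ne'] at he
    have e1 : √(2 * N - (mesoScale α N * ξ) ^ 2)
        = √(2 * N) * √(1 - (mesoScale α N * ξ) ^ 2 / N / 2) := by
      rw [← Real.sqrt_mul (by positivity)]
      congr 1; field_simp
    have e2 : 2 * mesoPhase α N (x + d) - 2 * mesoPhase α N x
        = Real.pi * √(1 - (mesoScale α N * ξ) ^ 2 / N / 2) := by
      rw [← mul_sub, ← he, e1, ← mul_assoc (mesoScale α N), mesoScale_mul_sqrt α hN, hd,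
        Real.rpow_neg hN.le]
      have := Real.rpow_pos_of_pos hN (1 - α)
      field_simp
    rw [e2]
    have hξ2 : ξ ^ 2 ≤ (|x| + 1) ^ 2 := by
      apply sq_le_sq'
      · linarith [hξ.1, neg_abs_le x]
      · linarith [hξ.2, le_abs_self x]
    have hm := mesoScale_pos α hN
    constructor
    · have : (mesoScale α N * ξ) ^ 2 ≤ (mesoScale α N * (|x| + 1)) ^ 2 := by
        rw [mul_pow, mul_pow]; gcongr
      have := Real.pi_pos
      gcongr
    · refine mul_le_of_le_one_right Real.pi_pos.le (Real.sqrt_le_one.2 ?_)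
      have : 0 ≤ (mesoScale α N * ξ) ^ 2 / N / 2 := by positivity
      linarith
  exact tendsto_of_tendsto_of_tendsto_of_le_of_le' hlow tendsto_const_nhds
    (key.mono fun _ h => h.1) (key.mono fun _ h => h.2)

theorem tendsto_integral_mul_exp_mesoPhase {α : ℝ} (hα0 : 0 < α) (hα1 : α < 1)
    {g : ℝ → ℂ} (hg : Integrable g) :
    Tendsto (fun N => ∫ x, g x * Complex.exp ((2 * mesoPhase α N x : ℝ) * Complex.I))
      atTop (𝓝 0) := by
  have hδ : Tendsto (fun N : ℝ => N ^ (-(1 - α)) / 2) atTop (𝓝 (0 / 2)) :=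
    (tendsto_rpow_neg_atTop (by linarith)).div_const 2
  rw [zero_div] at hδ
  exact tendsto_integral_mul_exp (fun N => (continuous_mesoPhase α N).const_mul 2) hδ
    (tendsto_mesoPhase_shift hα0 hα1) hg

theorem tendsto_integral_prod_mul_exp_mesoPhase {α : ℝ} (hα0 : 0 < α) (hα1 : α < 1)
    {H : ℝ × ℝ → ℂ} (hH : Integrable H) :
    Tendsto (fun N => ∫ z, H z *
      Complex.exp ((2 * mesoPhase α N z.1 - 2 * mesoPhase α N z.2 : ℝ) * Complex.I))
      atTop (𝓝 0) := by
  have hδ : Tendsto (fun N : ℝ => N ^ (-(1 - α)) / 2) atTop (𝓝 (0 / 2)) :=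
    (tendsto_rpow_neg_atTop (by linarith)).div_const 2
  rw [zero_div] at hδ
  exact tendsto_integral_prod_mul_exp (fun N => (continuous_mesoPhase α N).const_mul 2) hδ
    (tendsto_mesoPhase_shift hα0 hα1) hH

/-! ## Sums over the spectrum as integrals -/

theorem iUnion_Ico_cells (N : ℝ) {T : ℝ} (hT : 0 < T) :
    ⋃ k : ℕ, Set.Ico (((k : ℝ) - N) / T) ((k + 1 - N) / T) = Set.Ici (-N / T) := by
  ext t
  simp only [Set.mem_iUnion, Set.mem_Ico, Set.mem_Ici, div_le_iff₀ hT, lt_div_iff₀ hT]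
  constructor
  · rintro ⟨k, hk, -⟩
    have : (0 : ℝ) ≤ k := Nat.cast_nonneg k
    linarith
  · intro h
    have h0 : 0 ≤ N + T * t := by linarith
    exact ⟨⌊N + T * t⌋₊, by linarith [Nat.floor_le h0], by linarith [Nat.lt_floor_add_one (N + T * t)]⟩

theorem floor_eq_of_mem_cell {N T : ℝ} (hT : 0 < T) {k : ℕ} {t : ℝ}
    (ht : t ∈ Set.Ico (((k : ℝ) - N) / T) ((k + 1 - N) / T)) : ⌊N + T * t⌋₊ = k := by
  rw [Set.mem_Ico, div_le_iff₀ hT, lt_div_iff₀ hT] at ht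
  rw [Nat.floor_eq_iff (by have : (0 : ℝ) ≤ k := Nat.cast_nonneg k; linarith [ht.1])]
  constructor <;> linarith [ht.1, ht.2]

/-- The index k corresponds to the cell of t on which ⌊N+Tt⌋ = k. Sums over the spectrum thereby
become integrals over t exactly, without Riemann-sum error, and dominated convergence can be applied
to them. -/
theorem hasSum_integral_cells {N T : ℝ} (hT : 0 < T) {F : ℝ → ℕ → ℝ}
    (hF : IntegrableOn (fun t => F t ⌊N + T * t⌋₊) (Set.Ici (-N / T))) :
    HasSum (fun k : ℕ => ∫ t in Set.Ico (((k : ℝ) - N) / T) ((k + 1 - N) / T), F t k)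
      (∫ t in Set.Ici (-N / T), F t ⌊N + T * t⌋₊) := by
  rw [← iUnion_Ico_cells N hT] at hF ⊢
  have hd : Pairwise (Function.onFun Disjoint
      fun k : ℕ => Set.Ico (((k : ℝ) - N) / T) ((k + 1 - N) / T)) := by
    intro j k hjk
    refine Set.disjoint_left.2 fun t h1 h2 => hjk ?_
    rw [← floor_eq_of_mem_cell hT h1, ← floor_eq_of_mem_cell hT h2]
  have h := hasSum_integral_iUnion (fun k => measurableSet_Ico) hd hF
  refine h.congr_fun ?_ |> fun h => h
  intro k
  refine setIntegral_congr_fun measurableSet_Ico fun t ht => ?_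
  simp only [floor_eq_of_mem_cell hT ht]

theorem integral_density_cell {Ψ : ℝ → ℝ} (hΨ : IsExpShape Ψ) (N : ℝ) {T : ℝ} (hT : 0 < T) (k : ℕ)
    (c : ℝ) :
    ∫ t in Set.Ico (((k : ℝ) - N) / T) ((k + 1 - N) / T), shapeDensity Ψ t * c
      = (Ψ (((k : ℝ) - N) / T) - Ψ (((k + 1 : ℕ) - N) / T)) * c := by
  have hle : ((k : ℝ) - N) / T ≤ (k + 1 - N) / T := by gcongr; linarith
  rw [integral_Ico_eq_integral_Ioc, ← intervalIntegral.integral_of_le hle,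
    intervalIntegral.integral_mul_const, hΨ.sub_eq_integral]
  push_cast
  rfl

theorem integral_const_cell (N : ℝ) {T : ℝ} (hT : 0 < T) (k : ℕ) (c : ℝ) :
    ∫ _ in Set.Ico (((k : ℝ) - N) / T) ((k + 1 - N) / T), c = T⁻¹ * c := by
  have hle : ((k : ℝ) - N) / T ≤ (k + 1 - N) / T := by gcongr; linarith
  rw [integral_Ico_eq_integral_Ioc, ← intervalIntegral.integral_of_le hle,
    intervalIntegral.integral_const, smul_eq_mul]
  congr 1; field_simp; ring

/-! ## Uniform bounds at the mesoscopic scale -/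

/-- The `k`-th Hermite function in mesoscopic coordinates. -/
noncomputable def mesoFun (α N : ℝ) (k : ℕ) (x : ℝ) : ℝ :=
  √(microScale N) * hermiteFun k (mesoScale α N * x)

theorem continuous_mesoFun (α N : ℝ) (k : ℕ) : Continuous (mesoFun α N k) :=
  continuous_const.mul ((continuous_hermiteFun k).comp (continuous_const.mul continuous_id))

theorem mesoScale_mul_rpow (α : ℝ) {N : ℝ} (hN : 0 < N) :
    mesoScale α N * N ^ α = microScale N := by
  rw [mesoScale, mul_assoc, ← Real.rpow_add hN]; simp

theorem mesoFun_mul (α : ℝ) {N : ℝ} (hN : 0 < N) (j k : ℕ) (x y : ℝ) :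
    mesoFun α N j x * mesoFun α N k y
      = N ^ α * (oscFun (mesoScale α N) j x * oscFun (mesoScale α N) k y) := by
  have h1 := Real.mul_self_sqrt (microScale_pos hN).le
  have h2 := Real.mul_self_sqrt (mesoScale_pos α hN).le
  have h3 := mesoScale_mul_rpow α hN
  simp only [mesoFun, oscFun]
  linear_combination hermiteFun j (mesoScale α N * x) * hermiteFun k (mesoScale α N * y) *
    (h1 - N ^ α * h2 - h3)

theorem oscFun_mul_eq (α : ℝ) {N : ℝ} (hN : 0 < N) (j k : ℕ) (x y : ℝ) :
    oscFun (mesoScale α N) j x * oscFun (mesoScale α N) k y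
      = N ^ (-α) * (mesoFun α N j x * mesoFun α N k y) := by
  rw [mesoFun_mul α hN, ← mul_assoc, ← Real.rpow_add hN]; simp

theorem oscCoeff_mesoScale (α : ℝ) {N : ℝ} (hN : 0 < N) (k : ℕ) :
    oscCoeff (mesoScale α N) k = N ^ α * (√((k + 1) / N) / Real.pi) := by
  have := Real.rpow_pos_of_pos hN α
  have hs := Real.sqrt_pos.2 hN
  have hk : 0 < √((k : ℝ) + 1) := by positivity
  have h2 : √2 * √2 = (2 : ℝ) := Real.mul_self_sqrt (by norm_num)
  rw [oscCoeff, mesoScale, microScale, Real.rpow_neg hN.le, Real.sqrt_mul (by norm_num),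
    Real.sqrt_div' _ hN.le]
  field_simp
  linear_combination h2

theorem oscWronskian_mesoScale (α : ℝ) {N : ℝ} (hN : 0 < N) (k : ℕ) (x y : ℝ) :
    oscWronskian (mesoScale α N) k x y = √((k + 1) / N) / Real.pi *
      (mesoFun α N (k + 1) x * mesoFun α N k y - mesoFun α N k x * mesoFun α N (k + 1) y) := by
  rw [oscWronskian, oscCoeff_mesoScale α hN, mesoFun_mul α hN, mesoFun_mul α hN]
  ring

/-- If 2k+1 ≥ N, the point lies well inside the oscillatory region and Sonin's bound applies.
Otherwise |t| is at least of order N^(1-α), and a power of |t| pays for the crude global bound. The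
-1 allows k to be the integer part of N + τN^α t. -/
theorem exists_mesoFun_sq_le {α τ : ℝ} (hα0 : 0 < α) (hα1 : α < 1) (hτ : 0 < τ) (R : ℝ) :
    ∃ (A : ℝ) (n : ℕ), 0 ≤ A ∧ ∀ᶠ N in atTop, ∀ (k : ℕ) (t : ℝ), N + τ * N ^ α * t - 1 ≤ k →
      ∀ x, |x| ≤ R → mesoFun α N k x ^ 2 ≤ A * (1 + |t|) ^ n := by
  obtain ⟨C, hC, hamp⟩ := exists_hermiteAmp_le
  -- With n(1-α) ≥ 2, the inequality N^(1-α) ≤ 4τ|t| of the second case gives N² ≤ (4τ|t|)^n, and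
  -- the crude bound costs 8N².
  obtain ⟨n, hn⟩ := exists_nat_ge (2 / (1 - α))
  rw [div_le_iff₀ (by linarith)] at hn
  refine ⟨8 * C + 8 * (4 * τ) ^ n, n, by positivity, ?_⟩
  filter_upwards [eventually_ge_atTop 4, (tendsto_mesoScale_sq_div hα0 R).eventually
    (ge_mem_nhds (by norm_num : (0 : ℝ) < 1 / 2))] with N hN4 hNR k t hk x hx
  have hN : 0 < N := by linarith
  have hs := microScale_pos hN
  have h1t : 1 ≤ 1 + |t| := by linarith [abs_nonneg t]
  have hpow : 1 ≤ (1 + |t|) ^ n := one_le_pow₀ h1t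
  have hsN : microScale N ≤ 4 * √N := by
    have h2 : 1 ≤ √(2 : ℝ) := Real.one_le_sqrt.2 (by norm_num)
    rw [microScale, div_le_iff₀ (by positivity)]
    have := Real.sqrt_nonneg N
    nlinarith [Real.pi_le_four, mul_nonneg this (sub_nonneg.2 h2),
      mul_nonneg this (sub_nonneg.2 Real.pi_le_four)]
  have hsq : mesoFun α N k x ^ 2 = microScale N * hermiteFun k (mesoScale α N * x) ^ 2 := by
    rw [mesoFun, mul_pow, Real.sq_sqrt hs.le]
  rw [hsq]
  rcases le_or_gt N (2 * k + 1) with hcase | hcase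
  · rw [div_le_iff₀ hN] at hNR
    have hlx : (mesoScale α N * x) ^ 2 ≤ (2 * k + 1) / 2 := by
      have : (mesoScale α N * x) ^ 2 ≤ (mesoScale α N * R) ^ 2 := by
        rw [mul_pow, mul_pow]
        have : x ^ 2 ≤ R ^ 2 := sq_le_sq' (by linarith [neg_abs_le x]) (by linarith [le_abs_self x])
        gcongr
      linarith
    have h1 := hermiteFun_sq_le_amp hlx
    have h2 : √N * hermiteAmp k ^ 2 ≤ C := by
      refine le_trans ?_ (hamp k)
      gcongr
    calc microScale N * hermiteFun k (mesoScale α N * x) ^ 2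
        ≤ 4 * √N * (2 * hermiteAmp k ^ 2) := by gcongr
      _ = 8 * (√N * hermiteAmp k ^ 2) := by ring
      _ ≤ 8 * C := by gcongr
      _ ≤ (8 * C + 8 * (4 * τ) ^ n) * 1 := by
          have : 0 ≤ 8 * (4 * τ) ^ n := by positivity
          linarith
      _ ≤ _ := by gcongr
  · have h1 := hermiteFun_sq_le k (mesoScale α N * x)
    have hNα := Real.rpow_pos_of_pos hN α
    have hsN2 : √N ≤ N := Real.sqrt_le_iff.2 ⟨hN.le, by nlinarith⟩
    -- From N + τN^α t - 1 ≤ k < (N-1)/2 one gets τN^α|t| > (N-1)/2 ≥ N/4.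
    have ht : N ^ (1 - α) ≤ 4 * τ * |t| := by
      rw [Real.rpow_sub hN, Real.rpow_one, div_le_iff₀ hNα]
      have : τ * N ^ α * -t ≤ τ * N ^ α * |t| := by gcongr; exact neg_le_abs t
      nlinarith
    have hN2 : N ^ 2 ≤ (4 * τ) ^ n * (1 + |t|) ^ n := by
      calc N ^ 2 = N ^ (2 : ℝ) := by norm_cast
        _ ≤ N ^ ((1 - α) * n) := Real.rpow_le_rpow_of_exponent_le (by linarith) (by linarith)
        _ = (N ^ (1 - α)) ^ n := by rw [Real.rpow_mul hN.le, Real.rpow_natCast]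
        _ ≤ (4 * τ * |t|) ^ n := by gcongr
        _ ≤ (4 * τ * (1 + |t|)) ^ n := by gcongr; linarith
        _ = _ := by rw [mul_pow]
    calc microScale N * hermiteFun k (mesoScale α N * x) ^ 2
        ≤ 4 * N * (2 * N) := by
          refine mul_le_mul (by linarith) (by linarith) (sq_nonneg _) (by positivity)
      _ = 8 * N ^ 2 := by ring
      _ ≤ 8 * ((4 * τ) ^ n * (1 + |t|) ^ n) := by gcongr
      _ ≤ _ := by
          have : 0 ≤ 8 * C * (1 + |t|) ^ n := by positivity
          linarith

/-! ## Weights given by a shape -/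

theorem measurable_comp_floor (N T : ℝ) (g : ℕ → ℝ) : Measurable fun t : ℝ => g ⌊N + T * t⌋₊ :=
  (measurable_from_nat (f := g)).comp
    (Nat.measurable_floor.comp ((measurable_const.mul measurable_id).const_add N))

theorem floor_bounds {N T : ℝ} (hT : 0 < T) {t : ℝ} (ht : -N / T ≤ t) :
    (⌊N + T * t⌋₊ : ℝ) ≤ N + T * t ∧ N + T * t < ⌊N + T * t⌋₊ + 1 := by
  rw [div_le_iff₀ hT] at ht
  exact ⟨Nat.floor_le (by linarith), Nat.lt_floor_add_one _⟩

/-- The mass of the density on a cell is the difference of two consecutive weights, which is exactly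
the coefficient left by summation by parts. Polynomial growth of g in t is harmless because the
density has all moments. -/
theorem hasSum_density_cells {Ψ : ℝ → ℝ} (hΨ : IsExpShape Ψ) {N T : ℝ} (hT : 0 < T) {g : ℕ → ℝ}
    {A : ℝ} {n : ℕ} (hg : ∀ t, -N / T ≤ t → |g ⌊N + T * t⌋₊| ≤ A * (1 + |t|) ^ n) :
    HasSum (fun k : ℕ => (Ψ (((k : ℝ) - N) / T) - Ψ (((k + 1 : ℕ) - N) / T)) * g k)
      (∫ t in Set.Ici (-N / T), shapeDensity Ψ t * g ⌊N + T * t⌋₊) ∧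
    |∫ t in Set.Ici (-N / T), shapeDensity Ψ t * g ⌊N + T * t⌋₊|
      ≤ A * ∫ t, (1 + |t|) ^ n * shapeDensity Ψ t := by
  have hint := (hΨ.integrable_pow_mul_density n).const_mul A
  have hb : ∀ t ∈ Set.Ici (-N / T), ‖shapeDensity Ψ t * g ⌊N + T * t⌋₊‖
      ≤ A * ((1 + |t|) ^ n * shapeDensity Ψ t) := fun t ht => by
    rw [norm_mul, Real.norm_of_nonneg (hΨ.density_nonneg t), Real.norm_eq_abs]
    calc shapeDensity Ψ t * |g ⌊N + T * t⌋₊| ≤ shapeDensity Ψ t * (A * (1 + |t|) ^ n) :=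
          mul_le_mul_of_nonneg_left (hg t ht) (hΨ.density_nonneg t)
      _ = _ := by ring
  have hi : IntegrableOn (fun t => shapeDensity Ψ t * g ⌊N + T * t⌋₊) (Set.Ici (-N / T)) :=
    Integrable.mono' hint.integrableOn ((measurable_shapeDensity Ψ).mul
      (measurable_comp_floor N T g)).aestronglyMeasurable
      ((ae_restrict_iff' measurableSet_Ici).2 (Eventually.of_forall hb))
  refine ⟨?_, ?_⟩
  · have h := hasSum_integral_cells hT (F := fun t k => shapeDensity Ψ t * g k) hi
    simp_rw [integral_density_cell hΨ N hT] at h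
    exact h
  · have hA : 0 ≤ A * (1 + |max (-N / T) 0|) ^ n :=
      (abs_nonneg _).trans (hg (max (-N / T) 0) (le_max_left _ _))
    have hA0 : 0 ≤ A := by
      have h : (0 : ℝ) < (1 + |max (-N / T) 0|) ^ n := by positivity
      exact nonneg_of_mul_nonneg_left hA h
    rw [← integral_const_mul, ← Real.norm_eq_abs]
    refine (norm_integral_le_integral_norm _).trans ?_
    refine (setIntegral_mono_on hi.norm hint.integrableOn measurableSet_Ici hb).trans ?_
    refine setIntegral_le_integral hint (Eventually.of_forall fun t => ?_)
    have := hΨ.density_nonneg t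
    positivity

theorem hasSum_const_cells {N T : ℝ} (hT : 0 < T) {w : ℝ → ℝ} {g : ℕ → ℝ} {b : ℝ → ℝ}
    (hb : Integrable b) (hg : ∀ t, -N / T ≤ t →
      |w ((⌊N + T * t⌋₊ - N) / T) * g ⌊N + T * t⌋₊| ≤ b t) :
    HasSum (fun k : ℕ => w ((k - N) / T) * g k)
      (T * ∫ t in Set.Ici (-N / T), w ((⌊N + T * t⌋₊ - N) / T) * g ⌊N + T * t⌋₊) := by
  have hi : IntegrableOn (fun t => w ((⌊N + T * t⌋₊ - N) / T) * g ⌊N + T * t⌋₊)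
      (Set.Ici (-N / T)) :=
    Integrable.mono' hb.integrableOn
      (measurable_comp_floor N T (fun k => w ((k - N) / T) * g k)).aestronglyMeasurable
      ((ae_restrict_iff' measurableSet_Ici).2 (Eventually.of_forall hg))
  have h := (hasSum_integral_cells hT (F := fun _ k => w ((k - N) / T) * g k) hi).mul_left T
  simp_rw [integral_const_cell N hT, mul_inv_cancel_left₀ hT.ne'] at h
  exact h

/-- The occupation probabilities of the modified GUE. -/
noncomputable def shapeWeight (Ψ : ℝ → ℝ) (α τ N : ℝ) (k : ℕ) : ℝ :=
  Ψ (((k : ℝ) - N) / (τ * N ^ α))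

theorem isRapid_of_le_exp {p : ℕ → ℝ} {C r : ℝ} (hr : 0 < r)
    (h : ∀ k, |p k| ≤ C * Real.exp (-r * k)) : IsRapid p := fun m => by
  have h1 := ((summable_nat_add_iff 1).2
    (Real.summable_pow_mul_exp_neg_nat_mul m hr)).mul_left (C * Real.exp r)
  refine Summable.of_nonneg_of_le (fun k => by positivity) (fun k => ?_) h1
  calc |p k| * ((k : ℝ) + 1) ^ m ≤ C * Real.exp (-r * k) * ((k : ℝ) + 1) ^ m := by
        gcongr; exact h k
    _ = _ := by
        have : Real.exp (-r * k) = Real.exp r * Real.exp (-r * (k + 1 : ℕ)) := by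
          rw [← Real.exp_add]; congr 1; push_cast; ring
        rw [this]; push_cast; ring

theorem isRapid_shapeWeight {Ψ : ℝ → ℝ} (hΨ : IsExpShape Ψ) (α : ℝ) {τ N : ℝ} (hτ : 0 < τ)
    (hN : 0 < N) : IsRapid (shapeWeight Ψ α τ N) := by
  obtain ⟨c, C, hc, hC, -, h1, -⟩ := hΨ.exists_tail
  have hT : 0 < τ * N ^ α := mul_pos hτ (Real.rpow_pos_of_pos hN α)
  refine isRapid_of_le_exp (r := c / (τ * N ^ α)) (C := C * Real.exp (c * N / (τ * N ^ α)))
    (by positivity) fun k => ?_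
  rw [shapeWeight, abs_of_nonneg (hΨ.mem_Icc _).1]
  refine (h1 _).trans (le_of_eq ?_)
  rw [mul_assoc, ← Real.exp_add]
  congr 2
  field_simp
  ring

theorem shapeWeight_mem {Ψ : ℝ → ℝ} (hΨ : IsExpShape Ψ) (α τ N : ℝ) (k : ℕ) :
    0 ≤ shapeWeight Ψ α τ N k ∧ shapeWeight Ψ α τ N k ≤ 1 := hΨ.mem_Icc _

/-! ## Limits of the kernel -/

theorem eventually_neg_div_le {α τ : ℝ} (hα1 : α < 1) (hτ : 0 < τ) (t : ℝ) :
    ∀ᶠ N in atTop, -N / (τ * N ^ α) ≤ t := by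
  have h : Tendsto (fun N : ℝ => N ^ (1 - α)) atTop atTop := tendsto_rpow_atTop (by linarith)
  filter_upwards [eventually_gt_atTop 0, h.eventually_ge_atTop (τ * |t|)] with N hN h1
  have hp := Real.rpow_pos_of_pos hN α
  rw [div_le_iff₀ (by positivity)]
  rw [Real.rpow_sub hN, Real.rpow_one, le_div_iff₀ hp] at h1
  have : τ * N ^ α * -t ≤ τ * N ^ α * |t| := by gcongr; exact neg_le_abs t
  linarith

theorem tendsto_floor_window {α τ : ℝ} (hα0 : 0 < α) (hα1 : α < 1) (hτ : 0 < τ) (t : ℝ) (j : ℕ) :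
    Tendsto (fun N => (((⌊N + τ * N ^ α * t⌋₊ + j : ℕ) : ℝ) - N) / N ^ α) atTop (𝓝 (τ * t)) := by
  have h0 : Tendsto (fun N : ℝ => (1 + j) * N ^ (-α)) atTop (𝓝 ((1 + j) * 0)) :=
    (tendsto_rpow_neg_atTop hα0).const_mul _
  rw [mul_zero] at h0
  rw [tendsto_iff_norm_sub_tendsto_zero]
  refine squeeze_zero' (Eventually.of_forall fun _ => norm_nonneg _) ?_ h0
  filter_upwards [eventually_gt_atTop 0, eventually_neg_div_le hα1 hτ t] with N hN ht
  have hp := Real.rpow_pos_of_pos hN α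
  obtain ⟨h1, h2⟩ := floor_bounds (by positivity) ht
  rw [Real.rpow_neg hN.le, ← div_eq_mul_inv, le_div_iff₀ hp, Real.norm_eq_abs,
    ← abs_of_pos hp, ← abs_mul, abs_of_pos hp, sub_mul, div_mul_cancel₀ _ hp.ne']
  push_cast
  have : (0 : ℝ) ≤ j := Nat.cast_nonneg j
  rw [abs_le]
  constructor <;> nlinarith

theorem tendsto_mul_sub_mul {ι : Type*} {l : Filter ι} {u v a b : ι → ℝ}
    (hu : Tendsto (fun n => u n - a n) l (𝓝 0)) (hv : Tendsto (fun n => v n - b n) l (𝓝 0))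
    (ha : ∀ n, |a n| ≤ 1) (hb : ∀ n, |b n| ≤ 1) :
    Tendsto (fun n => u n * v n - a n * b n) l (𝓝 0) := by
  have h := ((hu.abs.mul hv.abs).add hu.abs).add hv.abs
  simp only [abs_zero, mul_zero, add_zero] at h
  refine squeeze_zero_norm (fun n => ?_) h
  rw [show u n * v n - a n * b n = (u n - a n) * (v n - b n) + (u n - a n) * b n
    + a n * (v n - b n) by ring, Real.norm_eq_abs]
  refine (abs_add_three _ _ _).trans ?_
  rw [abs_mul, abs_mul, abs_mul]
  gcongr
  · exact mul_le_of_le_one_right (abs_nonneg _) (hb n)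
  · exact mul_le_of_le_one_left (abs_nonneg _) (ha n)

theorem tendsto_mesoFun_floor {α τ : ℝ} (hα0 : 0 < α) (hα1 : α < 1) (hτ : 0 < τ) (t : ℝ) (j : ℕ)
    (x : ℝ) :
    Tendsto (fun N => mesoFun α N (⌊N + τ * N ^ α * t⌋₊ + j) x
      - Real.cos (mesoPhase α N x + τ * t * (Real.pi / 2) * x
        - ((⌊N + τ * N ^ α * t⌋₊ + j : ℕ) : ℝ) * (Real.pi / 2))) atTop (𝓝 0) :=
  tendsto_hermiteFun_sub_cos (k := fun N => ⌊N + τ * N ^ α * t⌋₊ + j) hα0 hα1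
    (tendsto_floor_window hα0 hα1 hτ t j) x

/-- Raising the index by one retards the phase by π/2 and turns the cosine into a sine. The
antisymmetric combination is then the addition formula for a sine, and the Jacobi prefactor
√((k+1)/N) tends to 1. -/
theorem tendsto_oscWronskian {α τ : ℝ} (hα0 : 0 < α) (hα1 : α < 1) (hτ : 0 < τ) (t x y : ℝ) :
    Tendsto (fun N => oscWronskian (mesoScale α N) ⌊N + τ * N ^ α * t⌋₊ x y
      - 1 / Real.pi * Real.sin (mesoPhase α N x - mesoPhase α N y + τ * t * (Real.pi / 2) * (x - y)))
      atTop (𝓝 0) := by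
  set k : ℝ → ℕ := fun N => ⌊N + τ * N ^ α * t⌋₊ with hk
  set A : ℝ → ℝ → ℝ := fun z N => mesoPhase α N z + τ * t * (Real.pi / 2) * z
    - (k N : ℝ) * (Real.pi / 2) with hA
  have h0 : ∀ z, Tendsto (fun N => mesoFun α N (k N) z - Real.cos (A z N)) atTop (𝓝 0) :=
    fun z => tendsto_mesoFun_floor hα0 hα1 hτ t 0 z
  have h1 : ∀ z, Tendsto (fun N => mesoFun α N (k N + 1) z - Real.sin (A z N)) atTop (𝓝 0) := by
    intro z
    refine (tendsto_mesoFun_floor hα0 hα1 hτ t 1 z).congr fun N => ?_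
    rw [← Real.cos_sub_pi_div_two]
    simp only [hA, hk]
    congr 2
    push_cast; ring
  have hc : Tendsto (fun N => √(((k N : ℝ) + 1) / N) - 1) atTop (𝓝 0) := by
    have h2 := tendsto_div_of_window hα1 (tendsto_floor_window hα0 hα1 hτ t 0)
    have h3 : Tendsto (fun N : ℝ => N⁻¹) atTop (𝓝 0) := tendsto_inv_atTop_zero
    simp only [add_zero] at h2
    have h4 := (((h2.add h3).div_const 2).sqrt).sub_const 1
    rw [show √((2 + 0) / 2) - 1 = (0 : ℝ) by norm_num] at h4
    refine h4.congr fun N => ?_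
    congr 2
    simp only [hk]; ring
  have hw := ((tendsto_mul_sub_mul (h1 x) (h0 y) (fun N => Real.abs_sin_le_one _)
    (fun N => Real.abs_cos_le_one _)).sub (tendsto_mul_sub_mul (h0 x) (h1 y)
    (fun N => Real.abs_cos_le_one _) (fun N => Real.abs_sin_le_one _)))
  rw [sub_zero] at hw
  have hw' : Tendsto (fun N => (mesoFun α N (k N + 1) x * mesoFun α N (k N) y
      - mesoFun α N (k N) x * mesoFun α N (k N + 1) y) - Real.sin (A x N - A y N)) atTop (𝓝 0) := by
    refine hw.congr fun N => ?_
    rw [Real.sin_sub (A x N) (A y N)]; ring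
  have hfin := (tendsto_mul_sub_mul hc hw' (fun N => by simp)
    (fun N => Real.abs_sin_le_one _)).const_mul (1 / Real.pi)
  rw [mul_zero] at hfin
  refine hfin.congr' ?_
  filter_upwards [eventually_gt_atTop 0] with N hN
  rw [oscWronskian_mesoScale α hN]
  have e : A x N - A y N = mesoPhase α N x - mesoPhase α N y + τ * t * (Real.pi / 2) * (x - y) := by
    simp only [hA]; ring
  rw [e]
  ring

theorem sqrt_floor_div_le {α τ N t : ℝ} (hα1 : α < 1) (hτ : 0 < τ) (hN : 1 ≤ N)
    (ht : -N / (τ * N ^ α) ≤ t) :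
    ((⌊N + τ * N ^ α * t⌋₊ : ℝ) + 1) / N ≤ (2 + τ) * (1 + |t|) := by
  have hN0 : 0 < N := by linarith
  have hp := Real.rpow_pos_of_pos hN0 α
  obtain ⟨h1, h2⟩ := floor_bounds (by positivity) ht
  rw [div_le_iff₀ hN0]
  have h3 : N ^ α ≤ N := by
    calc N ^ α ≤ N ^ (1 : ℝ) := Real.rpow_le_rpow_of_exponent_le hN hα1.le
      _ = N := Real.rpow_one N
  have h4 : τ * N ^ α * t ≤ τ * N * |t| := by
    calc τ * N ^ α * t ≤ τ * N ^ α * |t| := by gcongr; exact le_abs_self t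
      _ ≤ _ := by gcongr
  have h5 : 0 ≤ τ * N := by positivity
  have h6 : 0 ≤ N * |t| := by positivity
  nlinarith

theorem mesoFun_sq_floor_le {α τ : ℝ} (hα0 : 0 < α) (hα1 : α < 1) (hτ : 0 < τ) (R : ℝ) :
    ∃ (A : ℝ) (n : ℕ), 0 ≤ A ∧ ∀ᶠ N in atTop, ∀ t, -N / (τ * N ^ α) ≤ t → ∀ x, |x| ≤ R →
      mesoFun α N ⌊N + τ * N ^ α * t⌋₊ x ^ 2 ≤ A * (1 + |t|) ^ n ∧
      mesoFun α N (⌊N + τ * N ^ α * t⌋₊ + 1) x ^ 2 ≤ A * (1 + |t|) ^ n := by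
  obtain ⟨A, n, hA, h⟩ := exists_mesoFun_sq_le hα0 hα1 hτ R
  refine ⟨A, n, hA, ?_⟩
  filter_upwards [h, eventually_gt_atTop 0] with N hN hN0 t ht x hx
  have hp := Real.rpow_pos_of_pos hN0 α
  obtain ⟨h1, h2⟩ := floor_bounds (by positivity) ht
  exact ⟨hN _ t (by linarith) x hx, hN _ t (by push_cast; linarith) x hx⟩

theorem abs_oscWronskian_floor_le {α τ : ℝ} (hα0 : 0 < α) (hα1 : α < 1) (hτ : 0 < τ) (R : ℝ) :
    ∃ (A : ℝ) (n : ℕ), 0 ≤ A ∧ ∀ᶠ N in atTop, ∀ t, -N / (τ * N ^ α) ≤ t → ∀ x y, |x| ≤ R →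
      |y| ≤ R → |oscWronskian (mesoScale α N) ⌊N + τ * N ^ α * t⌋₊ x y| ≤ A * (1 + |t|) ^ n := by
  obtain ⟨A, n, hA, h⟩ := mesoFun_sq_floor_le hα0 hα1 hτ R
  refine ⟨(2 + τ) * (2 * A), n + 1, by positivity, ?_⟩
  filter_upwards [h, eventually_ge_atTop 1] with N hN hN1 t ht x y hx hy
  have hN0 : 0 < N := by linarith
  rw [oscWronskian_mesoScale α hN0, abs_mul]
  have h1 := sqrt_floor_div_le hα1 hτ hN1 ht
  have ht0 := abs_nonneg t
  have h2 : |√(((⌊N + τ * N ^ α * t⌋₊ : ℝ) + 1) / N) / Real.pi| ≤ (2 + τ) * (1 + |t|) := by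
    rw [abs_of_nonneg (by have := Real.pi_pos; positivity)]
    refine (div_le_self (Real.sqrt_nonneg _) (by linarith [Real.pi_gt_three])).trans ?_
    have h3 : 1 ≤ (2 + τ) * (1 + |t|) := by nlinarith [mul_nonneg hτ.le ht0]
    refine Real.sqrt_le_iff.2 ⟨by positivity, h1.trans ?_⟩
    nlinarith
  obtain ⟨a1, a2⟩ := hN t ht x hx
  obtain ⟨b1, b2⟩ := hN t ht y hy
  have hab : ∀ a b c d B : ℝ, a ^ 2 ≤ B → b ^ 2 ≤ B → c ^ 2 ≤ B → d ^ 2 ≤ B →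
      |a * b - c * d| ≤ 2 * B := fun a b c d B h1 h2 h3 h4 => by
    rw [abs_le]
    constructor <;> nlinarith [sq_nonneg (a + b), sq_nonneg (a - b), sq_nonneg (c + d),
      sq_nonneg (c - d)]
  have h4 := hab _ _ _ _ _ a2 b1 a1 b2
  calc _ ≤ ((2 + τ) * (1 + |t|)) * (2 * (A * (1 + |t|) ^ n)) :=
        mul_le_mul h2 h4 (abs_nonneg _) (by positivity)
    _ = _ := by ring

theorem sub_mul_oscKernel_eq_integral {Ψ : ℝ → ℝ} (hΨ : IsExpShape Ψ) {α τ N : ℝ} (hτ : 0 < τ)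
    (hN : 0 < N) {x y A : ℝ} {n : ℕ} (h : ∀ t, -N / (τ * N ^ α) ≤ t →
      |oscWronskian (mesoScale α N) ⌊N + τ * N ^ α * t⌋₊ x y| ≤ A * (1 + |t|) ^ n) :
    (x - y) * oscKernel (shapeWeight Ψ α τ N) (mesoScale α N) x y
      = ∫ t in Set.Ici (-N / (τ * N ^ α)), shapeDensity Ψ t *
          oscWronskian (mesoScale α N) ⌊N + τ * N ^ α * t⌋₊ x y := by
  have hT : 0 < τ * N ^ α := mul_pos hτ (Real.rpow_pos_of_pos hN α)
  rw [sub_mul_oscKernel (isRapid_shapeWeight hΨ α hτ hN) (mesoScale_pos α hN)]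
  exact (hasSum_density_cells hΨ hT h).1.tsum_eq

theorem exists_abs_sub_mul_oscKernel_le {Ψ : ℝ → ℝ} (hΨ : IsExpShape Ψ) {α τ : ℝ} (hα0 : 0 < α)
    (hα1 : α < 1) (hτ : 0 < τ) (R : ℝ) :
    ∃ M : ℝ, ∀ᶠ N in atTop, ∀ x y, |x| ≤ R → |y| ≤ R →
      |(x - y) * oscKernel (shapeWeight Ψ α τ N) (mesoScale α N) x y| ≤ M := by
  obtain ⟨A, n, hA, h⟩ := abs_oscWronskian_floor_le hα0 hα1 hτ R
  refine ⟨A * ∫ t, (1 + |t|) ^ n * shapeDensity Ψ t, ?_⟩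
  filter_upwards [h, eventually_gt_atTop 0] with N hN hN0 x y hx hy
  have hT : 0 < τ * N ^ α := mul_pos hτ (Real.rpow_pos_of_pos hN0 α)
  have hb := fun t ht => hN t ht x y hx hy
  rw [sub_mul_oscKernel_eq_integral hΨ hτ hN0 hb]
  exact (hasSum_density_cells hΨ hT (g := fun k => oscWronskian (mesoScale α N) k x y) hb).2

/-- The leading term of `(x - y) K(x, y)` in mesoscopic coordinates. -/
noncomputable def mesoLimit (Ψ : ℝ → ℝ) (α τ N x y : ℝ) : ℝ :=
  1 / Real.pi * ∫ t, shapeDensity Ψ t *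
    Real.sin (mesoPhase α N x - mesoPhase α N y + τ * t * (Real.pi / 2) * (x - y))

/-- Dominated convergence in t against the density. Both sides oscillate with N, so only their
difference converges. -/
theorem tendsto_sub_mul_oscKernel {Ψ : ℝ → ℝ} (hΨ : IsExpShape Ψ) {α τ : ℝ} (hα0 : 0 < α)
    (hα1 : α < 1) (hτ : 0 < τ) (x y : ℝ) :
    Tendsto (fun N => (x - y) * oscKernel (shapeWeight Ψ α τ N) (mesoScale α N) x y
      - mesoLimit Ψ α τ N x y) atTop (𝓝 0) := by
  obtain ⟨A, n, hA, h⟩ := abs_oscWronskian_floor_le hα0 hα1 hτ (max |x| |y|)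
  have hint := hΨ.integrable_pow_mul_density n
  have hmeas : ∀ N, Measurable fun t => shapeDensity Ψ t * (1 / Real.pi *
      Real.sin (mesoPhase α N x - mesoPhase α N y + τ * t * (Real.pi / 2) * (x - y))) := fun N =>
    (measurable_shapeDensity Ψ).mul (by fun_prop)
  have hmeas2 : ∀ N, Measurable fun t => shapeDensity Ψ t *
      oscWronskian (mesoScale α N) ⌊N + τ * N ^ α * t⌋₊ x y := fun N =>
    (measurable_shapeDensity Ψ).mul (measurable_comp_floor N (τ * N ^ α)
      (fun k => oscWronskian (mesoScale α N) k x y))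
  have hsin : ∀ N t, |1 / Real.pi * Real.sin (mesoPhase α N x - mesoPhase α N y
      + τ * t * (Real.pi / 2) * (x - y))| ≤ 1 := fun N t => by
    rw [abs_mul, abs_of_pos (by have := Real.pi_pos; positivity)]
    have h1 : 1 / Real.pi ≤ 1 := by
      rw [div_le_one Real.pi_pos]; linarith [Real.pi_gt_three]
    exact mul_le_one₀ h1 (abs_nonneg _) (Real.abs_sin_le_one _)
  have hD : Tendsto (fun N => ∫ t, ((Set.Ici (-N / (τ * N ^ α))).indicator (fun t =>
        shapeDensity Ψ t * oscWronskian (mesoScale α N) ⌊N + τ * N ^ α * t⌋₊ x y) t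
      - shapeDensity Ψ t * (1 / Real.pi * Real.sin (mesoPhase α N x - mesoPhase α N y
        + τ * t * (Real.pi / 2) * (x - y))))) atTop (𝓝 (∫ _ : ℝ, (0 : ℝ))) := by
    refine tendsto_integral_filter_of_dominated_convergence
      (fun t => (A + 1) * ((1 + |t|) ^ n * shapeDensity Ψ t))
      (Eventually.of_forall fun N => (((hmeas2 N).indicator measurableSet_Ici).sub
        (hmeas N)).aestronglyMeasurable) ?_ (hint.const_mul _) ?_
    · filter_upwards [h] with N hN
      refine Eventually.of_forall fun t => ?_
      have hΦ := hΨ.density_nonneg t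
      have hone : 1 ≤ (1 + |t|) ^ n := one_le_pow₀ (by linarith [abs_nonneg t])
      have h1 : |(Set.Ici (-N / (τ * N ^ α))).indicator (fun t =>
          shapeDensity Ψ t * oscWronskian (mesoScale α N) ⌊N + τ * N ^ α * t⌋₊ x y) t|
          ≤ A * ((1 + |t|) ^ n * shapeDensity Ψ t) := by
        by_cases ht : t ∈ Set.Ici (-N / (τ * N ^ α))
        · rw [Set.indicator_of_mem ht, abs_mul, abs_of_nonneg hΦ]
          have := hN t ht x y (le_max_left _ _) (le_max_right _ _)
          nlinarith
        · rw [Set.indicator_of_notMem ht, abs_zero]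
          positivity
      have h2 : |shapeDensity Ψ t * (1 / Real.pi * Real.sin (mesoPhase α N x - mesoPhase α N y
          + τ * t * (Real.pi / 2) * (x - y)))| ≤ (1 + |t|) ^ n * shapeDensity Ψ t := by
        rw [abs_mul, abs_of_nonneg hΦ]
        nlinarith [hsin N t]
      refine (abs_sub _ _).trans ?_
      linarith
    · refine Eventually.of_forall fun t => ?_
      have h1 := (tendsto_oscWronskian hα0 hα1 hτ t x y).const_mul (shapeDensity Ψ t)
      rw [mul_zero] at h1
      refine h1.congr' ?_
      filter_upwards [eventually_neg_div_le hα1 hτ t] with N hN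
      rw [Set.indicator_of_mem (Set.mem_Ici.2 hN)]
      ring
  rw [integral_zero] at hD
  refine hD.congr' ?_
  filter_upwards [h, eventually_gt_atTop 0] with N hN hN0
  have hb := fun t ht => hN t ht x y (le_max_left _ _) (le_max_right _ _)
  have hi2 : Integrable fun t => shapeDensity Ψ t * (1 / Real.pi *
      Real.sin (mesoPhase α N x - mesoPhase α N y + τ * t * (Real.pi / 2) * (x - y))) := by
    refine hΨ.integrable_density.mono' (hmeas N).aestronglyMeasurable
      (Eventually.of_forall fun t => ?_)
    rw [norm_mul, Real.norm_of_nonneg (hΨ.density_nonneg t)]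
    exact mul_le_of_le_one_right (hΨ.density_nonneg t) (hsin N t)
  have hi1 : Integrable ((Set.Ici (-N / (τ * N ^ α))).indicator fun t =>
      shapeDensity Ψ t * oscWronskian (mesoScale α N) ⌊N + τ * N ^ α * t⌋₊ x y) := by
    refine (hint.const_mul A).mono' ((hmeas2 N).indicator measurableSet_Ici).aestronglyMeasurable
      (Eventually.of_forall fun t => ?_)
    have hΦ := hΨ.density_nonneg t
    by_cases ht : t ∈ Set.Ici (-N / (τ * N ^ α))
    · rw [Set.indicator_of_mem ht, norm_mul, Real.norm_of_nonneg hΦ, Real.norm_eq_abs]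
      have := hb t ht
      nlinarith
    · rw [Set.indicator_of_notMem ht, norm_zero]
      positivity
  rw [integral_sub hi1 hi2, integral_indicator measurableSet_Ici,
    sub_mul_oscKernel_eq_integral hΨ hτ hN0 hb, mesoLimit]
  congr 1
  rw [← integral_const_mul]
  congr 1; ext t; ring

/-- In the Parseval bound one factor p_k - p_{k+1} is at most 1/(τN^α), which cancels the N^α from
the Jacobi coefficients and the change of scale. The other factor is kept as mass of the density, so
the sum is bounded by a moment. -/
theorem exists_integral_sub_mul_oscKernel_sq_le {Ψ : ℝ → ℝ} (hΨ : IsExpShape Ψ) {α τ : ℝ}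
    (hα0 : 0 < α) (hα1 : α < 1) (hτ : 0 < τ) (R : ℝ) :
    ∃ M : ℝ, 0 ≤ M ∧ ∀ᶠ N in atTop, ∀ x, |x| ≤ R →
      ∫ y, ((x - y) * oscKernel (shapeWeight Ψ α τ N) (mesoScale α N) x y) ^ 2 ≤ M := by
  obtain ⟨A, n, hA, h⟩ := mesoFun_sq_floor_le hα0 hα1 hτ R
  refine ⟨2 * (((2 + τ) * (2 * A) / τ) * ∫ t, (1 + |t|) ^ (n + 1) * shapeDensity Ψ t),
    ?_, ?_⟩
  · have : 0 ≤ ∫ t, (1 + |t|) ^ (n + 1) * shapeDensity Ψ t :=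
      integral_nonneg fun t => mul_nonneg (by positivity) (hΨ.density_nonneg t)
    positivity
  filter_upwards [h, eventually_ge_atTop 1] with N hN hN1 x hx
  have hN0 : 0 < N := by linarith
  have hp := Real.rpow_pos_of_pos hN0 α
  have hT : 0 < τ * N ^ α := mul_pos hτ hp
  refine (integral_sub_mul_oscKernel_sq_le (isRapid_shapeWeight hΨ α hτ hN0)
    (mesoScale_pos α hN0) x).2.trans (mul_le_mul_of_nonneg_left ?_ zero_le_two)
  set g : ℕ → ℝ := fun k => (((k : ℝ) + 1) / N) / τ *
    (mesoFun α N (k + 1) x ^ 2 + mesoFun α N k x ^ 2) with hg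
  have hgb : ∀ t, -N / (τ * N ^ α) ≤ t →
      |g ⌊N + τ * N ^ α * t⌋₊| ≤ (2 + τ) * (2 * A) / τ * (1 + |t|) ^ (n + 1) := by
    intro t ht
    obtain ⟨a1, a2⟩ := hN t ht x hx
    have h1 := sqrt_floor_div_le hα1 hτ hN1 ht
    rw [abs_of_nonneg (by positivity)]
    calc g ⌊N + τ * N ^ α * t⌋₊ ≤ ((2 + τ) * (1 + |t|)) / τ *
          (A * (1 + |t|) ^ n + A * (1 + |t|) ^ n) := by
          simp only [hg]; gcongr
      _ = _ := by ring
  obtain ⟨hs, hle⟩ := hasSum_density_cells hΨ hT hgb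
  refine le_trans ?_ ((le_abs_self _).trans hle)
  rw [← hs.tsum_eq]
  have hterm : ∀ k : ℕ, (shapeWeight Ψ α τ N k - shapeWeight Ψ α τ N (k + 1)) ^ 2
      * oscCoeff (mesoScale α N) k ^ 2
      * (oscFun (mesoScale α N) (k + 1) x ^ 2 + oscFun (mesoScale α N) k x ^ 2)
      ≤ (Ψ (((k : ℝ) - N) / (τ * N ^ α)) - Ψ (((k + 1 : ℕ) - N) / (τ * N ^ α))) * g k := by
    intro k
    have hle : ((k : ℝ) - N) / (τ * N ^ α) ≤ ((k + 1 : ℕ) - N) / (τ * N ^ α) := by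
      gcongr; simp
    have hd := hΨ.sub_le hle
    have hd0 : 0 ≤ Ψ (((k : ℝ) - N) / (τ * N ^ α)) - Ψ (((k + 1 : ℕ) - N) / (τ * N ^ α)) :=
      sub_nonneg.2 (hΨ.antitone hle)
    have e1 : ((k + 1 : ℕ) - N) / (τ * N ^ α) - ((k : ℝ) - N) / (τ * N ^ α) = (τ * N ^ α)⁻¹ := by
      push_cast; field_simp; ring
    rw [e1] at hd
    simp only [shapeWeight]
    set d := Ψ (((k : ℝ) - N) / (τ * N ^ α)) - Ψ (((k + 1 : ℕ) - N) / (τ * N ^ α))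
    have e2 : oscCoeff (mesoScale α N) k ^ 2 * (oscFun (mesoScale α N) (k + 1) x ^ 2
        + oscFun (mesoScale α N) k x ^ 2)
        = N ^ α * ((k + 1) / N / Real.pi ^ 2
          * (mesoFun α N (k + 1) x ^ 2 + mesoFun α N k x ^ 2)) := by
      rw [sq (oscFun _ (k + 1) x), sq (oscFun _ k x), oscFun_mul_eq α hN0, oscFun_mul_eq α hN0,
        oscCoeff_mesoScale α hN0, mul_pow, div_pow, Real.sq_sqrt (by positivity),
        Real.rpow_neg hN0.le]
      field_simp
    rw [mul_assoc, e2]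
    have hB : 0 ≤ (k + 1) / N * (mesoFun α N (k + 1) x ^ 2 + mesoFun α N k x ^ 2) := by positivity
    have hpi : 1 ≤ Real.pi ^ 2 := by nlinarith [Real.pi_gt_three]
    calc d ^ 2 * (N ^ α * ((k + 1) / N / Real.pi ^ 2
          * (mesoFun α N (k + 1) x ^ 2 + mesoFun α N k x ^ 2)))
        = d * (d * N ^ α) * ((k + 1) / N
          * (mesoFun α N (k + 1) x ^ 2 + mesoFun α N k x ^ 2)) / Real.pi ^ 2 := by ring
      _ ≤ d * ((τ * N ^ α)⁻¹ * N ^ α) * ((k + 1) / N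
          * (mesoFun α N (k + 1) x ^ 2 + mesoFun α N k x ^ 2)) / 1 := by gcongr
      _ = d * g k := by simp only [hg]; field_simp
  refine Summable.tsum_le_tsum hterm ?_ hs.summable
  exact Summable.of_nonneg_of_le (fun k => by positivity) hterm hs.summable

/-! ## Limit of the diagonal term -/

theorem hasSum_integral_mul_oscKernel_self {q : ℕ → ℝ} (hq : IsRapid q) {l : ℝ} (hl : 0 < l)
    {F : ℝ → ℝ} (hF : Integrable F) :
    HasSum (fun k => q k * ∫ x, F x * (oscFun l k x * oscFun l k x))
      (∫ x, F x * oscKernel q l x x) := by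
  have hint : ∀ k, Integrable fun x => F x * (oscFun l k x * oscFun l k x) := fun k =>
    hF.mul_bdd (c := 2 * l * ((k : ℝ) + 1) ^ 2)
      ((continuous_oscFun l k).mul (continuous_oscFun l k)).aestronglyMeasurable
      (Eventually.of_forall fun x => abs_oscFun_mul_le hl k x x)
  have h := hasSum_integral_of_summable_integral_norm (μ := (volume : Measure ℝ))
    (F := fun k x => q k * (F x * (oscFun l k x * oscFun l k x)))
    (fun k => (hint k).const_mul (q k)) (by
      refine Summable.of_nonneg_of_le (fun k => integral_nonneg fun x => norm_nonneg _)
        (fun k => ?_) ((hq 2).mul_left (2 * l * ∫ x, ‖F x‖))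
      calc ∫ x, ‖q k * (F x * (oscFun l k x * oscFun l k x))‖
          ≤ ∫ x, (|q k| * (2 * l * ((k : ℝ) + 1) ^ 2)) * ‖F x‖ := by
            refine integral_mono ((hint k).const_mul (q k)).norm (hF.norm.const_mul _) fun x => ?_
            simp only [norm_mul, Real.norm_eq_abs]
            rw [← abs_mul (oscFun l k x)]
            calc |q k| * (|F x| * |oscFun l k x * oscFun l k x|)
                ≤ |q k| * (|F x| * (2 * l * ((k : ℝ) + 1) ^ 2)) := by
                  gcongr; exact abs_oscFun_mul_le hl k x x
              _ = _ := by ring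
        _ = _ := by rw [integral_const_mul]; ring)
  simp_rw [integral_const_mul] at h
  have e : ∀ x, ∑' k, q k * (F x * (oscFun l k x * oscFun l k x)) = F x * oscKernel q l x x := by
    intro x
    rw [oscKernel, ← tsum_mul_left]
    exact tsum_congr fun k => by ring
  simp_rw [e] at h
  exact h

/-- The index enters only through the constant factor e^{-ikπ} of modulus one, so its dependence on
N may be arbitrary. -/
theorem tendsto_integral_mul_cos {α : ℝ} (hα0 : 0 < α) (hα1 : α < 1) {F : ℝ → ℝ}
    (hF : Integrable F) (c : ℝ) (k : ℝ → ℕ) :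
    Tendsto (fun N => ∫ x, F x * Real.cos (2 * (mesoPhase α N x + c * x - k N * (Real.pi / 2))))
      atTop (𝓝 0) := by
  have hg : Integrable fun x => (F x : ℂ) * Complex.exp ((2 * c * x : ℝ) * Complex.I) :=
    hF.ofReal.mul_bdd (c := 1) (by fun_prop : Continuous fun x : ℝ =>
      Complex.exp ((2 * c * x : ℝ) * Complex.I)).aestronglyMeasurable
      (Eventually.of_forall fun x => (norm_exp_ofReal_mul_I' _).le)
  have h := (tendsto_integral_mul_exp_mesoPhase hα0 hα1 hg).norm
  rw [norm_zero] at h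
  refine squeeze_zero_norm (fun N => ?_) h
  have hi : Integrable fun x => (F x : ℂ) * Complex.exp ((2 * c * x : ℝ) * Complex.I)
      * Complex.exp ((2 * mesoPhase α N x : ℝ) * Complex.I) := by
    have := continuous_mesoPhase α N
    exact hg.mul_bdd (c := 1) (by fun_prop : Continuous fun x : ℝ =>
      Complex.exp ((2 * mesoPhase α N x : ℝ) * Complex.I)).aestronglyMeasurable
      (Eventually.of_forall fun x => (norm_exp_ofReal_mul_I' _).le)
  have e : ∀ x, F x * Real.cos (2 * (mesoPhase α N x + c * x - k N * (Real.pi / 2)))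
      = RCLike.re (Complex.exp ((-(k N * Real.pi) : ℝ) * Complex.I) *
        ((F x : ℂ) * Complex.exp ((2 * c * x : ℝ) * Complex.I)
          * Complex.exp ((2 * mesoPhase α N x : ℝ) * Complex.I))) := by
    intro x
    have h1 : Complex.exp ((-(k N * Real.pi) : ℝ) * Complex.I) *
        ((F x : ℂ) * Complex.exp ((2 * c * x : ℝ) * Complex.I)
          * Complex.exp ((2 * mesoPhase α N x : ℝ) * Complex.I))
        = (F x : ℂ) * Complex.exp
          ((2 * (mesoPhase α N x + c * x - k N * (Real.pi / 2)) : ℝ) * Complex.I) := by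
      have : (((2 * (mesoPhase α N x + c * x - k N * (Real.pi / 2)) : ℝ)) : ℂ) * Complex.I
          = (-(k N * Real.pi) : ℝ) * Complex.I + (2 * c * x : ℝ) * Complex.I
            + (2 * mesoPhase α N x : ℝ) * Complex.I := by push_cast; ring
      rw [this, Complex.exp_add, Complex.exp_add]; ring
    rw [h1]
    simp only [RCLike.re_eq_complex_re]
    rw [Complex.re_ofReal_mul, Complex.exp_ofReal_mul_I_re]
  simp_rw [e]
  rw [integral_re (hi.const_mul _), integral_const_mul]
  refine (RCLike.abs_re_le_norm _).trans (le_of_eq ?_)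
  rw [norm_mul, norm_exp_ofReal_mul_I', one_mul]

/-- The square is asymptotically cos², that is 1/2 plus half the cosine of the doubled phase, which
integrates to 0 in the limit. -/
theorem tendsto_integral_mul_mesoFun_sq {α τ : ℝ} (hα0 : 0 < α) (hα1 : α < 1) (hτ : 0 < τ)
    {F : ℝ → ℝ} (hF : Integrable F) {R : ℝ} (hR : ∀ x, R < |x| → F x = 0) (t : ℝ) :
    Tendsto (fun N => ∫ x, F x * mesoFun α N ⌊N + τ * N ^ α * t⌋₊ x ^ 2) atTop
      (𝓝 (1 / 2 * ∫ x, F x)) := by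
  obtain ⟨A, n, hA, h⟩ := mesoFun_sq_floor_le hα0 hα1 hτ R
  set k : ℝ → ℕ := fun N => ⌊N + τ * N ^ α * t⌋₊ with hk
  set B : ℝ → ℝ → ℝ := fun N x => mesoPhase α N x + τ * t * (Real.pi / 2) * x
    - (k N : ℝ) * (Real.pi / 2) with hB
  have hBc : ∀ N, Continuous (B N) := fun N => by
    have := continuous_mesoPhase α N
    simp only [hB]; fun_prop
  have hcosi : ∀ N, Integrable fun x => F x * Real.cos (B N x) ^ 2 := fun N => by
    have := hBc N
    refine hF.mul_bdd (c := 1) (by fun_prop : Continuous fun x =>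
      Real.cos (B N x) ^ 2).aestronglyMeasurable (Eventually.of_forall fun x => ?_)
    rw [Real.norm_of_nonneg (sq_nonneg _)]
    exact Real.cos_sq_le_one _
  have hmi : ∀ N, Integrable fun x => F x * mesoFun α N (k N) x ^ 2 := fun N => by
    refine hF.mul_bdd (c := (√(microScale N)) ^ 2 * (2 * k N + 2))
      ((continuous_mesoFun α N (k N)).pow 2).aestronglyMeasurable
      (Eventually.of_forall fun x => ?_)
    rw [Real.norm_of_nonneg (sq_nonneg _), mesoFun, mul_pow]
    gcongr
    exact hermiteFun_sq_le _ _
  have h1 : Tendsto (fun N => ∫ x, (F x * mesoFun α N (k N) x ^ 2 - F x * Real.cos (B N x) ^ 2))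
      atTop (𝓝 (∫ _ : ℝ, (0 : ℝ))) := by
    refine tendsto_integral_filter_of_dominated_convergence
      (fun x => (A * (1 + |t|) ^ n + 1) * ‖F x‖)
      (Eventually.of_forall fun N => ((hmi N).sub (hcosi N)).aestronglyMeasurable) ?_
      (hF.norm.const_mul _) ?_
    · filter_upwards [h, eventually_neg_div_le hα1 hτ t] with N hN ht
      refine Eventually.of_forall fun x => ?_
      by_cases hx : |x| ≤ R
      · have h2 := (hN t ht x hx).1
        rw [← mul_sub, norm_mul, mul_comm]
        gcongr
        refine (abs_sub _ _).trans ?_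
        rw [abs_of_nonneg (sq_nonneg _), abs_of_nonneg (sq_nonneg _)]
        linarith [Real.cos_sq_le_one (B N x)]
      · rw [hR x (not_le.1 hx)]; simp
    · refine Eventually.of_forall fun x => ?_
      have h2 : Tendsto (fun N => mesoFun α N (k N) x - Real.cos (B N x)) atTop (𝓝 0) :=
        tendsto_mesoFun_floor hα0 hα1 hτ t 0 x
      have h3 := (tendsto_mul_sub_mul h2 h2 (fun N => Real.abs_cos_le_one _)
        (fun N => Real.abs_cos_le_one _)).const_mul (F x)
      rw [mul_zero] at h3
      exact h3.congr fun N => by ring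
  rw [integral_zero] at h1
  have h2 := ((tendsto_integral_mul_cos hα0 hα1 hF (τ * t * (Real.pi / 2)) k).const_mul
    (1 / 2)).const_add (1 / 2 * ∫ x, F x)
  rw [mul_zero, add_zero] at h2
  have h3 := h1.add h2
  rw [zero_add] at h3
  refine h3.congr fun N => ?_
  have hci : Integrable fun x => F x * Real.cos (2 * (mesoPhase α N x + τ * t * (Real.pi / 2) * x
      - k N * (Real.pi / 2))) := by
    have := hBc N
    exact hF.mul_bdd (c := 1) (by fun_prop : Continuous fun x =>
      Real.cos (2 * B N x)).aestronglyMeasurable (Eventually.of_forall fun x =>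
        Real.abs_cos_le_one _)
  have e : ∫ x, F x * Real.cos (B N x) ^ 2 = 1 / 2 * (∫ x, F x) + 1 / 2 *
      ∫ x, F x * Real.cos (2 * (mesoPhase α N x + τ * t * (Real.pi / 2) * x
        - k N * (Real.pi / 2))) := by
    rw [← integral_const_mul, ← integral_const_mul,
      ← integral_add (hF.const_mul _) (hci.const_mul _)]
    congr 1; ext x
    rw [Real.cos_sq]
    simp only [hB]; ring
  rw [integral_sub (hmi N) (hcosi N), e]
  ring

/-- The sum over k has mesh 1/(τN^α), and passing from e_k² to the normalized functions costs
N^(-α). The remaining factor is τ, times the mean 1/2 of the squares. -/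
theorem tendsto_integral_mul_oscKernel_self {Ψ : ℝ → ℝ} (hΨ : IsExpShape Ψ) {α τ : ℝ}
    (hα0 : 0 < α) (hα1 : α < 1) (hτ : 0 < τ)
    {F : ℝ → ℝ} (hF : Integrable F) {R : ℝ} (hR : ∀ x, R < |x| → F x = 0) :
    Tendsto (fun N => ∫ x, F x * oscKernel
      (fun k => shapeWeight Ψ α τ N k * (1 - shapeWeight Ψ α τ N k)) (mesoScale α N) x x) atTop
      (𝓝 (τ / 2 * shapeB2 Ψ * ∫ x, F x)) := by
  obtain ⟨A, n, hA, h⟩ := mesoFun_sq_floor_le hα0 hα1 hτ R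
  obtain ⟨c, C, hc, hC, hw⟩ := hΨ.mul_one_sub_le
  set w : ℝ → ℝ := fun t => Ψ t * (1 - Ψ t) with hwdef
  have hw0 : ∀ t, 0 ≤ w t := fun t =>
    mul_nonneg (hΨ.mem_Icc t).1 (by linarith [(hΨ.mem_Icc t).2])
  have hwle : ∀ t, w t ≤ C * Real.exp (-c * |t|) := fun t => by simpa using hw t 0
  have hwc : Continuous w := hΨ.continuous.mul (continuous_const.sub hΨ.continuous)
  set J : ℝ → ℕ → ℝ := fun N k => ∫ x, F x * mesoFun α N k x ^ 2 with hJ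
  set b : ℝ → ℝ := fun t => C * Real.exp c * (A * ∫ x, ‖F x‖)
    * ((1 + |t|) ^ n * Real.exp (-c * |t|)) with hb
  have hbi : Integrable b := (integrable_one_add_abs_pow_mul_exp hc n).const_mul _
  have hTlim : ∀ᶠ N : ℝ in atTop, 1 ≤ τ * N ^ α :=
    ((tendsto_rpow_atTop hα0).const_mul_atTop hτ).eventually_ge_atTop 1
  have hbound : ∀ᶠ N in atTop, ∀ t, -N / (τ * N ^ α) ≤ t →
      |w ((⌊N + τ * N ^ α * t⌋₊ - N) / (τ * N ^ α)) * J N ⌊N + τ * N ^ α * t⌋₊| ≤ b t := by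
    filter_upwards [h, eventually_gt_atTop 0, hTlim] with N hN hN0 hT1 t ht
    have hT : 0 < τ * N ^ α := by linarith
    obtain ⟨h1, h2⟩ := floor_bounds hT ht
    have hJb : |J N ⌊N + τ * N ^ α * t⌋₊| ≤ (A * ∫ x, ‖F x‖) * (1 + |t|) ^ n := by
      have : (A * ∫ x, ‖F x‖) * (1 + |t|) ^ n = ∫ x, A * (1 + |t|) ^ n * ‖F x‖ := by
        rw [integral_const_mul]; ring
      rw [this, ← Real.norm_eq_abs]
      refine norm_integral_le_of_norm_le (hF.norm.const_mul _) (Eventually.of_forall fun x => ?_)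
      by_cases hx : |x| ≤ R
      · rw [norm_mul, mul_comm, Real.norm_of_nonneg (sq_nonneg _)]
        gcongr
        exact (hN t ht x hx).1
      · rw [hR x (not_le.1 hx)]; simp
    set s := ((⌊N + τ * N ^ α * t⌋₊ : ℝ) - N) / (τ * N ^ α) with hs
    -- The weight is evaluated at the left end s of the cell containing t, within 1 of t once τN^α ≥
    -- 1. Moving the exponential bound from s to t costs the factor e^c in b.
    have hst : |t| ≤ |s| + 1 := by
      have h3 : |t - s| ≤ 1 := by
        rw [hs, abs_le]
        constructor
        · rw [neg_le_sub_iff_le_add, div_le_iff₀ hT]; nlinarith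
        · rw [sub_le_iff_le_add, ← sub_le_iff_le_add', le_div_iff₀ hT]; nlinarith
      have := abs_sub_abs_le_abs_sub t s
      linarith
    have hws : w s ≤ C * Real.exp c * Real.exp (-c * |t|) := by
      refine (hwle s).trans ?_
      rw [mul_assoc, ← Real.exp_add]
      gcongr
      nlinarith
    rw [abs_mul, abs_of_nonneg (hw0 s)]
    calc w s * |J N ⌊N + τ * N ^ α * t⌋₊| ≤ (C * Real.exp c * Real.exp (-c * |t|))
          * ((A * ∫ x, ‖F x‖) * (1 + |t|) ^ n) :=
          mul_le_mul hws hJb (abs_nonneg _) (by positivity)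
      _ = b t := by simp only [hb]; ring
  have hD : Tendsto (fun N => ∫ t, (Set.Ici (-N / (τ * N ^ α))).indicator (fun t =>
      w ((⌊N + τ * N ^ α * t⌋₊ - N) / (τ * N ^ α)) * J N ⌊N + τ * N ^ α * t⌋₊) t) atTop
      (𝓝 (∫ t, w t * (1 / 2 * ∫ x, F x))) := by
    refine tendsto_integral_filter_of_dominated_convergence b
      (Eventually.of_forall fun N => ((measurable_comp_floor N (τ * N ^ α)
        (fun k => w ((k - N) / (τ * N ^ α)) * J N k)).indicator
          measurableSet_Ici).aestronglyMeasurable) ?_ hbi ?_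
    · filter_upwards [hbound] with N hN
      refine Eventually.of_forall fun t => ?_
      by_cases ht : t ∈ Set.Ici (-N / (τ * N ^ α))
      · rw [Set.indicator_of_mem ht]
        exact hN t ht
      · rw [Set.indicator_of_notMem ht, norm_zero]
        positivity
    · refine Eventually.of_forall fun t => ?_
      have h1 := ((tendsto_floor_window hα0 hα1 hτ t 0).div_const τ)
      rw [mul_div_cancel_left₀ _ hτ.ne'] at h1
      have h2 := ((hwc.tendsto t).comp h1).mul
        (tendsto_integral_mul_mesoFun_sq hα0 hα1 hτ hF hR t)
      refine h2.congr' ?_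
      filter_upwards [eventually_neg_div_le hα1 hτ t] with N hN
      rw [Set.indicator_of_mem (Set.mem_Ici.2 hN)]
      simp only [Function.comp, add_zero, hJ]
      rw [div_div, mul_comm (N ^ α) τ]
  have hlim := hD.const_mul τ
  rw [integral_mul_const] at hlim
  have e : τ * ((∫ t, w t) * (1 / 2 * ∫ x, F x)) = τ / 2 * shapeB2 Ψ * ∫ x, F x := by
    simp only [hwdef, shapeB2]; ring
  rw [e] at hlim
  refine hlim.congr' ?_
  filter_upwards [hbound, eventually_gt_atTop 0] with N hN hN0
  have hp := Real.rpow_pos_of_pos hN0 α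
  have hT : 0 < τ * N ^ α := mul_pos hτ hp
  have hq : IsRapid fun k => shapeWeight Ψ α τ N k * (1 - shapeWeight Ψ α τ N k) := by
    refine (isRapid_shapeWeight hΨ α hτ hN0).mono fun k => ?_
    obtain ⟨h1, h2⟩ := shapeWeight_mem hΨ α τ N k
    rw [abs_mul, abs_of_nonneg (by linarith : 0 ≤ 1 - shapeWeight Ψ α τ N k)]
    exact mul_le_of_le_one_right (abs_nonneg _) (by linarith)
  have h1 := hasSum_integral_mul_oscKernel_self hq (mesoScale_pos α hN0) hF
  have h2 := (hasSum_const_cells hT hbi hN).mul_left (N ^ (-α))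
  have h3 : ∀ k : ℕ, N ^ (-α) * (w ((k - N) / (τ * N ^ α)) * J N k)
      = shapeWeight Ψ α τ N k * (1 - shapeWeight Ψ α τ N k) *
        ∫ x, F x * (oscFun (mesoScale α N) k x * oscFun (mesoScale α N) k x) := by
    intro k
    have : ∀ x, F x * (oscFun (mesoScale α N) k x * oscFun (mesoScale α N) k x)
        = N ^ (-α) * (F x * mesoFun α N k x ^ 2) := fun x => by
      rw [oscFun_mul_eq α hN0]; ring
    simp_rw [this]
    rw [integral_const_mul]
    simp only [hwdef, shapeWeight, hJ]; ring
  simp_rw [h3] at h2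
  rw [← h2.unique h1, integral_indicator measurableSet_Ici, Real.rpow_neg hN0.le]
  field_simp

/-! ## Limit of the off-diagonal term -/

/-- The characteristic function of the density, in the frequency normalization of the kernel. -/
noncomputable def densityChar (Ψ : ℝ → ℝ) (τ z : ℝ) : ℂ :=
  ∫ t, (shapeDensity Ψ t : ℂ) * Complex.exp ((τ * t * (Real.pi / 2) * z : ℝ) * Complex.I)

theorem norm_densityChar_le {Ψ : ℝ → ℝ} (hΨ : IsExpShape Ψ) (τ z : ℝ) :
    ‖densityChar Ψ τ z‖ ≤ ∫ t, shapeDensity Ψ t := by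
  refine norm_integral_le_of_norm_le hΨ.integrable_density (Eventually.of_forall fun t => ?_)
  rw [norm_mul, norm_exp_ofReal_mul_I', mul_one, Complex.norm_real,
    Real.norm_of_nonneg (hΨ.density_nonneg t)]

theorem continuous_densityChar {Ψ : ℝ → ℝ} (hΨ : IsExpShape Ψ) (τ : ℝ) :
    Continuous (densityChar Ψ τ) := by
  refine continuous_of_dominated (bound := shapeDensity Ψ) (fun z => ?_) (fun z => ?_)
    hΨ.integrable_density (Eventually.of_forall fun t => by fun_prop)
  · exact ((Complex.measurable_ofReal.comp (measurable_shapeDensity Ψ)).mul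
      (by fun_prop)).aestronglyMeasurable
  · refine Eventually.of_forall fun t => ?_
    rw [norm_mul, norm_exp_ofReal_mul_I', mul_one, Complex.norm_real,
      Real.norm_of_nonneg (hΨ.density_nonneg t)]

theorem mesoLimit_eq_im {Ψ : ℝ → ℝ} (hΨ : IsExpShape Ψ) (α τ N x y : ℝ) :
    mesoLimit Ψ α τ N x y = 1 / Real.pi * (Complex.exp ((mesoPhase α N x - mesoPhase α N y : ℝ)
      * Complex.I) * densityChar Ψ τ (x - y)).im := by
  have hi : Integrable fun t => (shapeDensity Ψ t : ℂ) *
      Complex.exp ((τ * t * (Real.pi / 2) * (x - y) : ℝ) * Complex.I) :=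
    hΨ.integrable_density.ofReal.mul_bdd (c := 1) (by fun_prop : Continuous fun t : ℝ =>
      Complex.exp ((τ * t * (Real.pi / 2) * (x - y) : ℝ) * Complex.I)).aestronglyMeasurable
      (Eventually.of_forall fun x => (norm_exp_ofReal_mul_I' _).le)
  rw [mesoLimit, densityChar]
  congr 1
  rw [← integral_const_mul]
  have h := integral_im (hi.const_mul
    (Complex.exp ((mesoPhase α N x - mesoPhase α N y : ℝ) * Complex.I)))
  simp only [RCLike.im_eq_complex_im] at h
  rw [← h]
  congr 1; ext t
  have : Complex.exp ((mesoPhase α N x - mesoPhase α N y : ℝ) * Complex.I) *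
      ((shapeDensity Ψ t : ℂ) * Complex.exp ((τ * t * (Real.pi / 2) * (x - y) : ℝ) * Complex.I))
      = (shapeDensity Ψ t : ℂ) * Complex.exp ((mesoPhase α N x - mesoPhase α N y
        + τ * t * (Real.pi / 2) * (x - y) : ℝ) * Complex.I) := by
    rw [mul_left_comm, ← Complex.exp_add]
    congr 2; push_cast; ring
  rw [this, Complex.im_ofReal_mul, Complex.exp_ofReal_mul_I_im]

/-- Separates the mean of a squared sine from its oscillation: with e the exponential of i times the
phase difference, the second term carries the doubled phase. -/
theorem im_mul_sq (e w : ℂ) (he : ‖e‖ = 1) :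
    (e * w).im ^ 2 = 1 / 2 * ‖w‖ ^ 2 - 1 / 2 * (w ^ 2 * e ^ 2).re := by
  have h : ‖w‖ ^ 2 = (e * w).re ^ 2 + (e * w).im ^ 2 := by
    rw [← one_mul ‖w‖, ← he, ← norm_mul, ← Complex.normSq_eq_norm_sq, Complex.normSq_apply]; ring
  rw [h, show w ^ 2 * e ^ 2 = (e * w) ^ 2 by ring, sq (e * w), Complex.mul_re (e * w)]
  ring

theorem mesoLimit_sq {Ψ : ℝ → ℝ} (hΨ : IsExpShape Ψ) (α τ N x y : ℝ) :
    mesoLimit Ψ α τ N x y ^ 2 = 1 / (2 * Real.pi ^ 2) * ‖densityChar Ψ τ (x - y)‖ ^ 2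
      - 1 / (2 * Real.pi ^ 2) * (densityChar Ψ τ (x - y) ^ 2 *
        Complex.exp ((2 * mesoPhase α N x - 2 * mesoPhase α N y : ℝ) * Complex.I)).re := by
  rw [mesoLimit_eq_im hΨ, mul_pow, im_mul_sq _ _ (norm_exp_ofReal_mul_I' _), ← Complex.exp_nat_mul]
  have : ((2 : ℕ) : ℂ) * (((mesoPhase α N x - mesoPhase α N y : ℝ) : ℂ) * Complex.I)
      = ((2 * mesoPhase α N x - 2 * mesoPhase α N y : ℝ) : ℂ) * Complex.I := by
    push_cast; ring
  rw [this]
  have := Real.pi_pos.ne'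
  field_simp

theorem abs_mesoLimit_le {Ψ : ℝ → ℝ} (hΨ : IsExpShape Ψ) (α τ N x y : ℝ) :
    |mesoLimit Ψ α τ N x y| ≤ ∫ t, shapeDensity Ψ t := by
  rw [mesoLimit_eq_im hΨ, abs_mul, abs_of_pos (by have := Real.pi_pos; positivity)]
  have h1 : 1 / Real.pi ≤ 1 := by
    rw [div_le_one Real.pi_pos]; linarith [Real.pi_gt_three]
  refine (mul_le_of_le_one_left (abs_nonneg _) h1).trans ((Complex.abs_im_le_norm _).trans ?_)
  rw [norm_mul, norm_exp_ofReal_mul_I', one_mul]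
  exact norm_densityChar_le hΨ τ _

theorem measurable_mesoLimit {Ψ : ℝ → ℝ} (hΨ : IsExpShape Ψ) (α τ N : ℝ) :
    Measurable fun z : ℝ × ℝ => mesoLimit Ψ α τ N z.1 z.2 := by
  simp_rw [mesoLimit_eq_im hΨ]
  have h1 := continuous_densityChar hΨ τ
  have h2 := continuous_mesoPhase α N
  exact Measurable.const_mul (Complex.measurable_im.comp
    (by fun_prop : Continuous fun z : ℝ × ℝ =>
      Complex.exp ((mesoPhase α N z.1 - mesoPhase α N z.2 : ℝ) * Complex.I)
        * densityChar Ψ τ (z.1 - z.2)).measurable) _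

theorem tendsto_integral_mul_mesoLimit_sq {Ψ : ℝ → ℝ} (hΨ : IsExpShape Ψ) {α τ : ℝ} (hα0 : 0 < α)
    (hα1 : α < 1) {I : ℝ × ℝ → ℝ} (hI : Integrable I) :
    Tendsto (fun N => ∫ z, I z * mesoLimit Ψ α τ N z.1 z.2 ^ 2) atTop
      (𝓝 (1 / (2 * Real.pi ^ 2) * ∫ z, I z * ‖densityChar Ψ τ (z.1 - z.2)‖ ^ 2)) := by
  have hc := continuous_densityChar hΨ τ
  have hb := norm_densityChar_le hΨ τ
  set D := ∫ t, shapeDensity Ψ t with hD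
  have hI1 : Integrable fun z : ℝ × ℝ => I z * ‖densityChar Ψ τ (z.1 - z.2)‖ ^ 2 :=
    hI.mul_bdd (c := D ^ 2) (by fun_prop : Continuous fun z : ℝ × ℝ =>
      ‖densityChar Ψ τ (z.1 - z.2)‖ ^ 2).aestronglyMeasurable (Eventually.of_forall fun z => by
        rw [norm_pow, norm_norm]; gcongr; exact hb _)
  have hH : Integrable fun z : ℝ × ℝ => (I z : ℂ) * densityChar Ψ τ (z.1 - z.2) ^ 2 :=
    hI.ofReal.mul_bdd (c := D ^ 2) (by fun_prop : Continuous fun z : ℝ × ℝ =>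
      densityChar Ψ τ (z.1 - z.2) ^ 2).aestronglyMeasurable (Eventually.of_forall fun z => by
        rw [norm_pow]; gcongr; exact hb _)
  have h := tendsto_integral_prod_mul_exp_mesoPhase hα0 hα1 hH
  have h2 := ((Complex.continuous_re.tendsto 0).comp h).const_mul (1 / (2 * Real.pi ^ 2))
  rw [Complex.zero_re, mul_zero] at h2
  have h3 := h2.const_sub (1 / (2 * Real.pi ^ 2) * ∫ z, I z * ‖densityChar Ψ τ (z.1 - z.2)‖ ^ 2)
  rw [sub_zero] at h3
  refine h3.congr fun N => ?_
  have hm := continuous_mesoPhase α N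
  have hE : Integrable fun z : ℝ × ℝ => (I z : ℂ) * densityChar Ψ τ (z.1 - z.2) ^ 2 *
      Complex.exp ((2 * mesoPhase α N z.1 - 2 * mesoPhase α N z.2 : ℝ) * Complex.I) :=
    hH.mul_bdd (c := 1) (by fun_prop : Continuous fun z : ℝ × ℝ =>
      Complex.exp ((2 * mesoPhase α N z.1 - 2 * mesoPhase α N z.2 : ℝ)
        * Complex.I)).aestronglyMeasurable
      (Eventually.of_forall fun x => (norm_exp_ofReal_mul_I' _).le)
  have hEre : Integrable fun z : ℝ × ℝ => ((I z : ℂ) * densityChar Ψ τ (z.1 - z.2) ^ 2 *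
      Complex.exp ((2 * mesoPhase α N z.1 - 2 * mesoPhase α N z.2 : ℝ) * Complex.I)).re := hE.re
  have hre := integral_re hE
  simp only [RCLike.re_eq_complex_re] at hre
  simp only [Function.comp]
  rw [← hre, ← integral_const_mul, ← integral_const_mul,
    ← integral_sub (hI1.const_mul _) (hEre.const_mul _)]
  congr 1; ext z
  rw [mesoLimit_sq hΨ, mul_assoc (I z : ℂ), Complex.re_ofReal_mul]
  ring

/-- The local form of the off-diagonal limit, for a weight supported in a bounded square. There
(x-y)K is bounded uniformly in N, so its square may be replaced under the integral by that of its
leading term. -/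
theorem tendsto_integral_mul_sub_mul_oscKernel_sq {Ψ : ℝ → ℝ} (hΨ : IsExpShape Ψ) {α τ : ℝ}
    (hα0 : 0 < α) (hα1 : α < 1) (hτ : 0 < τ) {I : ℝ × ℝ → ℝ} (hI : Integrable I) {R : ℝ}
    (hR : ∀ z : ℝ × ℝ, R < |z.1| ∨ R < |z.2| → I z = 0) :
    Tendsto (fun N => ∫ z : ℝ × ℝ, I z *
      ((z.1 - z.2) * oscKernel (shapeWeight Ψ α τ N) (mesoScale α N) z.1 z.2) ^ 2) atTop
      (𝓝 (1 / (2 * Real.pi ^ 2) * ∫ z, I z * ‖densityChar Ψ τ (z.1 - z.2)‖ ^ 2)) := by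
  obtain ⟨M, hM⟩ := exists_abs_sub_mul_oscKernel_le hΨ hα0 hα1 hτ R
  set D := ∫ t, shapeDensity Ψ t with hD
  have hmI : ∀ N, Integrable fun z : ℝ × ℝ => I z * mesoLimit Ψ α τ N z.1 z.2 ^ 2 := fun N =>
    hI.mul_bdd (c := D ^ 2) ((measurable_mesoLimit hΨ α τ N).pow_const 2).aestronglyMeasurable
      (Eventually.of_forall fun z => by
        rw [norm_pow, Real.norm_eq_abs]; gcongr; exact abs_mesoLimit_le hΨ α τ N _ _)
  have hGm : ∀ N, 0 < N → AEStronglyMeasurable (fun z : ℝ × ℝ =>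
      ((z.1 - z.2) * oscKernel (shapeWeight Ψ α τ N) (mesoScale α N) z.1 z.2) ^ 2) volume :=
    fun N hN => by
      have := continuous_oscKernel (isRapid_shapeWeight hΨ α hτ hN) (mesoScale_pos α hN)
      exact (((continuous_fst.sub continuous_snd).mul this).pow 2).aestronglyMeasurable
  have hGI : ∀ᶠ N in atTop, Integrable fun z : ℝ × ℝ => I z *
      ((z.1 - z.2) * oscKernel (shapeWeight Ψ α τ N) (mesoScale α N) z.1 z.2) ^ 2 := by
    filter_upwards [hM, eventually_gt_atTop 0] with N hN hN0
    refine (hI.norm.mul_const (M ^ 2)).mono' (hI.aestronglyMeasurable.mul (hGm N hN0))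
      (Eventually.of_forall fun z => ?_)
    by_cases hz : R < |z.1| ∨ R < |z.2|
    · rw [hR z hz]; simp
    · push Not at hz
      rw [norm_mul, norm_pow, Real.norm_eq_abs (_ * _)]
      gcongr
      exact hN _ _ hz.1 hz.2
  have h1 : Tendsto (fun N => ∫ z : ℝ × ℝ, (I z *
      ((z.1 - z.2) * oscKernel (shapeWeight Ψ α τ N) (mesoScale α N) z.1 z.2) ^ 2
      - I z * mesoLimit Ψ α τ N z.1 z.2 ^ 2)) atTop (𝓝 (∫ _ : ℝ × ℝ, (0 : ℝ))) := by
    refine tendsto_integral_filter_of_dominated_convergence (fun z => ‖I z‖ * (M ^ 2 + D ^ 2)) ?_ ?_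
      (hI.norm.mul_const _) ?_
    · filter_upwards [hGI] with N hN
      exact (hN.sub (hmI N)).aestronglyMeasurable
    · filter_upwards [hM] with N hN
      refine Eventually.of_forall fun z => ?_
      by_cases hz : R < |z.1| ∨ R < |z.2|
      · rw [hR z hz]; simp
      · push Not at hz
        rw [← mul_sub, norm_mul]
        gcongr
        refine (norm_sub_le _ _).trans ?_
        rw [norm_pow, norm_pow, Real.norm_eq_abs, Real.norm_eq_abs]
        gcongr
        · exact hN _ _ hz.1 hz.2
        · exact abs_mesoLimit_le hΨ α τ N _ _
    · refine Eventually.of_forall fun z => ?_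
      have h2 := tendsto_sub_mul_oscKernel hΨ hα0 hα1 hτ z.1 z.2
      have hbd : ∀ N, |mesoLimit Ψ α τ N z.1 z.2| ≤ D := fun N => abs_mesoLimit_le hΨ α τ N _ _
      have h3 := (h2.abs.mul (h2.abs.add_const (2 * D))).const_mul ‖I z‖
      simp only [abs_zero, zero_mul, mul_zero] at h3
      refine squeeze_zero_norm (fun N => ?_) h3
      set a := (z.1 - z.2) * oscKernel (shapeWeight Ψ α τ N) (mesoScale α N) z.1 z.2
      set m := mesoLimit Ψ α τ N z.1 z.2
      rw [← mul_sub, norm_mul, show a ^ 2 - m ^ 2 = (a - m) * ((a - m) + 2 * m) by ring, norm_mul]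
      gcongr
      · exact le_rfl
      · refine (norm_add_le _ _).trans ?_
        rw [norm_mul, Real.norm_two]
        gcongr
        · exact le_rfl
        · exact hbd N
  rw [integral_zero] at h1
  have h4 := h1.add (tendsto_integral_mul_mesoLimit_sq (τ := τ) hΨ hα0 hα1 hI)
  rw [zero_add] at h4
  refine h4.congr' ?_
  filter_upwards [hGI] with N hN
  rw [integral_sub hN (hmI N)]
  ring

/-! ## Variance functionals of the Hermite kernels -/

/-- The fibre bound is required only where g does not vanish: in the application it is known only
for x in the support of the test function. -/
theorem integrable_fst_mul {g : ℝ → ℝ} {H : ℝ × ℝ → ℝ} {M : ℝ} (hg : Integrable g)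
    (hH : Continuous H) (hH0 : ∀ z, 0 ≤ H z) (hs : ∀ x, Integrable fun y => H (x, y))
    (hM : ∀ x, g x ≠ 0 → ∫ y, H (x, y) ≤ M) : Integrable fun z : ℝ × ℝ => g z.1 * H z := by
  have hm : AEStronglyMeasurable (fun z : ℝ × ℝ => g z.1 * H z) (volume.prod volume) :=
    hg.aestronglyMeasurable.comp_fst.mul hH.aestronglyMeasurable
  refine (integrable_prod_iff hm).2 ⟨Eventually.of_forall fun x => (hs x).const_mul (g x), ?_⟩
  refine (hg.norm.mul_const M).mono' hm.norm.integral_prod_right' (Eventually.of_forall fun x => ?_)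
  simp only [norm_mul, Real.norm_of_nonneg (hH0 _)]
  rw [integral_const_mul, norm_mul, norm_norm,
    Real.norm_of_nonneg (integral_nonneg fun y => hH0 _)]
  by_cases hx : g x = 0
  · simp [hx]
  · gcongr
    exact hM x hx

theorem integral_fst_mul {g : ℝ → ℝ} {H : ℝ × ℝ → ℝ}
    (hi : Integrable fun z : ℝ × ℝ => g z.1 * H z) :
    ∫ z : ℝ × ℝ, g z.1 * H z = ∫ x, g x * ∫ y, H (x, y) := by
  rw [Measure.volume_eq_prod, integral_prod _ (by rwa [← Measure.volume_eq_prod])]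
  simp only [integral_const_mul]

theorem integral_fst_mul_le {g : ℝ → ℝ} {H : ℝ × ℝ → ℝ} {M : ℝ} (hg : Integrable g)
    (hg0 : ∀ x, 0 ≤ g x) (hH : Continuous H) (hH0 : ∀ z, 0 ≤ H z)
    (hs : ∀ x, Integrable fun y => H (x, y)) (hM : ∀ x, g x ≠ 0 → ∫ y, H (x, y) ≤ M) :
    ∫ z : ℝ × ℝ, g z.1 * H z ≤ M * ∫ x, g x := by
  have hi := integrable_fst_mul hg hH hH0 hs hM
  rw [integral_fst_mul hi, mul_comm M, ← integral_mul_const]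
  have h1 : Integrable fun x => g x * ∫ y, H (x, y) := by
    have := Integrable.integral_prod_left (μ := (volume : Measure ℝ)) (ν := (volume : Measure ℝ)) hi
    simpa only [integral_const_mul] using this
  refine integral_mono h1 (hg.mul_const M) fun x => ?_
  by_cases hx : g x = 0
  · simp [hx]
  · exact mul_le_mul_of_nonneg_left (hM x hx) (hg0 x)

theorem IsRapid.sq {p : ℕ → ℝ} (hp : IsRapid p) (h : ∀ k, |p k| ≤ 1) :
    IsRapid fun k => p k ^ 2 :=
  hp.mono fun k => by rw [abs_pow, _root_.sq]; exact mul_le_of_le_one_left (abs_nonneg _) (h k)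

theorem integrable_fst_mul_oscKernel_sq {p : ℕ → ℝ} (hp : IsRapid p) (h1 : ∀ k, |p k| ≤ 1)
    {l : ℝ} (hl : 0 < l) {g : ℝ → ℝ} (hg : Integrable g) :
    Integrable fun z : ℝ × ℝ => g z.1 * oscKernel p l z.1 z.2 ^ 2 := by
  obtain ⟨C, _, hC⟩ := exists_abs_oscKernel_le (hp.sq h1) hl
  refine integrable_fst_mul (M := C) (H := fun z : ℝ × ℝ => oscKernel p l z.1 z.2 ^ 2) hg
    ((continuous_oscKernel hp hl).pow 2) (fun z => sq_nonneg _)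
    (fun x => integrable_oscKernel_sq hp hl x) fun x _ => ?_
  rw [integral_oscKernel_sq hp hl]
  exact (le_abs_self _).trans (hC x x)

theorem integrable_snd_mul_oscKernel_sq {p : ℕ → ℝ} (hp : IsRapid p) (h1 : ∀ k, |p k| ≤ 1)
    {l : ℝ} (hl : 0 < l) {g : ℝ → ℝ} (hg : Integrable g) :
    Integrable fun z : ℝ × ℝ => g z.2 * oscKernel p l z.1 z.2 ^ 2 := by
  have := (integrable_fst_mul_oscKernel_sq hp h1 hl hg).swap
  refine this.congr (Eventually.of_forall fun z => ?_)
  simp only [Function.comp, Prod.fst_swap, Prod.snd_swap]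
  rw [oscKernel_comm]

theorem integral_fst_mul_oscKernel_sq {p : ℕ → ℝ} (hp : IsRapid p) (h1 : ∀ k, |p k| ≤ 1)
    {l : ℝ} (hl : 0 < l) {g : ℝ → ℝ} (hg : Integrable g) :
    ∫ z : ℝ × ℝ, g z.1 * oscKernel p l z.1 z.2 ^ 2
      = ∫ x, g x * oscKernel (fun k => p k ^ 2) l x x := by
  rw [integral_fst_mul (H := fun z : ℝ × ℝ => oscKernel p l z.1 z.2 ^ 2)
    (integrable_fst_mul_oscKernel_sq hp h1 hl hg)]
  simp only [integral_oscKernel_sq hp hl]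

theorem integral_snd_mul_oscKernel_sq {p : ℕ → ℝ} (hp : IsRapid p) (h1 : ∀ k, |p k| ≤ 1)
    {l : ℝ} (hl : 0 < l) {g : ℝ → ℝ} (hg : Integrable g) :
    ∫ z : ℝ × ℝ, g z.2 * oscKernel p l z.1 z.2 ^ 2
      = ∫ x, g x * oscKernel (fun k => p k ^ 2) l x x := by
  rw [← integral_fst_mul_oscKernel_sq hp h1 hl hg]
  have := integral_prod_swap (μ := (volume : Measure ℝ)) (ν := (volume : Measure ℝ))
    fun z : ℝ × ℝ => g z.1 * oscKernel p l z.1 z.2 ^ 2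
  rw [← Measure.volume_eq_prod] at this
  rw [← this]
  congr 1; ext z
  rw [Prod.fst_swap, Prod.snd_swap, oscKernel_comm]

theorem integrable_mul_self_oscKernel {p : ℕ → ℝ} (hp : IsRapid p) {l : ℝ} (hl : 0 < l)
    {g : ℝ → ℝ} (hg : Integrable g) : Integrable fun x => g x * oscKernel p l x x := by
  obtain ⟨C, _, hC⟩ := exists_abs_oscKernel_le hp hl
  exact hg.mul_bdd (c := C) (continuous_oscKernel_self hp hl).aestronglyMeasurable
    (Eventually.of_forall fun x => hC x x)

theorem aestronglyMeasurable_sub_sq_mul {p : ℕ → ℝ} (hp : IsRapid p) {l : ℝ} (hl : 0 < l)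
    {f : ℝ → ℝ} (hf : AEStronglyMeasurable f) :
    AEStronglyMeasurable (fun z : ℝ × ℝ => (f z.1 - f z.2) ^ 2 * oscKernel p l z.1 z.2 ^ 2)
      volume :=
  ((hf.comp_fst.sub hf.comp_snd).pow 2).mul
    ((continuous_oscKernel hp hl).pow 2).aestronglyMeasurable

theorem integrable_sub_sq_mul_oscKernel_sq {p : ℕ → ℝ} (hp : IsRapid p) (h1 : ∀ k, |p k| ≤ 1)
    {l : ℝ} (hl : 0 < l) {f : ℝ → ℝ} (hf : MemLp f 2) :
    Integrable fun z : ℝ × ℝ => (f z.1 - f z.2) ^ 2 * oscKernel p l z.1 z.2 ^ 2 := by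
  have h := ((integrable_fst_mul_oscKernel_sq hp h1 hl hf.integrable_sq).add
    (integrable_snd_mul_oscKernel_sq hp h1 hl hf.integrable_sq)).const_mul 2
  refine h.mono' (aestronglyMeasurable_sub_sq_mul hp hl hf.1) (Eventually.of_forall fun z => ?_)
  rw [Real.norm_of_nonneg (by positivity)]
  simp only [Pi.add_apply]
  nlinarith [mul_nonneg (sq_nonneg (f z.1 + f z.2)) (sq_nonneg (oscKernel p l z.1 z.2))]

theorem integrable_mul_mul_oscKernel_sq {p : ℕ → ℝ} (hp : IsRapid p) (h1 : ∀ k, |p k| ≤ 1)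
    {l : ℝ} (hl : 0 < l) {f : ℝ → ℝ} (hf : MemLp f 2) :
    Integrable fun z : ℝ × ℝ => f z.1 * f z.2 * oscKernel p l z.1 z.2 ^ 2 := by
  have h := (((integrable_fst_mul_oscKernel_sq hp h1 hl hf.integrable_sq).add
    (integrable_snd_mul_oscKernel_sq hp h1 hl hf.integrable_sq)).sub
      (integrable_sub_sq_mul_oscKernel_sq hp h1 hl hf)).const_mul (1 / 2)
  refine h.congr (Eventually.of_forall fun z => ?_)
  simp only [Pi.add_apply, Pi.sub_apply]
  ring

/-- Expand the square: each of the terms f(x)²K² and f(y)²K² integrates to ∫ f² Σ p_k² e_k² by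
Parseval, and p - p² = p(1-p). The second term now contains differences of f, which absorb the
singularity of K on the diagonal. -/
theorem variance_functional_eq {p : ℕ → ℝ} (hp : IsRapid p) (h1 : ∀ k, |p k| ≤ 1)
    {l : ℝ} (hl : 0 < l) {f : ℝ → ℝ} (hf : MemLp f 2) :
    (∫ x, f x ^ 2 * oscKernel p l x x) - ∫ z : ℝ × ℝ, f z.1 * f z.2 * oscKernel p l z.1 z.2 ^ 2
      = (∫ x, f x ^ 2 * oscKernel (fun k => p k * (1 - p k)) l x x)
        + 1 / 2 * ∫ z : ℝ × ℝ, (f z.1 - f z.2) ^ 2 * oscKernel p l z.1 z.2 ^ 2 := by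
  have hf2 := hf.integrable_sq
  have e1 : ∫ z : ℝ × ℝ, (f z.1 - f z.2) ^ 2 * oscKernel p l z.1 z.2 ^ 2
      = 2 * (∫ x, f x ^ 2 * oscKernel (fun k => p k ^ 2) l x x)
        - 2 * ∫ z : ℝ × ℝ, f z.1 * f z.2 * oscKernel p l z.1 z.2 ^ 2 := by
    have hA := integrable_fst_mul_oscKernel_sq hp h1 hl hf2
    have hB := integrable_snd_mul_oscKernel_sq hp h1 hl hf2
    have hC := integrable_mul_mul_oscKernel_sq hp h1 hl hf
    have := integral_sub (hA.add hB) (hC.const_mul 2)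
    simp only [Pi.add_apply] at this
    rw [integral_add hA hB, integral_const_mul, integral_fst_mul_oscKernel_sq hp h1 hl hf2,
      integral_snd_mul_oscKernel_sq hp h1 hl hf2] at this
    rw [two_mul (∫ x, f x ^ 2 * _), ← this]
    congr 1; ext z; ring
  have e2 : ∫ x, f x ^ 2 * oscKernel (fun k => p k * (1 - p k)) l x x
      = (∫ x, f x ^ 2 * oscKernel p l x x)
        - ∫ x, f x ^ 2 * oscKernel (fun k => p k ^ 2) l x x := by
    rw [← integral_sub (integrable_mul_self_oscKernel hp hl hf2)
      (integrable_mul_self_oscKernel (hp.sq h1) hl hf2)]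
    congr 1; ext x
    rw [← mul_sub]
    congr 1
    simp only [oscKernel]
    rw [← (summable_oscKernel hp hl x x).tsum_sub (summable_oscKernel (hp.sq h1) hl x x)]
    exact tsum_congr fun k => by ring
  rw [e1, e2]
  ring

theorem sub_sq_mul_eq (f : ℝ → ℝ) (z : ℝ × ℝ) (K : ℝ) :
    (f z.1 - f z.2) ^ 2 * K ^ 2
      = ((f z.1 - f z.2) / (z.1 - z.2)) ^ 2 * ((z.1 - z.2) * K) ^ 2 := by
  by_cases h : z.1 = z.2
  · simp [h]
  · have := sub_ne_zero.2 h
    field_simp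

theorem continuous_sub_mul_oscKernel_sq {p : ℕ → ℝ} (hp : IsRapid p) {l : ℝ} (hl : 0 < l) :
    Continuous fun z : ℝ × ℝ => ((z.1 - z.2) * oscKernel p l z.1 z.2) ^ 2 :=
  ((continuous_fst.sub continuous_snd).mul (continuous_oscKernel hp hl)).pow 2

/-- Outside of the square `|x|, |y| ≤ L`, the double integral of `(f x - f y)² K²` is small when
`f` is supported in `[-R, R]`. -/
theorem setIntegral_sub_sq_mul_oscKernel_sq_le {p : ℕ → ℝ} (hp : IsRapid p) (h1 : ∀ k, |p k| ≤ 1)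
    {l : ℝ} (hl : 0 < l) {f : ℝ → ℝ} (hf : MemLp f 2) {R L M : ℝ} (hRL : R < L)
    (hR : ∀ x, R < |x| → f x = 0)
    (hM : ∀ x, |x| ≤ R → ∫ y, ((x - y) * oscKernel p l x y) ^ 2 ≤ M) :
    ∫ z in (Metric.closedBall (0 : ℝ × ℝ) L)ᶜ, (f z.1 - f z.2) ^ 2 * oscKernel p l z.1 z.2 ^ 2
      ≤ 2 * M * (∫ x, f x ^ 2) / (L - R) ^ 2 := by
  have hf2 := hf.integrable_sq
  set H : ℝ × ℝ → ℝ := fun z => ((z.1 - z.2) * oscKernel p l z.1 z.2) ^ 2 with hH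
  have hHc : Continuous H := continuous_sub_mul_oscKernel_sq hp hl
  have hM' : ∀ x, f x ^ 2 ≠ 0 → ∫ y, H (x, y) ≤ M := fun x hx => by
    refine hM x (not_lt.1 fun h => hx ?_)
    rw [hR x h]; ring
  have hs : ∀ x, Integrable fun y => H (x, y) :=
    fun x => (integral_sub_mul_oscKernel_sq_le hp hl x).1
  have hA : Integrable fun z : ℝ × ℝ => f z.1 ^ 2 * H z :=
    integrable_fst_mul (g := fun x => f x ^ 2) hf2 hHc (fun z => sq_nonneg _) hs hM'
  have hAle : ∫ z : ℝ × ℝ, f z.1 ^ 2 * H z ≤ M * ∫ x, f x ^ 2 :=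
    integral_fst_mul_le (g := fun x => f x ^ 2) hf2 (fun x => sq_nonneg _) hHc
      (fun z => sq_nonneg _) hs hM'
  have hsw : ∀ z : ℝ × ℝ, f z.swap.1 ^ 2 * H z.swap = f z.2 ^ 2 * H z := fun z => by
    simp only [hH, Prod.fst_swap, Prod.snd_swap]
    rw [oscKernel_comm]; ring
  have hB : Integrable fun z : ℝ × ℝ => f z.2 ^ 2 * H z :=
    hA.swap.congr (Eventually.of_forall hsw)
  have hBe : ∫ z : ℝ × ℝ, f z.2 ^ 2 * H z = ∫ z : ℝ × ℝ, f z.1 ^ 2 * H z := by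
    have := integral_prod_swap (μ := (volume : Measure ℝ)) (ν := (volume : Measure ℝ))
      fun z : ℝ × ℝ => f z.1 ^ 2 * H z
    rw [← Measure.volume_eq_prod] at this
    rw [← this]
    exact integral_congr_ae (Eventually.of_forall fun z => (hsw z).symm)
  have hLR : 0 < L - R := by linarith
  have hS := (hA.add hB).const_mul (((L - R) ^ 2)⁻¹)
  have hpt : ∀ z ∈ (Metric.closedBall (0 : ℝ × ℝ) L)ᶜ, (f z.1 - f z.2) ^ 2 *
      oscKernel p l z.1 z.2 ^ 2 ≤ ((L - R) ^ 2)⁻¹ * (f z.1 ^ 2 * H z + f z.2 ^ 2 * H z) := by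
    intro z hz
    -- Outside the square one coordinate a exceeds L, where f vanishes, and the other may be taken
    -- in [-R, R]. Then |a-b| ≥ L-R, so K² is at most (a-b)²K²/(L-R)².
    have hkey : ∀ a b : ℝ, L < |a| → f b ^ 2 * oscKernel p l z.1 z.2 ^ 2
        ≤ ((L - R) ^ 2)⁻¹ * (f b ^ 2 * ((a - b) * oscKernel p l z.1 z.2) ^ 2) := by
      intro a b ha
      by_cases hb : R < |b|
      · simp [hR b hb]
      · have h2 : L - R ≤ |a - b| := by
          have := abs_sub_abs_le_abs_sub a b
          linarith
        have h3 : (L - R) ^ 2 ≤ (a - b) ^ 2 := by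
          rw [← sq_abs (a - b)]; gcongr
        rw [le_inv_mul_iff₀ (by positivity), mul_pow]
        have h4 : 0 ≤ f b ^ 2 * oscKernel p l z.1 z.2 ^ 2 := by positivity
        nlinarith
    have h0 : 0 ≤ ((L - R) ^ 2)⁻¹ := by positivity
    have hH0 : 0 ≤ H z := sq_nonneg _
    rw [Set.mem_compl_iff, Metric.mem_closedBall, dist_zero_right, Prod.norm_def, max_le_iff,
      not_and_or, not_le, not_le, Real.norm_eq_abs, Real.norm_eq_abs] at hz
    rcases hz with hz | hz
    · rw [hR z.1 (hRL.trans hz)]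
      have := hkey z.1 z.2 hz
      have e : (0 - f z.2) ^ 2 = f z.2 ^ 2 := by ring
      rw [e]
      refine this.trans (mul_le_mul_of_nonneg_left ?_ h0)
      simp [hH]
    · rw [hR z.2 (hRL.trans hz)]
      have := hkey z.2 z.1 hz
      rw [show (z.2 - z.1) * oscKernel p l z.1 z.2 = -((z.1 - z.2) * oscKernel p l z.1 z.2) by ring,
        neg_sq] at this
      have e : (f z.1 - 0) ^ 2 = f z.1 ^ 2 := by ring
      rw [e]
      refine this.trans (mul_le_mul_of_nonneg_left ?_ h0)
      simp [hH]
  calc ∫ z in (Metric.closedBall (0 : ℝ × ℝ) L)ᶜ,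
        (f z.1 - f z.2) ^ 2 * oscKernel p l z.1 z.2 ^ 2
      ≤ ∫ z in (Metric.closedBall (0 : ℝ × ℝ) L)ᶜ,
          ((L - R) ^ 2)⁻¹ * (f z.1 ^ 2 * H z + f z.2 ^ 2 * H z) :=
        setIntegral_mono_on (integrable_sub_sq_mul_oscKernel_sq hp h1 hl hf).integrableOn
          hS.integrableOn Metric.isClosed_closedBall.measurableSet.compl hpt
    _ ≤ ∫ z, ((L - R) ^ 2)⁻¹ * (f z.1 ^ 2 * H z + f z.2 ^ 2 * H z) :=
        setIntegral_le_integral hS (Eventually.of_forall fun z => by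
          have : 0 ≤ H z := sq_nonneg _
          simp only [Pi.zero_apply]; positivity)
    _ ≤ 2 * M * (∫ x, f x ^ 2) / (L - R) ^ 2 := by
        rw [integral_const_mul, integral_add hA hB, hBe, div_eq_inv_mul]
        gcongr
        linarith

theorem tendsto_integral_sub_sq_mul_oscKernel_sq {Ψ : ℝ → ℝ} (hΨ : IsExpShape Ψ) {α τ : ℝ}
    (hα0 : 0 < α) (hα1 : α < 1) (hτ : 0 < τ) {f : ℝ → ℝ} (hf : MemLp f 2) {R : ℝ}
    (hR : ∀ x, R < |x| → f x = 0)
    (hI : Integrable fun z : ℝ × ℝ => ((f z.1 - f z.2) / (z.1 - z.2)) ^ 2) :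
    Tendsto (fun N => ∫ z : ℝ × ℝ, (f z.1 - f z.2) ^ 2 *
      oscKernel (shapeWeight Ψ α τ N) (mesoScale α N) z.1 z.2 ^ 2) atTop
      (𝓝 (1 / (2 * Real.pi ^ 2) * ∫ z : ℝ × ℝ, ((f z.1 - f z.2) / (z.1 - z.2)) ^ 2
        * ‖densityChar Ψ τ (z.1 - z.2)‖ ^ 2)) := by
  obtain ⟨M, hM0, hM⟩ := exists_integral_sub_mul_oscKernel_sq_le hΨ hα0 hα1 hτ R
  set I : ℝ × ℝ → ℝ := fun z => ((f z.1 - f z.2) / (z.1 - z.2)) ^ 2 with hIdef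
  set a := ∫ z, I z * ‖densityChar Ψ τ (z.1 - z.2)‖ ^ 2 with ha
  have hc := continuous_densityChar hΨ τ
  have hI1 : Integrable fun z : ℝ × ℝ => I z * ‖densityChar Ψ τ (z.1 - z.2)‖ ^ 2 :=
    hI.mul_bdd (c := (∫ t, shapeDensity Ψ t) ^ 2) (by fun_prop : Continuous fun z : ℝ × ℝ =>
      ‖densityChar Ψ τ (z.1 - z.2)‖ ^ 2).aestronglyMeasurable (Eventually.of_forall fun z => by
        rw [norm_pow, norm_norm]; gcongr; exact norm_densityChar_le hΨ τ _)
  have hlim := ((aecover_closedBall (μ := (volume : Measure (ℝ × ℝ))) (x := (0 : ℝ × ℝ))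
    tendsto_id).integral_tendsto_of_countably_generated hI1).const_mul (1 / (2 * Real.pi ^ 2))
  rw [← ha] at hlim
  have htail : Tendsto (fun L : ℝ => 2 * M * (∫ x, f x ^ 2) / (L - R) ^ 2) atTop (𝓝 0) :=
    tendsto_const_nhds.div_atTop ((tendsto_pow_atTop two_ne_zero).comp
      (tendsto_atTop_add_const_right _ _ tendsto_id))
  rw [Metric.tendsto_nhds]
  intro ε hε
  -- L is fixed before N, which is possible because the tail bound M does not depend on N. The three
  -- thirds are the truncated limit, the tail, and local convergence on the square.
  obtain ⟨L, ⟨hL1, hL2⟩, hL3⟩ := ((((Metric.tendsto_nhds.1 hlim) (ε / 3) (by positivity)).and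
    ((Metric.tendsto_nhds.1 htail) (ε / 3) (by positivity))).and (eventually_gt_atTop R)).exists
  set Q := Metric.closedBall (0 : ℝ × ℝ) L with hQ
  have hQm : MeasurableSet Q := Metric.isClosed_closedBall.measurableSet
  have hloc := tendsto_integral_mul_sub_mul_oscKernel_sq hΨ hα0 hα1 hτ (I := Q.indicator I)
    (hI.indicator hQm) (R := L) (fun z hz => by
      refine Set.indicator_of_notMem (fun h => ?_) _
      rw [hQ, Metric.mem_closedBall, dist_zero_right, Prod.norm_def, max_le_iff,
        Real.norm_eq_abs, Real.norm_eq_abs] at h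
      rcases hz with hz | hz
      · exact absurd h.1 (not_le.2 hz)
      · exact absurd h.2 (not_le.2 hz))
  have hind : ∀ H : ℝ × ℝ → ℝ, ∫ z, Q.indicator I z * H z = ∫ z in Q, I z * H z := fun H => by
    rw [← integral_indicator hQm]
    congr 1; ext z
    by_cases hz : z ∈ Q <;> simp [hz]
  rw [hind fun z => ‖densityChar Ψ τ (z.1 - z.2)‖ ^ 2] at hloc
  filter_upwards [(Metric.tendsto_nhds.1 hloc) (ε / 3) (by positivity), hM,
    eventually_gt_atTop 0] with N hN1 hN2 hN0
  have hp := isRapid_shapeWeight hΨ α hτ hN0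
  have hl := mesoScale_pos α hN0
  have hp1 : ∀ k, |shapeWeight Ψ α τ N k| ≤ 1 := fun k => by
    obtain ⟨b1, b2⟩ := shapeWeight_mem hΨ α τ N k
    rw [abs_of_nonneg b1]; exact b2
  rw [hind fun z => ((z.1 - z.2) *
    oscKernel (shapeWeight Ψ α τ N) (mesoScale α N) z.1 z.2) ^ 2] at hN1
  have hout := setIntegral_sub_sq_mul_oscKernel_sq_le hp hp1 hl hf hL3 hR hN2
  have hout0 : 0 ≤ ∫ z in Qᶜ, (f z.1 - f z.2) ^ 2 *
      oscKernel (shapeWeight Ψ α τ N) (mesoScale α N) z.1 z.2 ^ 2 :=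
    integral_nonneg fun z => by positivity
  have hsplit := integral_add_compl hQm (integrable_sub_sq_mul_oscKernel_sq hp hp1 hl hf)
  simp only [sub_sq_mul_eq f] at hsplit hout hout0 ⊢
  rw [← hsplit]
  simp only [Real.dist_eq, id, abs_lt, sub_zero] at hL1 hL2 hN1 ⊢
  constructor <;> linarith [hL1.1, hL1.2, hL2.2, hN1.1, hN1.2]

/-! ## Moments of linear statistics -/

theorem det_of_fin_one (K : ℝ → ℝ → ℝ) (x : Fin 1 → ℝ) :
    (Matrix.of fun i j => K (x i) (x j)).det = K (x 0) (x 0) := by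
  simp

theorem det_of_fin_two (K : ℝ → ℝ → ℝ) (x : Fin 2 → ℝ) :
    (Matrix.of fun i j => K (x i) (x j)).det
      = K (x 0) (x 0) * K (x 1) (x 1) - K (x 0) (x 1) * K (x 1) (x 0) := by
  simp [Matrix.det_fin_two]

namespace PointProcess

variable {Ω : Type*} [MeasurableSpace Ω]

/-- The linear statistic of an extended nonnegative function. -/
noncomputable def lsum (X : PointProcess Ω) (g : ℝ → ℝ≥0∞) (ω : Ω) : ℝ≥0∞ :=
  ∑' x : X.points ω, g x

theorem countable_points (X : PointProcess Ω) (ω : Ω) : (X.points ω).Countable := by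
  have h : X.points ω = ⋃ n : ℕ, X.points ω ∩ Metric.closedBall 0 n := by
    rw [← Set.inter_iUnion, Metric.iUnion_closedBall_nat, Set.inter_univ]
  rw [h]
  exact Set.countable_iUnion fun n => (X.finite_inter ω _ (isCompact_closedBall _ _)).countable

theorem lsum_eq_lintegral (X : PointProcess Ω) (g : ℝ → ℝ≥0∞) (ω : Ω) :
    X.lsum g ω = ∫⁻ x, g x ∂(Measure.count.restrict (X.points ω)) := by
  rw [lintegral_countable _ (X.countable_points ω)]
  simp [lsum]

/-- Measurability of the counts says that the counting measure of the configuration is a random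
measure; sums over points are its integrals. -/
theorem measurable_lsum (X : PointProcess Ω) {g : ℝ → ℝ≥0∞} (hg : Measurable g) :
    Measurable (X.lsum g) := by
  have h : Measurable fun ω => Measure.count.restrict (X.points ω) := by
    refine Measure.measurable_of_measurable_coe _ fun B hB => ?_
    have e : ∀ ω, Measure.count.restrict (X.points ω) B = ((X.points ω ∩ B).encard : ℝ≥0∞) :=
      fun ω => by
        rw [Measure.restrict_apply hB, Set.inter_comm B,
          Measure.count_apply ((X.countable_points ω).measurableSet.inter hB)]
    simp only [e]
    exact X.measurable_count B hB
  rw [funext (X.lsum_eq_lintegral g)]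
  exact (Measure.measurable_lintegral hg).comp h

/-- Ordered pairs of points split into distinct pairs, governed by the two-point correlation
function, and the diagonal, governed by the one-point function. -/
theorem lsum_mul_lsum (X : PointProcess Ω) (g h : ℝ → ℝ≥0∞) (ω : Ω) :
    X.lsum g ω * X.lsum h ω
      = (∑' x : {x : Fin 2 → ℝ // Function.Injective x ∧ ∀ i, x i ∈ X.points ω},
          g (x.1 0) * h (x.1 1)) + X.lsum (fun x => g x * h x) ω := by
  have e0 : X.lsum g ω * X.lsum h ω
      = ∑' p : X.points ω × X.points ω, g p.1 * h p.2 := by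
    rw [ENNReal.tsum_prod (f := fun a b : X.points ω => g a * h b), lsum, lsum,
      ← ENNReal.tsum_mul_right]
    exact tsum_congr fun a => ENNReal.tsum_mul_left.symm
  have e1 := Summable.tsum_add_tsum_compl (f := fun p : X.points ω × X.points ω => g p.1 * h p.2)
    (s := {p | p.1 ≠ p.2}) ENNReal.summable ENNReal.summable
  rw [e0, ← e1]
  congr 1
  · let e : {x : Fin 2 → ℝ // Function.Injective x ∧ ∀ i, x i ∈ X.points ω}
        ≃ {p : X.points ω × X.points ω | p.1 ≠ p.2} :=
      { toFun := fun x => ⟨(⟨x.1 0, x.2.2 0⟩, ⟨x.1 1, x.2.2 1⟩), fun h => by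
          have h' : x.1 0 = x.1 1 := congrArg Subtype.val h
          exact absurd (x.2.1 h') (by decide)⟩
        invFun := fun p => ⟨![p.1.1, p.1.2], by
          have hp : (p.1.1 : ℝ) ≠ p.1.2 := fun h => p.2 (Subtype.ext h)
          refine ⟨fun i j hij => ?_, fun i => ?_⟩
          · fin_cases i <;> fin_cases j <;> simp_all
          · fin_cases i
            · exact p.1.1.2
            · exact p.1.2.2⟩
        left_inv := fun x => by
          ext i; fin_cases i <;> rfl
        right_inv := fun p => rfl }
    exact (e.tsum_eq fun p : {p : X.points ω × X.points ω | p.1 ≠ p.2} =>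
      g p.1.1 * h p.1.2).symm
  · let e : X.points ω ≃ ({p : X.points ω × X.points ω | p.1 ≠ p.2}ᶜ : Set _) :=
      { toFun := fun x => ⟨(x, x), by simp⟩
        invFun := fun p => p.1.1
        left_inv := fun x => rfl
        right_inv := fun p => by
          have hp : p.1.1 = p.1.2 := not_not.1 p.2
          exact Subtype.ext (Prod.ext rfl hp) }
    exact (e.tsum_eq fun p : ({p : X.points ω × X.points ω | p.1 ≠ p.2}ᶜ : Set _) =>
      g p.1.1 * h p.1.2).symm

/-! ### First and second moments from the correlation functions -/

variable {X : PointProcess Ω} {P : Measure Ω} {K : ℝ → ℝ → ℝ}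

theorem IsDeterminantal.ae_nonneg (h : X.IsDeterminantal P K) : ∀ᵐ x, 0 ≤ K x x := by
  have h1 := (h 1).1
  simp only [det_of_fin_one] at h1
  have hmp := (volume_preserving_funUnique (Fin 1) ℝ).symm
  exact hmp.quasiMeasurePreserving.ae h1

theorem IsDeterminantal.ae_nonneg_two (h : X.IsDeterminantal P K) :
    ∀ᵐ z : ℝ × ℝ, 0 ≤ K z.1 z.1 * K z.2 z.2 - K z.1 z.2 * K z.2 z.1 := by
  have h1 := (h 2).1
  simp only [det_of_fin_two] at h1
  have hmp := (volume_preserving_finTwoArrow ℝ).symm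
  exact hmp.quasiMeasurePreserving.ae h1

theorem IsDeterminantal.lintegral_lsum (h : X.IsDeterminantal P K) {g : ℝ → ℝ≥0∞}
    (hg : Measurable g) : ∫⁻ ω, X.lsum g ω ∂P = ∫⁻ x, g x * ENNReal.ofReal (K x x) := by
  have h1 := (h 1).2 (fun x => g (x 0)) (hg.comp (measurable_pi_apply 0))
  simp only [det_of_fin_one] at h1
  have e1 : ∀ ω, X.lsum g ω = ∑' x : {x : Fin 1 → ℝ // Function.Injective x ∧
      ∀ i, x i ∈ X.points ω}, g (x.1 0) := fun ω => by
    let e : {x : Fin 1 → ℝ // Function.Injective x ∧ ∀ i, x i ∈ X.points ω} ≃ X.points ω :=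
      { toFun := fun x => ⟨x.1 0, x.2.2 0⟩
        invFun := fun p => ⟨fun _ => p, Function.injective_of_subsingleton _, fun _ => p.2⟩
        left_inv := fun x => by ext i; fin_cases i; rfl
        right_inv := fun p => rfl }
    exact (e.tsum_eq fun p : X.points ω => g p).symm
  simp only [e1, h1]
  exact (volume_preserving_funUnique (Fin 1) ℝ).lintegral_comp_emb
    (MeasurableEquiv.measurableEmbedding _) fun x => g x * ENNReal.ofReal (K x x)

theorem IsDeterminantal.lintegral_lsum_mul (h : X.IsDeterminantal P K) {u v : ℝ → ℝ≥0∞}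
    (hu : Measurable u) (hv : Measurable v) :
    ∫⁻ ω, X.lsum u ω * X.lsum v ω ∂P
      = (∫⁻ z : ℝ × ℝ, u z.1 * v z.2 *
          ENNReal.ofReal (K z.1 z.1 * K z.2 z.2 - K z.1 z.2 * K z.2 z.1))
        + ∫⁻ x, u x * v x * ENNReal.ofReal (K x x) := by
  simp only [lsum_mul_lsum]
  have huv : Measurable fun x => u x * v x := hu.mul hv
  rw [lintegral_add_right _ (X.measurable_lsum huv), h.lintegral_lsum huv]
  congr 1
  have h1 := (h 2).2 (fun x => u (x 0) * v (x 1))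
    ((hu.comp (measurable_pi_apply 0)).mul (hv.comp (measurable_pi_apply 1)))
  simp only [det_of_fin_two] at h1
  rw [h1]
  exact (volume_preserving_finTwoArrow ℝ).lintegral_comp_emb
    (MeasurableEquiv.measurableEmbedding _) fun z : ℝ × ℝ => u z.1 * v z.2 *
      ENNReal.ofReal (K z.1 z.1 * K z.2 z.2 - K z.1 z.2 * K z.2 z.1)

theorem finite_support_points (X : PointProcess Ω) {f : ℝ → ℝ} (hf : HasCompactSupport f) (ω : Ω) :
    (Function.support fun x : X.points ω => f x).Finite := by
  refine Set.Finite.of_finite_image (f := Subtype.val) ?_ Subtype.val_injective.injOn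
  refine (X.finite_inter ω _ hf).subset ?_
  rintro _ ⟨x, hx, rfl⟩
  exact ⟨x.2, subset_tsupport f hx⟩

theorem linearStatistic_eq_tsum (X : PointProcess Ω) {f : ℝ → ℝ} (hf : HasCompactSupport f)
    (ω : Ω) : X.linearStatistic f ω = ∑' x : X.points ω, f x := by
  rw [tsum_eq_finsum (X.finite_support_points hf ω), linearStatistic,
    finsum_subtype_eq_finsum_cond]

theorem linearStatistic_sub (X : PointProcess Ω) {f g : ℝ → ℝ} (hf : HasCompactSupport f)
    (hg : HasCompactSupport g) (ω : Ω) :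
    X.linearStatistic (fun x => f x - g x) ω = X.linearStatistic f ω - X.linearStatistic g ω := by
  rw [linearStatistic_eq_tsum X hf, linearStatistic_eq_tsum X hg,
    linearStatistic_eq_tsum X (f := fun x => f x - g x) (hf.sub hg)]
  exact (summable_of_hasFiniteSupport (X.finite_support_points hf ω)).tsum_sub
    (summable_of_hasFiniteSupport (X.finite_support_points hg ω))

theorem linearStatistic_eq_toReal (X : PointProcess Ω) {f : ℝ → ℝ} (hf : HasCompactSupport f)
    (h0 : ∀ x, 0 ≤ f x) :
    X.linearStatistic f = fun ω => (X.lsum (fun x => ENNReal.ofReal (f x)) ω).toReal := by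
  ext ω
  rw [linearStatistic_eq_tsum X hf, lsum, ENNReal.tsum_toReal_eq fun x => ENNReal.ofReal_ne_top]
  simp only [ENNReal.toReal_ofReal (h0 _)]

theorem measurable_linearStatistic (X : PointProcess Ω) {f : ℝ → ℝ} (hf : HasCompactSupport f)
    (h0 : ∀ x, 0 ≤ f x) (hm : Measurable f) : Measurable (X.linearStatistic f) := by
  rw [linearStatistic_eq_toReal X hf h0]
  exact (X.measurable_lsum hm.ennreal_ofReal).ennreal_toReal

theorem integral_toReal_of_lintegral_eq {α β : Type*} [MeasurableSpace α] [MeasurableSpace β]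
    {μ : Measure α} {ν : Measure β} {F : α → ℝ≥0∞} {G : β → ℝ} (hF : Measurable F)
    (hG : Integrable G ν) (hG0 : 0 ≤ᵐ[ν] G)
    (h : ∫⁻ a, F a ∂μ = ∫⁻ b, ENNReal.ofReal (G b) ∂ν) :
    Integrable (fun a => (F a).toReal) μ ∧ ∫ a, (F a).toReal ∂μ = ∫ b, G b ∂ν := by
  have hne : ∫⁻ a, F a ∂μ ≠ ∞ := by
    rw [h]; exact hG.lintegral_lt_top.ne
  refine ⟨integrable_toReal_of_lintegral_ne_top hF.aemeasurable hne, ?_⟩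
  rw [integral_toReal hF.aemeasurable (ae_lt_top hF hne), h,
    integral_eq_lintegral_of_nonneg_ae hG0 hG.aestronglyMeasurable]

theorem IsDeterminantal.integral_linearStatistic (h : X.IsDeterminantal P K) {f : ℝ → ℝ}
    (hf : HasCompactSupport f) (h0 : ∀ x, 0 ≤ f x) (hm : Measurable f)
    (hi : Integrable fun x => f x * K x x) :
    Integrable (X.linearStatistic f) P ∧
      ∫ ω, X.linearStatistic f ω ∂P = ∫ x, f x * K x x := by
  rw [linearStatistic_eq_toReal X hf h0]
  refine integral_toReal_of_lintegral_eq (X.measurable_lsum hm.ennreal_ofReal) hi ?_ ?_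
  · filter_upwards [h.ae_nonneg] with x hx using mul_nonneg (h0 x) hx
  · rw [h.lintegral_lsum hm.ennreal_ofReal]
    simp only [ENNReal.ofReal_mul (h0 _)]

theorem IsDeterminantal.integral_linearStatistic_mul (h : X.IsDeterminantal P K) {u v : ℝ → ℝ}
    (hu : HasCompactSupport u) (hu0 : ∀ x, 0 ≤ u x) (hum : Measurable u)
    (hv : HasCompactSupport v) (hv0 : ∀ x, 0 ≤ v x) (hvm : Measurable v)
    (hi2 : Integrable fun z : ℝ × ℝ => u z.1 * v z.2 *
      (K z.1 z.1 * K z.2 z.2 - K z.1 z.2 * K z.2 z.1))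
    (hi1 : Integrable fun x => u x * v x * K x x) :
    Integrable (fun ω => X.linearStatistic u ω * X.linearStatistic v ω) P ∧
      ∫ ω, X.linearStatistic u ω * X.linearStatistic v ω ∂P
        = (∫ z : ℝ × ℝ, u z.1 * v z.2 * (K z.1 z.1 * K z.2 z.2 - K z.1 z.2 * K z.2 z.1))
          + ∫ x, u x * v x * K x x := by
  set F : Ω → ℝ≥0∞ := fun ω => X.lsum (fun x => ENNReal.ofReal (u x)) ω *
    X.lsum (fun x => ENNReal.ofReal (v x)) ω with hF
  have hFm : Measurable F :=
    (X.measurable_lsum hum.ennreal_ofReal).mul (X.measurable_lsum hvm.ennreal_ofReal)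
  have e : (fun ω => X.linearStatistic u ω * X.linearStatistic v ω) = fun ω => (F ω).toReal := by
    ext ω
    rw [linearStatistic_eq_toReal X hu hu0, linearStatistic_eq_toReal X hv hv0, hF,
      ENNReal.toReal_mul]
  have hp2 : 0 ≤ᵐ[volume] fun z : ℝ × ℝ => u z.1 * v z.2 *
      (K z.1 z.1 * K z.2 z.2 - K z.1 z.2 * K z.2 z.1) := by
    filter_upwards [h.ae_nonneg_two] with z hz using
      mul_nonneg (mul_nonneg (hu0 _) (hv0 _)) hz
  have hp1 : 0 ≤ᵐ[volume] fun x => u x * v x * K x x := by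
    filter_upwards [h.ae_nonneg] with x hx using mul_nonneg (mul_nonneg (hu0 _) (hv0 _)) hx
  have hlin : ∫⁻ ω, F ω ∂P = (∫⁻ z : ℝ × ℝ, ENNReal.ofReal (u z.1 * v z.2 *
      (K z.1 z.1 * K z.2 z.2 - K z.1 z.2 * K z.2 z.1)))
        + ∫⁻ x, ENNReal.ofReal (u x * v x * K x x) := by
    rw [h.lintegral_lsum_mul hum.ennreal_ofReal hvm.ennreal_ofReal]
    simp only [ENNReal.ofReal_mul (mul_nonneg (hu0 _) (hv0 _)), ENNReal.ofReal_mul (hu0 _)]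
  have hne : ∫⁻ ω, F ω ∂P ≠ ∞ := by
    rw [hlin]; exact ENNReal.add_ne_top.2 ⟨hi2.lintegral_lt_top.ne, hi1.lintegral_lt_top.ne⟩
  have e' : ∫ ω, X.linearStatistic u ω * X.linearStatistic v ω ∂P = ∫ ω, (F ω).toReal ∂P := by
    rw [e]
  rw [e', e]
  refine ⟨integrable_toReal_of_lintegral_ne_top hFm.aemeasurable hne, ?_⟩
  rw [integral_toReal hFm.aemeasurable (ae_lt_top hFm hne), hlin,
    ENNReal.toReal_add hi2.lintegral_lt_top.ne hi1.lintegral_lt_top.ne,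
    integral_eq_lintegral_of_nonneg_ae hp2 hi2.aestronglyMeasurable,
    integral_eq_lintegral_of_nonneg_ae hp1 hi1.aestronglyMeasurable]

end PointProcess

theorem integrable_of_memLp_two_of_hasCompactSupport {f : ℝ → ℝ} (hf : MemLp f 2)
    (hc : HasCompactSupport f) : Integrable f := by
  have hfin : IsFiniteMeasure ((volume : Measure ℝ).restrict (tsupport f)) :=
    isFiniteMeasure_restrict.2 (IsCompact.measure_ne_top hc)
  have h1 : IntegrableOn f (tsupport f) := (hf.restrict (tsupport f)).integrable one_le_two
  exact (integrableOn_iff_integrable_of_support_subset (subset_tsupport f)).1 h1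

theorem integral_sub_sub_sub {α : Type*} [MeasurableSpace α] {μ : Measure α} {a b c d : α → ℝ}
    (ha : Integrable a μ) (hb : Integrable b μ) (hc : Integrable c μ) (hd : Integrable d μ) :
    (∫ x, a x ∂μ) - (∫ x, b x ∂μ) - ((∫ x, c x ∂μ) - ∫ x, d x ∂μ)
      = ∫ x, (a x - b x - (c x - d x)) ∂μ := by
  have h1 : Integrable (fun x => a x - b x) μ := ha.sub hb
  have h2 : Integrable (fun x => c x - d x) μ := hc.sub hd
  rw [← integral_sub ha hb, ← integral_sub hc hd, ← integral_sub h1 h2]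

namespace PointProcess

variable {Ω : Type*} [MeasurableSpace Ω] {X : PointProcess Ω} {P : Measure Ω} {K : ℝ → ℝ → ℝ}

/-- The expected number of points in a null set is 0. This allows the test function to be replaced
by a Borel representative. -/
theorem IsDeterminantal.linearStatistic_congr_ae (h : X.IsDeterminantal P K) {f g : ℝ → ℝ}
    (hfg : f =ᵐ[volume] g) : X.linearStatistic f =ᵐ[P] X.linearStatistic g := by
  obtain ⟨N, hN, hNm, hN0⟩ := exists_measurable_superset_of_null hfg
  have hg : Measurable (N.indicator (1 : ℝ → ℝ≥0∞)) := measurable_one.indicator hNm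
  have h1 := h.lintegral_lsum hg
  have h2 : ∫⁻ x, N.indicator (1 : ℝ → ℝ≥0∞) x * ENNReal.ofReal (K x x) = 0 := by
    refine (lintegral_congr_ae ?_).trans lintegral_zero
    filter_upwards [compl_mem_ae_iff.2 hN0] with x hx
    rw [Set.indicator_of_notMem hx, zero_mul]
  rw [h2, lintegral_eq_zero_iff (X.measurable_lsum hg)] at h1
  filter_upwards [h1] with ω hω
  refine finsum_mem_congr rfl fun x hx => ?_
  by_contra hne
  have h3 : N.indicator (1 : ℝ → ℝ≥0∞) x = 0 :=
    ENNReal.tsum_eq_zero.1 hω (⟨x, hx⟩ : X.points ω)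
  rw [Set.indicator_of_mem (hN hne)] at h3
  exact one_ne_zero h3

/-- The correlation identities concern nonnegative functions, so f is split into positive and
negative parts and the four mixed second moments are recombined. The product K(x,x)K(y,y) in the
two-point function cancels the square of the mean. -/
theorem IsDeterminantal.variance_linearStatistic_of_measurable [IsProbabilityMeasure P]
    (h : X.IsDeterminantal P K) (hK : Continuous fun z : ℝ × ℝ => K z.1 z.2)
    (hsym : ∀ x y, K x y = K y x) {C : ℝ} (hC : ∀ x y, |K x y| ≤ C) {f : ℝ → ℝ}
    (hf : MemLp f 2) (hc : HasCompactSupport f) (hm : Measurable f) :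
    MemLp (X.linearStatistic f) 2 P ∧ variance (X.linearStatistic f) P
      = (∫ x, f x ^ 2 * K x x) - ∫ z : ℝ × ℝ, f z.1 * f z.2 * K z.1 z.2 ^ 2 := by
  have hC0 : 0 ≤ C := (abs_nonneg _).trans (hC 0 0)
  have hKd : Continuous fun x => K x x := hK.comp (continuous_id.prodMk continuous_id)
  set ρ : ℝ × ℝ → ℝ := fun z => K z.1 z.1 * K z.2 z.2 - K z.1 z.2 * K z.2 z.1 with hρ
  have hρc : Continuous ρ := by
    have h1 : Continuous fun z : ℝ × ℝ => K z.2 z.1 := hK.comp continuous_swap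
    exact ((hKd.comp continuous_fst).mul (hKd.comp continuous_snd)).sub (hK.mul h1)
  have hρb : ∀ z, ‖ρ z‖ ≤ C * C + C * C := fun z => by
    refine (norm_sub_le _ _).trans ?_
    rw [norm_mul, norm_mul]
    simp only [Real.norm_eq_abs]
    gcongr <;> exact hC _ _
  have I2 : ∀ a b : ℝ → ℝ, Integrable a → Integrable b →
      Integrable fun z : ℝ × ℝ => a z.1 * b z.2 * ρ z := fun a b ha hb =>
    (ha.mul_prod hb).mul_bdd hρc.aestronglyMeasurable (Eventually.of_forall hρb)
  have I1 : ∀ a : ℝ → ℝ, Integrable a → Integrable fun x => a x * K x x := fun a ha =>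
    ha.mul_bdd (c := C) hKd.aestronglyMeasurable (Eventually.of_forall fun x => hC x x)
  obtain ⟨u, hu⟩ : ∃ u : ℝ → ℝ, u = fun x => max (f x) 0 := ⟨_, rfl⟩
  obtain ⟨v, hv⟩ : ∃ v : ℝ → ℝ, v = fun x => max (-f x) 0 := ⟨_, rfl⟩
  have hfuv : f = fun x => u x - v x := by
    ext x
    rw [hu, hv]
    rcases le_total 0 (f x) with h0 | h0
    · simp [h0]
    · simp [h0]
  have huc : HasCompactSupport u := hc.mono fun x hx hfx => hx (by simp [hu, hfx])
  have hvc : HasCompactSupport v := hc.mono fun x hx hfx => hx (by simp [hv, hfx])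
  have hu0 : ∀ x, 0 ≤ u x := fun x => by rw [hu]; exact le_max_right _ _
  have hv0 : ∀ x, 0 ≤ v x := fun x => by rw [hv]; exact le_max_right _ _
  have hum : Measurable u := by rw [hu]; fun_prop
  have hvm : Measurable v := by rw [hv]; fun_prop
  have hu2 : MemLp u 2 := hf.mono hum.aestronglyMeasurable (Eventually.of_forall fun x => by
    rw [hu, Real.norm_eq_abs, Real.norm_eq_abs]
    exact abs_le.2 ⟨(neg_nonpos.2 (abs_nonneg _)).trans (le_max_right _ _),
      max_le (le_abs_self _) (abs_nonneg _)⟩)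
  have hv2 : MemLp v 2 := hf.mono hvm.aestronglyMeasurable (Eventually.of_forall fun x => by
    rw [hv, Real.norm_eq_abs, Real.norm_eq_abs]
    exact abs_le.2 ⟨(neg_nonpos.2 (abs_nonneg _)).trans (le_max_right _ _),
      max_le (neg_le_abs _) (abs_nonneg _)⟩)
  have hui := integrable_of_memLp_two_of_hasCompactSupport hu2 huc
  have hvi := integrable_of_memLp_two_of_hasCompactSupport hv2 hvc
  have hfi := integrable_of_memLp_two_of_hasCompactSupport hf hc
  obtain ⟨m1i, m1⟩ := h.integral_linearStatistic huc hu0 hum (I1 u hui)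
  obtain ⟨m2i, m2⟩ := h.integral_linearStatistic hvc hv0 hvm (I1 v hvi)
  have Iuu := I1 _ (hu2.integrable_mul hu2)
  have Iuv := I1 _ (hu2.integrable_mul hv2)
  have Ivu := I1 _ (hv2.integrable_mul hu2)
  have Ivv := I1 _ (hv2.integrable_mul hv2)
  have Juu := I2 _ _ hui hui
  have Juv := I2 _ _ hui hvi
  have Jvu := I2 _ _ hvi hui
  have Jvv := I2 _ _ hvi hvi
  obtain ⟨n1i, n1⟩ := h.integral_linearStatistic_mul huc hu0 hum huc hu0 hum Juu Iuu
  obtain ⟨n2i, n2⟩ := h.integral_linearStatistic_mul huc hu0 hum hvc hv0 hvm Juv Iuv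
  obtain ⟨n3i, n3⟩ := h.integral_linearStatistic_mul hvc hv0 hvm huc hu0 hum Jvu Ivu
  obtain ⟨n4i, n4⟩ := h.integral_linearStatistic_mul hvc hv0 hvm hvc hv0 hvm Jvv Ivv
  have hS : X.linearStatistic f = fun ω => X.linearStatistic u ω - X.linearStatistic v ω := by
    ext ω
    rw [← linearStatistic_sub X huc hvc, ← hfuv]
  have hSu := measurable_linearStatistic X huc hu0 hum
  have hSv := measurable_linearStatistic X hvc hv0 hvm
  have hSm : MemLp (X.linearStatistic f) 2 P := by
    have a1 : MemLp (X.linearStatistic u) 2 P :=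
      (memLp_two_iff_integrable_sq hSu.aestronglyMeasurable).2 (by simpa only [sq] using n1i)
    have a2 : MemLp (X.linearStatistic v) 2 P :=
      (memLp_two_iff_integrable_sq hSv.aestronglyMeasurable).2 (by simpa only [sq] using n4i)
    rw [hS]
    exact a1.sub a2
  refine ⟨hSm, ?_⟩
  have E1 : ∫ ω, X.linearStatistic f ω ∂P = ∫ x, f x * K x x := by
    rw [hS, integral_sub m1i m2i, m1, m2, ← integral_sub (I1 u hui) (I1 v hvi)]
    congr 1; ext x
    rw [hfuv]; ring
  have E2 : ∫ ω, X.linearStatistic f ω ^ 2 ∂P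
      = (∫ z : ℝ × ℝ, f z.1 * f z.2 * ρ z) + ∫ x, f x ^ 2 * K x x := by
    have e1 : ∫ ω, X.linearStatistic f ω ^ 2 ∂P
        = ((∫ ω, X.linearStatistic u ω * X.linearStatistic u ω ∂P)
          - ∫ ω, X.linearStatistic u ω * X.linearStatistic v ω ∂P)
          - ((∫ ω, X.linearStatistic v ω * X.linearStatistic u ω ∂P)
          - ∫ ω, X.linearStatistic v ω * X.linearStatistic v ω ∂P) := by
      rw [integral_sub_sub_sub n1i n2i n3i n4i, hS]
      congr 1; ext ω; ring
    have e2 : ∫ z : ℝ × ℝ, f z.1 * f z.2 * ρ z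
        = ((∫ z : ℝ × ℝ, u z.1 * u z.2 * ρ z) - ∫ z : ℝ × ℝ, u z.1 * v z.2 * ρ z)
          - ((∫ z : ℝ × ℝ, v z.1 * u z.2 * ρ z) - ∫ z : ℝ × ℝ, v z.1 * v z.2 * ρ z) := by
      rw [integral_sub_sub_sub Juu Juv Jvu Jvv, hfuv]
      congr 1; ext z; ring
    have e3 : ∫ x, f x ^ 2 * K x x
        = ((∫ x, u x * u x * K x x) - ∫ x, u x * v x * K x x)
          - ((∫ x, v x * u x * K x x) - ∫ x, v x * v x * K x x) := by
      refine Eq.trans ?_ (integral_sub_sub_sub Iuu Iuv Ivu Ivv).symm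
      rw [hfuv]
      congr 1; ext x
      simp only [Pi.mul_apply]; ring
    rw [e1, n1, n2, n3, n4, e2, e3]
    ring
  have E3 : ∫ z : ℝ × ℝ, f z.1 * f z.2 * ρ z
      = (∫ x, f x * K x x) ^ 2 - ∫ z : ℝ × ℝ, f z.1 * f z.2 * K z.1 z.2 ^ 2 := by
    have j1 : Integrable fun z : ℝ × ℝ => (f z.1 * K z.1 z.1) * (f z.2 * K z.2 z.2) :=
      (I1 f hfi).mul_prod (I1 f hfi)
    have j2 : Integrable fun z : ℝ × ℝ => f z.1 * f z.2 * K z.1 z.2 ^ 2 :=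
      (hfi.mul_prod hfi).mul_bdd (c := C ^ 2) (hK.pow 2).aestronglyMeasurable
        (Eventually.of_forall fun z => by
          rw [norm_pow, Real.norm_eq_abs]; gcongr; exact hC _ _)
    have j3 : (∫ x, f x * K x x) ^ 2
        = ∫ z : ℝ × ℝ, (f z.1 * K z.1 z.1) * (f z.2 * K z.2 z.2) := by
      rw [sq]
      exact (integral_prod_mul (μ := (volume : Measure ℝ)) (ν := (volume : Measure ℝ))
        (fun x => f x * K x x) fun x => f x * K x x).symm
    rw [j3, ← integral_sub j1 j2]
    congr 1; ext z
    simp only [hρ]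
    rw [hsym z.2 z.1]; ring
  have hv := variance_eq_sub hSm
  simp only [Pi.pow_apply] at hv
  rw [hv, E1, E2, E3]
  ring

theorem IsDeterminantal.variance_linearStatistic [IsProbabilityMeasure P]
    (h : X.IsDeterminantal P K) (hK : Continuous fun z : ℝ × ℝ => K z.1 z.2)
    (hsym : ∀ x y, K x y = K y x) {C : ℝ} (hC : ∀ x y, |K x y| ≤ C) {f : ℝ → ℝ}
    (hf : MemLp f 2) (hc : HasCompactSupport f) :
    MemLp (X.linearStatistic f) 2 P ∧ variance (X.linearStatistic f) P
      = (∫ x, f x ^ 2 * K x x) - ∫ z : ℝ × ℝ, f z.1 * f z.2 * K z.1 z.2 ^ 2 := by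
  set g : ℝ → ℝ := (tsupport f).indicator (hf.1.mk f) with hg
  have hgm : Measurable g :=
    hf.1.stronglyMeasurable_mk.measurable.indicator (isClosed_tsupport f).measurableSet
  have hfg : f =ᵐ[volume] g := by
    filter_upwards [hf.1.ae_eq_mk] with x hx
    by_cases hxs : x ∈ tsupport f
    · rw [hg, Set.indicator_of_mem hxs, ← hx]
    · rw [hg, Set.indicator_of_notMem hxs, image_eq_zero_of_notMem_tsupport hxs]
  have hgc : HasCompactSupport g := HasCompactSupport.intro hc fun x hx => by
    rw [hg, Set.indicator_of_notMem hx]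
  obtain ⟨h1, h2⟩ := h.variance_linearStatistic_of_measurable hK hsym hC (hf.ae_eq hfg) hgc hgm
  have hcong := h.linearStatistic_congr_ae hfg
  refine ⟨h1.ae_eq hcong.symm, ?_⟩
  rw [variance_congr hcong, h2]
  congr 1
  · refine integral_congr_ae ?_
    filter_upwards [hfg] with x hx
    rw [hx]
  · refine integral_congr_ae ?_
    have a1 : ∀ᵐ z : ℝ × ℝ, f z.1 = g z.1 := Measure.quasiMeasurePreserving_fst.ae hfg
    have a2 : ∀ᵐ z : ℝ × ℝ, f z.2 = g z.2 := Measure.quasiMeasurePreserving_snd.ae hfg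
    filter_upwards [a1, a2] with z h1 h2
    rw [h1, h2]

end PointProcess

/-! ## The variance of a mesoscopic linear statistic -/

theorem modifiedGUEKernel_eq (Ψ : ℝ → ℝ) (α τ N x y : ℝ) :
    modifiedGUEKernel Ψ α τ N x y = oscKernel (shapeWeight Ψ α τ N) (microScale N) x y := by
  simp only [modifiedGUEKernel, oscKernel, shapeWeight, rescaledHermite, oscFun, microScale,
    mul_comm x, mul_comm y]

/-- Homogeneity of the kernel; with a = N^α it moves the dilation of the test function into the
passage from `microScale` to `mesoScale`. -/
theorem oscKernel_mul_right (p : ℕ → ℝ) (l : ℝ) {a : ℝ} (ha : 0 ≤ a) (x y : ℝ) :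
    oscKernel p (l * a) x y = a * oscKernel p l (a * x) (a * y) := by
  simp only [oscKernel, ← tsum_mul_left]
  refine tsum_congr fun k => ?_
  simp only [oscFun]
  rw [Real.sqrt_mul' _ ha, mul_assoc l a x, mul_assoc l a y]
  have h := Real.mul_self_sqrt ha
  calc _ = p k * (√l * hermiteFun k (l * (a * x))) * (√l * hermiteFun k (l * (a * y)))
        * (√a * √a) := by ring
    _ = _ := by rw [h]; ring

theorem integral_rescale_mul_oscKernel (p : ℕ → ℝ) (l : ℝ) {a : ℝ} (ha : 0 < a) (F : ℝ → ℝ) :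
    ∫ x, F (a * x) * oscKernel p (l * a) x x = ∫ x, F x * oscKernel p l x x := by
  have h := Measure.integral_comp_mul_left (fun x => F x * oscKernel p l x x) a
  have e : ∫ x, F (a * x) * oscKernel p (l * a) x x
      = a * ∫ x, F (a * x) * oscKernel p l (a * x) (a * x) := by
    rw [← integral_const_mul]
    congr 1; ext x
    rw [oscKernel_mul_right p l ha.le]; ring
  rw [e, h, abs_of_pos (inv_pos.2 ha), smul_eq_mul, mul_inv_cancel_left₀ ha.ne']

theorem integral_prod_rescale_mul_oscKernel_sq (p : ℕ → ℝ) (l : ℝ) {a : ℝ} (ha : 0 < a)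
    (F : ℝ → ℝ → ℝ) :
    ∫ z : ℝ × ℝ, F (a * z.1) (a * z.2) * oscKernel p (l * a) z.1 z.2 ^ 2
      = ∫ z : ℝ × ℝ, F z.1 z.2 * oscKernel p l z.1 z.2 ^ 2 := by
  have h := Measure.integral_comp_smul (volume : Measure (ℝ × ℝ))
    (fun z => F z.1 z.2 * oscKernel p l z.1 z.2 ^ 2) a
  have e : ∫ z : ℝ × ℝ, F (a * z.1) (a * z.2) * oscKernel p (l * a) z.1 z.2 ^ 2
      = a ^ 2 * ∫ z : ℝ × ℝ, F (a • z).1 (a • z).2 * oscKernel p l (a • z).1 (a • z).2 ^ 2 := by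
    rw [← integral_const_mul]
    congr 1; ext z
    rw [oscKernel_mul_right p l ha.le, Prod.smul_fst, Prod.smul_snd, smul_eq_mul, smul_eq_mul]
    ring
  have hr : Module.finrank ℝ (ℝ × ℝ) = 2 := by simp
  rw [e, h, hr, abs_of_pos (by positivity), smul_eq_mul, mul_inv_cancel_left₀ (by positivity)]

theorem memLp_rescaledTest {f : ℝ → ℝ} (hf : MemLp f 2) (α : ℝ) {N : ℝ} (hN : 0 < N) :
    MemLp (rescaledTest f α N) 2 := by
  have ha := Real.rpow_pos_of_pos hN α
  have hm : AEStronglyMeasurable (rescaledTest f α N) volume :=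
    (hf.1.comp_quasiMeasurePreserving (Measure.quasiMeasurePreserving_smul volume ha.ne')).congr
      (Eventually.of_forall fun x => by simp [rescaledTest, mul_comm x])
  rw [memLp_two_iff_integrable_sq hm]
  exact hf.integrable_sq.comp_mul_right' ha.ne'

theorem hasCompactSupport_rescaledTest {f : ℝ → ℝ} (hf : HasCompactSupport f) (α : ℝ) {N : ℝ}
    (hN : 0 < N) : HasCompactSupport (rescaledTest f α N) :=
  hf.comp_homeomorph (Homeomorph.mulRight₀ (N ^ α) (Real.rpow_pos_of_pos hN α).ne')

theorem variance_rescaledTest {Ψ : ℝ → ℝ} (hΨ : IsExpShape Ψ) {f : ℝ → ℝ} (hf : MemLp f 2)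
    (hc : HasCompactSupport f) {α τ N : ℝ} (hτ : 0 < τ) (hN : 0 < N)
    {Ω : Type*} [MeasurableSpace Ω] {P : Measure Ω} [IsProbabilityMeasure P] {X : PointProcess Ω}
    (hX : X.IsDeterminantal P (modifiedGUEKernel Ψ α τ N)) :
    MemLp (X.linearStatistic (rescaledTest f α N)) 2 P ∧
    variance (X.linearStatistic (rescaledTest f α N)) P
      = (∫ x, f x ^ 2 * oscKernel (fun k => shapeWeight Ψ α τ N k * (1 - shapeWeight Ψ α τ N k))
          (mesoScale α N) x x)
        + 1 / 2 * ∫ z : ℝ × ℝ, (f z.1 - f z.2) ^ 2 *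
          oscKernel (shapeWeight Ψ α τ N) (mesoScale α N) z.1 z.2 ^ 2 := by
  have ha := Real.rpow_pos_of_pos hN α
  have hp := isRapid_shapeWeight hΨ α hτ hN
  have hm := mesoScale_pos α hN
  have hl : 0 < microScale N := by rw [← mesoScale_mul_rpow α hN]; positivity
  have hp1 : ∀ k, |shapeWeight Ψ α τ N k| ≤ 1 := fun k => by
    obtain ⟨b1, b2⟩ := shapeWeight_mem hΨ α τ N k
    rw [abs_of_nonneg b1]; exact b2
  obtain ⟨C, _, hC⟩ := exists_abs_oscKernel_le hp hl
  have hK : modifiedGUEKernel Ψ α τ N = oscKernel (shapeWeight Ψ α τ N) (microScale N) := by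
    ext x y; exact modifiedGUEKernel_eq Ψ α τ N x y
  rw [hK] at hX
  obtain ⟨h1, h2⟩ := hX.variance_linearStatistic (continuous_oscKernel hp hl) (oscKernel_comm _ _)
    hC (memLp_rescaledTest hf α hN) (hasCompactSupport_rescaledTest hc α hN)
  refine ⟨h1, ?_⟩
  rw [h2, ← variance_functional_eq hp hp1 hm hf, ← mesoScale_mul_rpow α hN,
    ← integral_rescale_mul_oscKernel _ (mesoScale α N) ha (fun x => f x ^ 2),
    ← integral_prod_rescale_mul_oscKernel_sq _ (mesoScale α N) ha (fun x y => f x * f y)]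
  simp only [rescaledTest, mul_comm _ (N ^ α)]

/-! ## Plancherel's theorem for integrable square integrable functions -/

theorem continuous_fourier_of_integrable {f : ℝ → ℂ} (h1 : Integrable f) : Continuous (𝓕 f) :=
  VectorFourier.fourierIntegral_continuous Real.continuous_fourierChar
    (by exact continuous_inner) h1

/-- Both sides define the same distribution: against a smooth compactly supported test function,
each moves the transform onto the test function. This carries the L² isometry over to the Fourier
integral. -/
theorem fourier_toLp_ae_eq {f : ℝ → ℂ} (h1 : Integrable f) (h2 : MemLp f 2) :
    (𝓕 (h2.toLp f) : Lp ℂ 2 (volume : Measure ℝ)) =ᵐ[volume] 𝓕 f := by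
  refine ae_eq_of_integral_contDiff_smul_eq
    ((Lp.memLp (𝓕 (h2.toLp f) : Lp ℂ 2 (volume : Measure ℝ))).locallyIntegrable one_le_two)
    (continuous_fourier_of_integrable h1).locallyIntegrable fun g hg hgc => ?_
  have hg₁ : HasCompactSupport (Complex.ofRealCLM ∘ g) := hgc.comp_left rfl
  have hg₂ : ContDiff ℝ (⊤ : ℕ∞) (Complex.ofRealCLM ∘ g) := Complex.ofRealCLM.contDiff.comp hg
  set G : SchwartzMap ℝ ℂ := hg₁.toSchwartzMap hg₂ with hG
  have hGg : ∀ x, G x = (g x : ℂ) := fun x => rfl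
  have e1 := DFunLike.congr_fun (Lp.fourier_toTemperedDistribution_eq (h2.toLp f)) G
  rw [TemperedDistribution.fourier_apply, Lp.toTemperedDistribution_apply,
    Lp.toTemperedDistribution_apply] at e1
  have e2 : ∫ x, (𝓕 G) x • (h2.toLp f) x = ∫ x, (𝓕 (G : ℝ → ℂ)) x • f x := by
    refine integral_congr_ae ?_
    filter_upwards [h2.coeFn_toLp] with x hx
    rw [hx, SchwartzMap.fourier_coe]
  have e3 : ∫ x, (𝓕 (G : ℝ → ℂ)) x • f x = ∫ x, G x • (𝓕 f) x := by
    simpa using! (VectorFourier.integral_fourierIntegral_smul_eq_flip (L := innerₗ ℝ)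
      Real.continuous_fourierChar continuous_inner G.integrable h1)
  rw [e2, e3] at e1
  simp only [hGg] at e1
  simpa only [Complex.real_smul, smul_eq_mul] using e1.symm

theorem integral_norm_sq_eq {f : ℝ → ℂ} (h2 : MemLp f 2) :
    ∫ x, ‖f x‖ ^ 2 = (eLpNorm f 2 volume).toReal ^ 2 := by
  have h0 : 0 ≤ ∫ x, ‖f x‖ ^ 2 := integral_nonneg fun x => sq_nonneg _
  rw [h2.eLpNorm_eq_integral_rpow_norm two_ne_zero ENNReal.ofNat_ne_top]
  simp only [ENNReal.toReal_ofNat, Real.rpow_ofNat]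
  rw [ENNReal.toReal_ofReal (by positivity), ← Real.rpow_natCast, ← Real.rpow_mul h0]
  norm_num

theorem memLp_fourier {f : ℝ → ℂ} (h1 : Integrable f) (h2 : MemLp f 2) : MemLp (𝓕 f) 2 :=
  (Lp.memLp (𝓕 (h2.toLp f) : Lp ℂ 2 (volume : Measure ℝ))).ae_eq (fourier_toLp_ae_eq h1 h2)

/-- Plancherel's theorem. -/
theorem integral_norm_fourier_sq {f : ℝ → ℂ} (h1 : Integrable f) (h2 : MemLp f 2) :
    ∫ u, ‖𝓕 f u‖ ^ 2 = ∫ x, ‖f x‖ ^ 2 := by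
  rw [integral_norm_sq_eq h2, integral_norm_sq_eq (memLp_fourier h1 h2)]
  have h := Lp.norm_fourier_eq (h2.toLp f)
  rw [Lp.norm_def, Lp.norm_toLp, eLpNorm_congr_ae (fourier_toLp_ae_eq h1 h2)] at h
  rw [h]

/-! ### Fourier transforms of real functions and of their increments -/

theorem continuous_realFourier {f : ℝ → ℝ} (h1 : Integrable f) : Continuous (realFourier f) :=
  continuous_fourier_of_integrable h1.ofReal

theorem integrable_norm_realFourier_sq {f : ℝ → ℝ} (h1 : Integrable f) (h2 : MemLp f 2) :
    Integrable fun u => ‖realFourier f u‖ ^ 2 :=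
  (memLp_fourier h1.ofReal h2.ofReal).norm.integrable_sq

theorem integral_norm_realFourier_sq {f : ℝ → ℝ} (h1 : Integrable f) (h2 : MemLp f 2) :
    ∫ u, ‖realFourier f u‖ ^ 2 = ∫ x, f x ^ 2 := by
  refine (integral_norm_fourier_sq h1.ofReal h2.ofReal).trans ?_
  refine integral_congr_ae (Eventually.of_forall fun x => ?_)
  exact (by rw [Complex.norm_real, Real.norm_eq_abs, sq_abs] : ‖(f x : ℂ)‖ ^ 2 = f x ^ 2)

theorem realFourier_eq (f : ℝ → ℝ) (u : ℝ) :
    realFourier f u = ∫ x, (f x : ℂ) * Complex.exp ((-2 * Real.pi * x * u : ℝ) * Complex.I) := by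
  rw [realFourier, Real.fourier_real_eq_integral_exp_smul]
  simp only [smul_eq_mul, mul_comm]

theorem norm_realFourier_neg (f : ℝ → ℝ) (u : ℝ) : ‖realFourier f (-u)‖ = ‖realFourier f u‖ := by
  have h : realFourier f (-u) = (starRingEnd ℂ) (realFourier f u) := by
    rw [realFourier_eq, realFourier_eq, ← integral_conj]
    congr 1; ext x
    rw [map_mul, Complex.conj_ofReal, ← Complex.exp_conj, map_mul, Complex.conj_ofReal,
      Complex.conj_I]
    congr 2
    push_cast; ring
  rw [h, RCLike.norm_conj]

theorem norm_realFourier_le {f : ℝ → ℝ} (h0 : ∀ x, 0 ≤ f x) (h1 : Integrable f) (u : ℝ) :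
    ‖realFourier f u‖ ≤ ∫ x, f x := by
  rw [realFourier_eq]
  refine norm_integral_le_of_norm_le h1 (Eventually.of_forall fun t => ?_)
  rw [norm_mul, norm_exp_ofReal_mul_I', mul_one, Complex.norm_real, Real.norm_of_nonneg (h0 t)]

theorem integrable_mul_exp_fourier {f : ℝ → ℝ} (h1 : Integrable f) (u : ℝ) :
    Integrable fun x => (f x : ℂ) * Complex.exp ((-2 * Real.pi * x * u : ℝ) * Complex.I) :=
  h1.ofReal.mul_bdd (c := 1) (by fun_prop : Continuous fun x : ℝ =>
    Complex.exp ((-2 * Real.pi * x * u : ℝ) * Complex.I)).aestronglyMeasurable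
    (Eventually.of_forall fun x => (norm_exp_ofReal_mul_I' _).le)

theorem realFourier_comp_add_sub {f : ℝ → ℝ} (h1 : Integrable f) (v u : ℝ) :
    realFourier (fun x => f (x + v) - f x) u
      = (Complex.exp ((2 * Real.pi * v * u : ℝ) * Complex.I) - 1) * realFourier f u := by
  have hv := integrable_mul_exp_fourier (h1.comp_add_right v) u
  have e : ∫ x, (f (x + v) : ℂ) * Complex.exp ((-2 * Real.pi * x * u : ℝ) * Complex.I)
      = Complex.exp ((2 * Real.pi * v * u : ℝ) * Complex.I) * realFourier f u := by
    rw [realFourier_eq, ← integral_const_mul, ← integral_add_right_eq_self (fun x : ℝ =>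
      Complex.exp ((2 * Real.pi * v * u : ℝ) * Complex.I) * ((f x : ℂ) *
        Complex.exp ((-2 * Real.pi * x * u : ℝ) * Complex.I))) v]
    congr 1; ext x
    rw [mul_left_comm, ← Complex.exp_add]
    congr 2
    push_cast; ring
  rw [sub_mul, one_mul, ← e, realFourier_eq, realFourier_eq f,
    ← integral_sub hv (integrable_mul_exp_fourier h1 u)]
  congr 1; ext x
  push_cast; ring

theorem norm_exp_sub_one_sq (s : ℝ) :
    ‖Complex.exp ((2 * Real.pi * s : ℝ) * Complex.I) - 1‖ ^ 2 = 4 * Real.sin (Real.pi * s) ^ 2 := by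
  rw [← Complex.normSq_eq_norm_sq, Complex.normSq_apply, Complex.sub_re, Complex.sub_im,
    Complex.exp_ofReal_mul_I_re, Complex.exp_ofReal_mul_I_im, mul_assoc, Real.cos_two_mul,
    Real.sin_two_mul]
  simp only [Complex.one_re, Complex.one_im]
  have := Real.sin_sq_add_cos_sq (Real.pi * s)
  rw [show Real.cos (Real.pi * s) ^ 2 = 1 - Real.sin (Real.pi * s) ^ 2 by linarith]
  have e : (2 * Real.sin (Real.pi * s) * Real.cos (Real.pi * s) - 0)
      * (2 * Real.sin (Real.pi * s) * Real.cos (Real.pi * s) - 0)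
      = 4 * Real.sin (Real.pi * s) ^ 2 * Real.cos (Real.pi * s) ^ 2 := by ring
  rw [e, show Real.cos (Real.pi * s) ^ 2 = 1 - Real.sin (Real.pi * s) ^ 2 by linarith]
  ring

theorem norm_realFourier_comp_add_sub_sq {f : ℝ → ℝ} (h1 : Integrable f) (v u : ℝ) :
    ‖realFourier (fun x => f (x + v) - f x) u‖ ^ 2
      = 4 * Real.sin (Real.pi * (v * u)) ^ 2 * ‖realFourier f u‖ ^ 2 := by
  rw [realFourier_comp_add_sub h1, norm_mul, mul_pow, mul_assoc (2 * Real.pi), norm_exp_sub_one_sq]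

theorem memLp_two_comp_add_sub {f : ℝ → ℝ} (h2 : MemLp f 2) (v : ℝ) :
    MemLp (fun x => f (x + v) - f x) 2 :=
  (h2.comp_measurePreserving (measurePreserving_add_right volume v)).sub h2

theorem integral_comp_add_sub_sq {f : ℝ → ℝ} (h1 : Integrable f) (h2 : MemLp f 2) (v : ℝ) :
    ∫ x, (f (x + v) - f x) ^ 2
      = ∫ u, 4 * Real.sin (Real.pi * (v * u)) ^ 2 * ‖realFourier f u‖ ^ 2 := by
  have hi : Integrable fun x => f (x + v) - f x := (h1.comp_add_right v).sub h1
  rw [← integral_norm_realFourier_sq hi (memLp_two_comp_add_sub h2 v)]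
  simp only [norm_realFourier_comp_add_sub_sq h1]

/-- Since τtπz/2 = 2πt(τz/4), this is where τ' = τ/4 arises. The opposite sign of the frequency does
not affect the modulus. -/
theorem norm_densityChar (Ψ : ℝ → ℝ) (τ z : ℝ) :
    ‖densityChar Ψ τ z‖ = ‖realFourier (shapeDensity Ψ) (τ / 4 * z)‖ := by
  rw [← norm_realFourier_neg, realFourier_eq, densityChar]
  congr 3; ext t
  congr 4
  ring

/-! ## The fractional Sobolev seminorm -/

theorem measurable_sin_sq_div : Measurable fun y : ℝ => Real.sin (Real.pi * y) ^ 2 / y ^ 2 := by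
  fun_prop

theorem integrable_sin_sq_div : Integrable fun y : ℝ => Real.sin (Real.pi * y) ^ 2 / y ^ 2 := by
  refine (integrable_inv_one_add_sq.const_mul (Real.pi ^ 2 + 1)).mono'
    measurable_sin_sq_div.aestronglyMeasurable (Eventually.of_forall fun y => ?_)
  rw [Real.norm_of_nonneg (by positivity)]
  rcases eq_or_ne y 0 with rfl | hy
  · simp; positivity
  have hy2 : 0 < y ^ 2 := by positivity
  rw [← div_eq_mul_inv, div_le_div_iff₀ hy2 (by positivity)]
  have h1 : Real.sin (Real.pi * y) ^ 2 ≤ 1 := Real.sin_sq_le_one _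
  have h2 : Real.sin (Real.pi * y) ^ 2 ≤ Real.pi ^ 2 * y ^ 2 := by
    rw [← mul_pow]
    exact sq_le_sq.2 Real.abs_sin_le_abs
  nlinarith

theorem integrable_sin_mul_sq_div (u : ℝ) :
    Integrable fun z : ℝ => Real.sin (Real.pi * (z * u)) ^ 2 / z ^ 2 := by
  rcases eq_or_ne u 0 with rfl | hu
  · simp
  refine ((integrable_sin_sq_div.comp_mul_right' hu).const_mul (u ^ 2)).congr
    (Eventually.of_forall fun z => ?_)
  simp only [mul_pow]
  field_simp

/-- By scaling the integral is proportional to |u|, which is how the weight of the Sobolev seminorm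
appears. Only the finiteness of the constant matters, not its value. -/
theorem integral_sin_mul_sq_div (u : ℝ) :
    ∫ z : ℝ, Real.sin (Real.pi * (z * u)) ^ 2 / z ^ 2
      = |u| * ∫ y : ℝ, Real.sin (Real.pi * y) ^ 2 / y ^ 2 := by
  rcases eq_or_ne u 0 with rfl | hu
  · simp
  have e : ∫ z : ℝ, Real.sin (Real.pi * (z * u)) ^ 2 / z ^ 2
      = u ^ 2 * ∫ z : ℝ, Real.sin (Real.pi * (z * u)) ^ 2 / (z * u) ^ 2 := by
    rw [← integral_const_mul]
    congr 1; ext z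
    rw [mul_pow z]
    field_simp
  rw [e, Measure.integral_comp_mul_right (fun y : ℝ => Real.sin (Real.pi * y) ^ 2 / y ^ 2) u,
    smul_eq_mul, ← mul_assoc, abs_inv, ← sq_abs]
  have := abs_pos.2 hu
  field_simp

theorem integrable_mul_sin_sq_div {w : ℝ → ℝ} (hw : Integrable fun u => w u * |u|)
    (hwm : Measurable w) :
    Integrable fun p : ℝ × ℝ => w p.1 * (Real.sin (Real.pi * (p.2 * p.1)) ^ 2 / p.2 ^ 2) := by
  have hm : Measurable fun p : ℝ × ℝ =>
      w p.1 * (Real.sin (Real.pi * (p.2 * p.1)) ^ 2 / p.2 ^ 2) := by fun_prop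
  refine (integrable_prod_iff hm.aestronglyMeasurable).2 ⟨Eventually.of_forall fun u =>
    (integrable_sin_mul_sq_div u).const_mul (w u), ?_⟩
  refine (hw.norm.mul_const (∫ y : ℝ, Real.sin (Real.pi * y) ^ 2 / y ^ 2)).congr
    (Eventually.of_forall fun u => ?_)
  simp only [norm_mul]
  rw [integral_const_mul]
  have : ∀ z : ℝ, ‖Real.sin (Real.pi * (z * u)) ^ 2 / z ^ 2‖
      = Real.sin (Real.pi * (z * u)) ^ 2 / z ^ 2 := fun z => Real.norm_of_nonneg (by positivity)
  simp only [this, integral_sin_mul_sq_div]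
  rw [Real.norm_eq_abs |u|, abs_abs]
  ring

/-- The squared difference quotient in the coordinates `(x - y, y)`. -/
theorem aestronglyMeasurable_diffQuot {f : ℝ → ℝ} (hf : AEStronglyMeasurable f) :
    AEStronglyMeasurable (fun p : ℝ × ℝ => ((f (p.2 + p.1) - f p.2) / p.1) ^ 2)
      (volume.prod volume) := by
  have h1 : AEStronglyMeasurable (fun p : ℝ × ℝ => f (p.1 + p.2)) (volume.prod volume) :=
    hf.comp_fst.comp_measurePreserving (measurePreserving_add_prod volume volume)
  have h1' : AEStronglyMeasurable (fun p : ℝ × ℝ => f (p.2 + p.1)) (volume.prod volume) := by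
    simpa only [add_comm] using h1
  have h2 : AEStronglyMeasurable (fun p : ℝ × ℝ => f (p.2 + p.1) - f p.2) (volume.prod volume) :=
    h1'.sub hf.comp_snd
  simp only [div_eq_mul_inv]
  exact (h2.mul measurable_fst.inv.aestronglyMeasurable).pow 2

theorem integral_diffQuot {f : ℝ → ℝ} (h1 : Integrable f) (h2 : MemLp f 2) (z : ℝ) :
    ∫ x, ((f (x + z) - f x) / z) ^ 2
      = 4 * ∫ u, ‖realFourier f u‖ ^ 2 * (Real.sin (Real.pi * (z * u)) ^ 2 / z ^ 2) := by
  simp only [div_pow]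
  rw [integral_div, integral_comp_add_sub_sq h1 h2, ← integral_const_mul, ← integral_div]
  congr 1; ext u
  ring

theorem integrable_diffQuot {f : ℝ → ℝ} (h1 : Integrable f) (h2 : MemLp f 2)
    (hw : Integrable fun u => ‖realFourier f u‖ ^ 2 * |u|) :
    Integrable fun p : ℝ × ℝ => ((f (p.2 + p.1) - f p.2) / p.1) ^ 2 := by
  refine (integrable_prod_iff (aestronglyMeasurable_diffQuot h1.1)).2
    ⟨Eventually.of_forall fun z => ?_, ?_⟩
  · simp only [div_pow]
    exact (memLp_two_comp_add_sub h2 z).integrable_sq.div_const _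
  · have hG := (integrable_mul_sin_sq_div hw
      ((continuous_realFourier h1).norm.pow 2).measurable).integral_prod_right
    refine (hG.const_mul 4).congr (Eventually.of_forall fun z => ?_)
    simp only [Real.norm_of_nonneg (sq_nonneg _)]
    rw [integral_diffQuot h1 h2]

theorem integrable_gagliardo {f : ℝ → ℝ} (h1 : Integrable f) (h2 : MemLp f 2)
    (hw : Integrable fun u => ‖realFourier f u‖ ^ 2 * |u|) :
    Integrable fun p : ℝ × ℝ => ((f p.1 - f p.2) / (p.1 - p.2)) ^ 2 := by
  have h := (measurePreserving_sub_prod (volume : Measure ℝ)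
    (volume : Measure ℝ)).integrable_comp_of_integrable (integrable_diffQuot h1 h2 hw)
  refine h.congr (Eventually.of_forall fun p => ?_)
  simp

/-- In the coordinates z = x-y and y, Plancherel in y turns the increment of f into 4
sin²(πzu)|f̂(u)|², and Fubini exchanges z and u. The bounded factor b will be |Φ̂(κz)|². -/
theorem integral_gagliardo_mul {f : ℝ → ℝ} (h1 : Integrable f) (h2 : MemLp f 2)
    (hw : Integrable fun u => ‖realFourier f u‖ ^ 2 * |u|) {b : ℝ → ℝ} (hb : Continuous b) {C : ℝ}
    (hC : ∀ z, ‖b z‖ ≤ C) :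
    Integrable (fun u => ‖realFourier f u‖ ^ 2 *
      ∫ z, Real.sin (Real.pi * (z * u)) ^ 2 / z ^ 2 * b z) ∧
    ∫ p : ℝ × ℝ, ((f p.1 - f p.2) / (p.1 - p.2)) ^ 2 * b (p.1 - p.2)
      = 4 * ∫ u, ‖realFourier f u‖ ^ 2 *
        ∫ z, Real.sin (Real.pi * (z * u)) ^ 2 / z ^ 2 * b z := by
  have hH := integrable_diffQuot h1 h2 hw
  have hHb : Integrable (fun p : ℝ × ℝ => ((f (p.2 + p.1) - f p.2) / p.1) ^ 2 * b p.1)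
      (volume.prod volume) :=
    hH.mul_bdd (c := C) (hb.comp continuous_fst).aestronglyMeasurable
      (Eventually.of_forall fun p => hC p.1)
  have hG : Integrable (fun p : ℝ × ℝ => ‖realFourier f p.1‖ ^ 2 *
      (Real.sin (Real.pi * (p.2 * p.1)) ^ 2 / p.2 ^ 2) * b p.2) (volume.prod volume) :=
    (integrable_mul_sin_sq_div hw ((continuous_realFourier h1).norm.pow 2).measurable).mul_bdd
      (c := C) (hb.comp continuous_snd).aestronglyMeasurable
      (Eventually.of_forall fun p => hC p.2)
  have e0 : ∀ u, ∫ z, ‖realFourier f u‖ ^ 2 * (Real.sin (Real.pi * (z * u)) ^ 2 / z ^ 2) * b z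
      = ‖realFourier f u‖ ^ 2 * ∫ z, Real.sin (Real.pi * (z * u)) ^ 2 / z ^ 2 * b z := fun u => by
    rw [← integral_const_mul]
    simp only [mul_assoc]
  refine ⟨by simpa only [e0] using hG.integral_prod_left, ?_⟩
  have hS := measurePreserving_sub_prod (volume : Measure ℝ) (volume : Measure ℝ)
  have e1 : ∫ p : ℝ × ℝ, ((f p.1 - f p.2) / (p.1 - p.2)) ^ 2 * b (p.1 - p.2)
      = ∫ p : ℝ × ℝ, ((f (p.2 + p.1) - f p.2) / p.1) ^ 2 * b p.1 := by
    have := integral_map hS.aemeasurable (hS.map_eq.symm ▸ hHb.aestronglyMeasurable)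
    rw [hS.map_eq] at this
    rw [Measure.volume_eq_prod, this]
    simp
  have e2 : ∫ p : ℝ × ℝ, ((f (p.2 + p.1) - f p.2) / p.1) ^ 2 * b p.1
      = ∫ z, 4 * ∫ u, ‖realFourier f u‖ ^ 2 *
        (Real.sin (Real.pi * (z * u)) ^ 2 / z ^ 2) * b z := by
    rw [Measure.volume_eq_prod, integral_prod _ hHb]
    congr 1; ext z
    simp only
    rw [integral_mul_const, integral_diffQuot h1 h2, integral_mul_const, mul_assoc]
  rw [e1, e2, integral_const_mul, ← integral_integral_swap hG]
  simp only [e0]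

/-! ## The overlap of a shape with its translates -/

/-- The overlap `∫ Ψ(t) (1 - Ψ(t + v)) dt`. -/
noncomputable def shapeOverlap (Ψ : ℝ → ℝ) (v : ℝ) : ℝ := ∫ t, Ψ t * (1 - Ψ (t + v))

/-- The squared `L²` distance between a shape and its translate. -/
noncomputable def shapeShift (Ψ : ℝ → ℝ) (v : ℝ) : ℝ := ∫ t, (Ψ (t + v) - Ψ t) ^ 2

namespace IsExpShape

variable {Ψ : ℝ → ℝ}

theorem integrable_mul_one_sub_symm (hΨ : IsExpShape Ψ) (v : ℝ) :
    Integrable fun t => Ψ (t + v) * (1 - Ψ t) := by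
  refine ((hΨ.integrable_mul_one_sub (-v)).comp_add_right v).congr
    (Eventually.of_forall fun t => ?_)
  simp

theorem integrable_comp_add_sub (hΨ : IsExpShape Ψ) (v : ℝ) :
    Integrable fun t => Ψ (t + v) - Ψ t := by
  refine ((hΨ.integrable_mul_one_sub_symm v).sub (hΨ.integrable_mul_one_sub v)).congr
    (Eventually.of_forall fun t => ?_)
  simp only [Pi.sub_apply]; ring

theorem integrable_comp_add_sub_sq (hΨ : IsExpShape Ψ) (v : ℝ) :
    Integrable fun t => (Ψ (t + v) - Ψ t) ^ 2 := by
  have hc := hΨ.continuous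
  refine (hΨ.integrable_comp_add_sub v).norm.mono'
    (by fun_prop : Continuous fun t => (Ψ (t + v) - Ψ t) ^ 2).aestronglyMeasurable
    (Eventually.of_forall fun t => ?_)
  rw [norm_pow, sq]
  refine mul_le_of_le_one_left (norm_nonneg _) ?_
  obtain ⟨a1, a2⟩ := hΨ.mem_Icc (t + v)
  obtain ⟨b1, b2⟩ := hΨ.mem_Icc t
  rw [Real.norm_eq_abs, abs_le]
  constructor <;> linarith

theorem memLp_comp_add_sub (hΨ : IsExpShape Ψ) (v : ℝ) : MemLp (fun t => Ψ (t + v) - Ψ t) 2 :=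
  (memLp_two_iff_integrable_sq (hΨ.integrable_comp_add_sub v).1).2 (hΨ.integrable_comp_add_sub_sq v)

/-- Pointwise, a(1-b) + b(1-a) = a(1-a) + b(1-b) + (a-b)² with a = Ψ(t) and b = Ψ(t+v); each term is
integrable, and translation invariance identifies the integrals. -/
theorem overlap_add_overlap_neg (hΨ : IsExpShape Ψ) (v : ℝ) :
    shapeOverlap Ψ v + shapeOverlap Ψ (-v) = 2 * shapeB2 Ψ + shapeShift Ψ v := by
  have h0 : Integrable fun t => Ψ t * (1 - Ψ t) := by simpa using hΨ.integrable_mul_one_sub 0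
  have e1 : shapeOverlap Ψ (-v) = ∫ t, Ψ (t + v) * (1 - Ψ t) := by
    rw [shapeOverlap, ← integral_add_right_eq_self _ v]
    simp
  have e2 : shapeB2 Ψ = ∫ t, Ψ (t + v) * (1 - Ψ (t + v)) :=
    (integral_add_right_eq_self (fun t => Ψ t * (1 - Ψ t)) v).symm
  have h0' : Integrable fun t => Ψ (t + v) * (1 - Ψ (t + v)) := h0.comp_add_right v
  have h3 : Integrable fun t => Ψ t * (1 - Ψ t) + Ψ (t + v) * (1 - Ψ (t + v)) := h0.add h0'
  rw [two_mul]
  nth_rewrite 2 [e2]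
  rw [e1, shapeOverlap, shapeShift, shapeB2, ← integral_add h0 h0',
    ← integral_add h3 (hΨ.integrable_comp_add_sub_sq v),
    ← integral_add (hΨ.integrable_mul_one_sub v) (hΨ.integrable_mul_one_sub_symm v)]
  congr 1; ext t
  ring

theorem overlap_nonneg (hΨ : IsExpShape Ψ) (v : ℝ) : 0 ≤ shapeOverlap Ψ v :=
  integral_nonneg fun t => mul_nonneg (hΨ.mem_Icc t).1 (sub_nonneg.2 (hΨ.mem_Icc _).2)

theorem monotone_overlap (hΨ : IsExpShape Ψ) : Monotone (shapeOverlap Ψ) := fun a b hab =>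
  integral_mono (hΨ.integrable_mul_one_sub a) (hΨ.integrable_mul_one_sub b) fun t =>
    mul_le_mul_of_nonneg_left (sub_le_sub_left (hΨ.antitone (by linarith)) 1) (hΨ.mem_Icc t).1

/-- Ψ itself is not integrable but its increments are. Their derivative is minus the increment of
the density, whose transform is that of the density times e^{2πivξ} - 1; differentiation multiplies
the transform by 2πiξ. -/
theorem sq_mul_norm_realFourier_comp_add_sub_sq (hΨ : IsExpShape Ψ) (v ξ : ℝ) :
    Real.pi ^ 2 * ξ ^ 2 * ‖realFourier (fun t => Ψ (t + v) - Ψ t) ξ‖ ^ 2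
      = Real.sin (Real.pi * (v * ξ)) ^ 2 * ‖realFourier (shapeDensity Ψ) ξ‖ ^ 2 := by
  set g : ℝ → ℂ := fun t => ((Ψ (t + v) - Ψ t : ℝ) : ℂ) with hg
  set d : ℝ → ℝ := fun t => shapeDensity Ψ (t + v) - shapeDensity Ψ t with hd
  have hder : ∀ t, HasDerivAt g (-(d t : ℂ)) t := fun t => by
    have h := (((hΨ.hasDerivAt (t + v)).comp_add_const t v).sub (hΨ.hasDerivAt t)).ofReal_comp
    refine h.congr_deriv ?_
    simp only [hd]; push_cast; ring
  have hderiv : deriv g = fun t => -(d t : ℂ) := funext fun t => (hder t).deriv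
  have hdi : Integrable d := (hΨ.integrable_density.comp_add_right v).sub hΨ.integrable_density
  have h := congrFun (Real.fourier_deriv (f := g) (hΨ.integrable_comp_add_sub v).ofReal
    (fun t => (hder t).differentiableAt) (by rw [hderiv]; exact hdi.ofReal.neg)) ξ
  have hneg : 𝓕 (deriv g) ξ = -realFourier d ξ := by
    rw [hderiv, realFourier, Real.fourier_real_eq, Real.fourier_real_eq, ← integral_neg]
    simp only [smul_neg]
  have hn := congrArg (fun z => ‖z‖ ^ 2) (hneg.symm.trans h)
  simp only [norm_neg, norm_smul, norm_mul, mul_pow, hd] at hn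
  rw [norm_realFourier_comp_add_sub_sq hΨ.integrable_density] at hn
  simp only [Complex.norm_ofNat, Complex.norm_real, Complex.norm_I, Real.norm_eq_abs, sq_abs] at hn
  have hr : realFourier (fun t => Ψ (t + v) - Ψ t) ξ = 𝓕 g ξ := rfl
  rw [hr]
  linarith

theorem shift_eq (hΨ : IsExpShape Ψ) (v : ℝ) :
    shapeShift Ψ v = ∫ ξ, Real.sin (Real.pi * (v * ξ)) ^ 2 / (Real.pi ^ 2 * ξ ^ 2)
      * ‖realFourier (shapeDensity Ψ) ξ‖ ^ 2 := by
  rw [shapeShift, ← integral_norm_realFourier_sq (hΨ.integrable_comp_add_sub v)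
    (hΨ.memLp_comp_add_sub v)]
  refine integral_congr_ae ?_
  have h0 : ∀ᵐ ξ : ℝ, ξ ≠ 0 := by simp [ae_iff]
  filter_upwards [h0] with ξ hξ
  have := Real.pi_pos.ne'
  rw [div_mul_eq_mul_div, eq_div_iff (by positivity), ← hΨ.sq_mul_norm_realFourier_comp_add_sub_sq]
  ring

theorem shift_div_eq (hΨ : IsExpShape Ψ) {κ : ℝ} (hκ : 0 < κ) (u : ℝ) :
    shapeShift Ψ (u / κ) = 1 / (κ * Real.pi ^ 2) *
      ∫ z, Real.sin (Real.pi * (z * u)) ^ 2 / z ^ 2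
        * ‖realFourier (shapeDensity Ψ) (κ * z)‖ ^ 2 := by
  have h := Measure.integral_comp_mul_left (fun ξ => Real.sin (Real.pi * (u / κ * ξ)) ^ 2 /
    (Real.pi ^ 2 * ξ ^ 2) * ‖realFourier (shapeDensity Ψ) ξ‖ ^ 2) κ
  rw [← hΨ.shift_eq, smul_eq_mul, abs_of_pos (inv_pos.2 hκ)] at h
  have h2 : shapeShift Ψ (u / κ) = κ * ∫ z, Real.sin (Real.pi * (u / κ * (κ * z))) ^ 2 /
    (Real.pi ^ 2 * (κ * z) ^ 2) * ‖realFourier (shapeDensity Ψ) (κ * z)‖ ^ 2 := by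
    rw [h, mul_inv_cancel_left₀ hκ.ne']
  rw [h2, ← integral_const_mul, ← integral_const_mul]
  congr 1; ext z
  have e : u / κ * (κ * z) = z * u := by field_simp
  rw [e, mul_pow]
  rcases eq_or_ne z 0 with rfl | hz
  · simp
  have := Real.pi_pos.ne'
  field_simp

end IsExpShape

/-! ## The two expressions of the limiting variance -/

/-- Since |f̂|² is even, the overlap may be symmetrized, which produces 2B² and the squared shift
distance. The former gives ∫ f² by Plancherel; the latter, after ξ = κz, gives the same double
integral in u and z as the weighted difference quotient. -/
theorem integrable_and_limit_eq {Ψ : ℝ → ℝ} (hΨ : IsExpShape Ψ) {f : ℝ → ℝ} (h1 : Integrable f)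
    (h2 : MemLp f 2) (hw : Integrable fun u => ‖realFourier f u‖ ^ 2 * |u|) {κ : ℝ} (hκ : 0 < κ) :
    Integrable (fun u => ‖realFourier f u‖ ^ 2 * shapeOverlap Ψ (u / κ)) ∧
    2 * κ * ∫ u, ‖realFourier f u‖ ^ 2 * shapeOverlap Ψ (u / κ)
      = 2 * κ * shapeB2 Ψ * (∫ x, f x ^ 2) + 1 / (4 * Real.pi ^ 2) *
        ∫ p : ℝ × ℝ, ((f p.1 - f p.2) / (p.1 - p.2)) ^ 2
          * ‖realFourier (shapeDensity Ψ) (κ * (p.1 - p.2))‖ ^ 2 := by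
  have hb : Continuous fun z => ‖realFourier (shapeDensity Ψ) (κ * z)‖ ^ 2 := by
    have := continuous_realFourier hΨ.integrable_density
    fun_prop
  obtain ⟨hI, hE⟩ := integral_gagliardo_mul h1 h2 hw hb (C := (∫ t, shapeDensity Ψ t) ^ 2)
    fun z => by
      rw [norm_pow, norm_norm]
      gcongr
      exact norm_realFourier_le hΨ.density_nonneg hΨ.integrable_density _
  set w : ℝ → ℝ := fun u => ‖realFourier f u‖ ^ 2 with hwdef
  have hw0 : ∀ u, 0 ≤ w u := fun u => sq_nonneg _
  have hwi : Integrable w := integrable_norm_realFourier_sq h1 h2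
  have hwc : Continuous w := (continuous_realFourier h1).norm.pow 2
  have hweven : ∀ u, w (-u) = w u := fun u => by simp only [hwdef, norm_realFourier_neg]
  have hS : Integrable fun u => w u * shapeShift Ψ (u / κ) := by
    refine (hI.const_mul (1 / (κ * Real.pi ^ 2))).congr (Eventually.of_forall fun u => ?_)
    simp only
    rw [hΨ.shift_div_eq hκ]; ring
  have hSe : ∫ u, w u * shapeShift Ψ (u / κ) = 1 / (κ * Real.pi ^ 2) * ∫ u, w u *
      ∫ z, Real.sin (Real.pi * (z * u)) ^ 2 / z ^ 2
        * ‖realFourier (shapeDensity Ψ) (κ * z)‖ ^ 2 := by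
    rw [← integral_const_mul]
    congr 1; ext u
    rw [hΨ.shift_div_eq hκ]; ring
  have hsum : ∀ u, w u * shapeOverlap Ψ (u / κ) + w u * shapeOverlap Ψ (-u / κ)
      = w u * (2 * shapeB2 Ψ) + w u * shapeShift Ψ (u / κ) := fun u => by
    rw [← mul_add, neg_div, hΨ.overlap_add_overlap_neg, mul_add]
  have hT : Integrable fun u => w u * (2 * shapeB2 Ψ) + w u * shapeShift Ψ (u / κ) :=
    (hwi.mul_const _).add hS
  -- The overlap is nonnegative, so it is dominated by its sum with its reflection, already known to
  -- be integrable; measurability comes from monotonicity.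
  have hD : Integrable fun u => w u * shapeOverlap Ψ (u / κ) := by
    refine hT.mono' (hwc.measurable.mul (hΨ.monotone_overlap.measurable.comp
      (measurable_id.div_const κ))).aestronglyMeasurable (Eventually.of_forall fun u => ?_)
    rw [Real.norm_of_nonneg (mul_nonneg (hw0 u) (hΨ.overlap_nonneg _)), ← hsum]
    exact le_add_of_nonneg_right (mul_nonneg (hw0 u) (hΨ.overlap_nonneg _))
  have hD' : Integrable fun u => w u * shapeOverlap Ψ (-u / κ) :=
    hD.comp_neg.congr (Eventually.of_forall fun u => by simp only [hweven])
  have hDe : ∫ u, w u * shapeOverlap Ψ (-u / κ) = ∫ u, w u * shapeOverlap Ψ (u / κ) := by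
    rw [← integral_neg_eq_self fun u => w u * shapeOverlap Ψ (u / κ)]
    simp only [hweven]
  refine ⟨hD, ?_⟩
  have hkey : 2 * ∫ u, w u * shapeOverlap Ψ (u / κ)
      = (∫ u, w u) * (2 * shapeB2 Ψ) + ∫ u, w u * shapeShift Ψ (u / κ) := by
    rw [two_mul]
    nth_rewrite 2 [← hDe]
    rw [← integral_add hD hD', ← integral_mul_const, ← integral_add (hwi.mul_const _) hS]
    simp only [hsum]
  have hP : ∫ u, w u = ∫ x, f x ^ 2 := integral_norm_realFourier_sq h1 h2
  rw [hP, hSe] at hkey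
  obtain ⟨J, hJ⟩ : ∃ J, J = ∫ u, w u * ∫ z, Real.sin (Real.pi * (z * u)) ^ 2 / z ^ 2
      * ‖realFourier (shapeDensity Ψ) (κ * z)‖ ^ 2 := ⟨_, rfl⟩
  rw [← hJ] at hkey
  rw [hE.trans (congrArg (4 * ·) hJ.symm), mul_comm 2 κ, mul_assoc κ 2, hkey]
  have := Real.pi_pos.ne'
  field_simp

/-! ## The main theorem -/

theorem mainTheorem4 (Ψ : ℝ → ℝ) (hΨ : IsExpShape Ψ) (f : ℝ → ℝ) (hf : IsHHalfCompact f)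
    (α : ℝ) (hα0 : 0 < α) (hα1 : α < 1) (τ : ℝ) (hτ : 0 < τ)
    (Ω : ℝ → Type*) [∀ N, MeasurableSpace (Ω N)]
    (P : (N : ℝ) → Measure (Ω N)) [∀ N, IsProbabilityMeasure (P N)]
    (X : (N : ℝ) → PointProcess (Ω N))
    (hX : ∀ N : ℝ, 0 < N → (X N).IsDeterminantal (P N) (modifiedGUEKernel Ψ α τ N)) :
    -- the variances are well defined and finite
    (∀ N : ℝ, 0 < N → MemLp ((X N).linearStatistic (rescaledTest f α N)) 2 (P N)) ∧
    -- the integrals in the limit are absolutely convergent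
    (∀ u : ℝ, Integrable fun t : ℝ => Ψ t * (1 - Ψ (t + u / (τ / 4)))) ∧
    (Integrable fun u : ℝ =>
      ‖realFourier f u‖ ^ 2 * ∫ t : ℝ, Ψ t * (1 - Ψ (t + u / (τ / 4)))) ∧
    (Integrable fun p : ℝ × ℝ =>
      |(f p.1 - f p.2) / (p.1 - p.2)| ^ 2 *
        ‖realFourier (shapeDensity Ψ) (τ / 4 * (p.1 - p.2))‖ ^ 2) ∧
    -- convergence of the variance
    Tendsto (fun N : ℝ => variance ((X N).linearStatistic (rescaledTest f α N)) (P N)) atTop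
      (𝓝 (2 * (τ / 4) * ∫ u : ℝ,
        ‖realFourier f u‖ ^ 2 * ∫ t : ℝ, Ψ t * (1 - Ψ (t + u / (τ / 4))))) ∧
    -- the second expression of the limit
    2 * (τ / 4) * (∫ u : ℝ, ‖realFourier f u‖ ^ 2 * ∫ t : ℝ, Ψ t * (1 - Ψ (t + u / (τ / 4))))
      = 2 * (τ / 4) * shapeB2 Ψ * (∫ x : ℝ, f x ^ 2)
        + 1 / (4 * Real.pi ^ 2) * ∫ p : ℝ × ℝ,
            |(f p.1 - f p.2) / (p.1 - p.2)| ^ 2 *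
              ‖realFourier (shapeDensity Ψ) (τ / 4 * (p.1 - p.2))‖ ^ 2 := by
  obtain ⟨R, hR⟩ : ∃ R : ℝ, ∀ x, R < |x| → f x = 0 := by
    obtain ⟨R, hR⟩ := hf.hasCompactSupport.isBounded.exists_norm_le
    refine ⟨R, fun x hx => image_eq_zero_of_notMem_tsupport fun h => ?_⟩
    exact absurd (hR x h) (not_le.2 hx)
  have h2 := hf.memLp
  have h1 := integrable_of_memLp_two_of_hasCompactSupport h2 hf.hasCompactSupport
  have hκ : 0 < τ / 4 := by positivity
  have hG := integrable_gagliardo h1 h2 hf.integrable_fourier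
  obtain ⟨hD, hE⟩ := integrable_and_limit_eq hΨ h1 h2 hf.integrable_fourier hκ
  simp only [shapeOverlap] at hD hE
  have hvar := fun N (hN : 0 < N) =>
    variance_rescaledTest hΨ h2 hf.hasCompactSupport hτ hN (hX N hN)
  simp only [sq_abs]
  refine ⟨fun N hN => (hvar N hN).1, fun u => hΨ.integrable_mul_one_sub _, hD, ?_, ?_, hE⟩
  · have hb : Continuous fun p : ℝ × ℝ =>
        ‖realFourier (shapeDensity Ψ) (τ / 4 * (p.1 - p.2))‖ ^ 2 := by
      have := continuous_realFourier hΨ.integrable_density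
      fun_prop
    exact hG.mul_bdd (c := (∫ t, shapeDensity Ψ t) ^ 2) hb.aestronglyMeasurable
      (Eventually.of_forall fun p => by
        rw [norm_pow, norm_norm]
        gcongr
        exact norm_realFourier_le hΨ.density_nonneg hΨ.integrable_density _)
  · have hA := tendsto_integral_mul_oscKernel_self hΨ hα0 hα1 hτ h2.integrable_sq (R := R)
      fun x hx => by rw [hR x hx]; ring
    have hB := (tendsto_integral_sub_sq_mul_oscKernel_sq hΨ hα0 hα1 hτ h2 hR hG).const_mul (1 / 2)
    have hlim := hA.add hB
    simp only [norm_densityChar] at hlim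
    -- The probabilistic limit is obtained in its second form, so the target is first rewritten by
    -- the Fourier identity.
    rw [hE]
    have e : ∀ a b : ℝ, τ / 2 * shapeB2 Ψ * a + 1 / 2 * (1 / (2 * Real.pi ^ 2) * b)
        = 2 * (τ / 4) * shapeB2 Ψ * a + 1 / (4 * Real.pi ^ 2) * b := fun a b => by
      have := Real.pi_pos.ne'
      field_simp
      ring
    rw [e] at hlim
    refine hlim.congr' ?_
    filter_upwards [eventually_gt_atTop 0] with N hN
    exact (hvar N hN).2.symm
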